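/- Let $k\ge 3$ be an integer, $d\in\mathbb{N}$ and $a\in\mathbb{R}\setminus\{0\}$ with $$a^2<\frac{4d(d+k-2)}{(k-2)^2}.$$ Let $E_a=\{x\in\mathbb{R}^{k+1} : a^{-2}x_1^2+x_2^2+\dots+x_{k+1}^2=1\}$ be the $k$-dimensional ellipsoid with the metric induced from $\mathbb{R}^{k+1}$, with the coordinates $(\psi,\theta)\mapsto(a\cos\psi,\ \sin\psi\,\theta)$, $\psi\in[0,\pi]$, $\theta\in\mathbb{S}^{k-1}\subset\mathbb{R}^k$, and put $m(t)=a^2\sin^2t+\cos^2t$. A smooth map between Riemannian manifolds is harmonic if its tension field $\operatorname{Tr}\nabla du$ vanishes; an eigenmap of $\mathbb{S}^{k-1}$ of degree $d$ is a harmonic map $\chi:\mathbb{S}^{k-1}\to\mathbb{S}^{k-1}$ with $|d\chi|^2=d(d+k-2)$ everywhere. Then the following hold. 1. $E_a$ admits infinitely many harmonic self-maps. 2. There are infinitely many continuous functions $f:[0,\pi]\to\mathbb{R}$, twice continuously differentiable on $(0,\pi)$, with $f(0)=0$, $f(\pi)=\ell\pi$ for some $\ell\in\mathbb{Z}$ (which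 may depend on $f$), and, on $(0,\pi)$, $$f''=\frac{d(d+k-2)}{2}\,\frac{m(\psi)}{m(f)}\,\frac{\sin 2f}{\sin^2\psi}-(k-1)\cot\psi\, f'-\frac{a^2-1}{2}\,\frac{\sin 2f}{m(f)}\,f'^2+\frac{a^2-1}{2}\,\frac{\sin 2\psi}{m(\psi)}\,f'.$$ 3. For every eigenmap $\chi$ of $\mathbb{S}^{k-1}$ of degree $d$ there are infinitely many harmonic self-maps of $E_a$ of the form $(\psi,\theta)\mapsto(f(\psi),\chi(\theta))$ with $f$ as in 2. -/

import Mathlib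

open scoped ContDiff

noncomputable section

/-! # Ellipsoids in Euclidean space and harmonic maps between them -/

/-- The ellipsoid `{x ∈ ℝⁿ | ∑ cᵢ xᵢ² = 1}` with weights `cᵢ > 0`. -/
def ellipsoid {n : ℕ} (c : Fin n → ℝ) : Set (EuclideanSpace ℝ (Fin n)) :=
  {x | ∑ i, c i * x i ^ 2 = 1}

/-- Half the gradient of `x ↦ ∑ cᵢ xᵢ²`: a normal vector field of the ellipsoid. -/
def normalVec {n : ℕ} (c : Fin n → ℝ) (x : EuclideanSpace ℝ (Fin n)) :
    EuclideanSpace ℝ (Fin n) :=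
  WithLp.toLp 2 (fun i => c i * x i)

/-- The tangent space of the ellipsoid at `x`, as a linear subspace of `ℝⁿ`. It carries the
restriction of the Euclidean inner product, i.e. the induced Riemannian metric. -/
def tangentPlane {n : ℕ} (c : Fin n → ℝ) (x : EuclideanSpace ℝ (Fin n)) :
    Submodule ℝ (EuclideanSpace ℝ (Fin n)) :=
  (Submodule.span ℝ {normalVec c x})ᗮ

/-- The orthogonal projection of `v` onto the tangent space at `x`. -/
def tangentProj {n : ℕ} (c : Fin n → ℝ) (x v : EuclideanSpace ℝ (Fin n)) :
    EuclideanSpace ℝ (Fin n) :=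
  (tangentPlane c x).starProjection v

/-- `U` is a smooth map, defined near the ellipsoid, that restricts to the self-map `u` of the
ellipsoid. A self-map of the ellipsoid is smooth if and only if it has such an extension. -/
def IsSmoothExtension {n : ℕ} (c : Fin n → ℝ) (u : ellipsoid c → ellipsoid c)
    (U : EuclideanSpace ℝ (Fin n) → EuclideanSpace ℝ (Fin n)) : Prop :=
  (∃ O : Set (EuclideanSpace ℝ (Fin n)), IsOpen O ∧ ellipsoid c ⊆ O ∧ ContDiffOn ℝ ∞ U O) ∧
    ∀ x : ellipsoid c, U x = u x

/-- The covariant Hessian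
`(∇du)(v, w) = ∇_v (du(W)) - du(∇_v W)`, at a point `x` of the ellipsoid and for `v, w` tangent
at `x`, of the self-map `u` with smooth extension `U`.
Here `W(y) = tangentProj c y w` is a tangent vector field with `W(x) = w`, and the Levi-Civita
connection of the induced metric, as well as its pull-back along `u`, is the tangential
projection of the Euclidean directional derivative. The value depends only on `u`. -/
def covHessian {n : ℕ} (c : Fin n → ℝ) (U : EuclideanSpace ℝ (Fin n) → EuclideanSpace ℝ (Fin n))
    (x v w : EuclideanSpace ℝ (Fin n)) : EuclideanSpace ℝ (Fin n) :=
  tangentProj c (U x) (fderiv ℝ (fun y => fderiv ℝ U y (tangentProj c y w)) x v) -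
    fderiv ℝ U x (tangentProj c x (fderiv ℝ (fun y => tangentProj c y w) x v))

/-- The tension field `τ(u) = Tr_g ∇du` at a point `x` of the ellipsoid: the trace is taken over
an orthonormal basis of the tangent space. -/
def tensionField {n : ℕ} (c : Fin n → ℝ)
    (U : EuclideanSpace ℝ (Fin n) → EuclideanSpace ℝ (Fin n))
    (x : EuclideanSpace ℝ (Fin n)) : EuclideanSpace ℝ (Fin n) :=
  ∑ i, covHessian c U x (stdOrthonormalBasis ℝ (tangentPlane c x) i)
    (stdOrthonormalBasis ℝ (tangentPlane c x) i)

/-- The squared norm `|du|²` of the differential at a point `x` of the ellipsoid. -/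
def normSqDiff {n : ℕ} (c : Fin n → ℝ)
    (U : EuclideanSpace ℝ (Fin n) → EuclideanSpace ℝ (Fin n))
    (x : EuclideanSpace ℝ (Fin n)) : ℝ :=
  ∑ i, ‖fderiv ℝ U x (stdOrthonormalBasis ℝ (tangentPlane c x) i : EuclideanSpace ℝ (Fin n))‖ ^ 2

/-- A self-map of the ellipsoid is harmonic if it is smooth and its tension field vanishes. -/
def IsHarmonicSelfMap {n : ℕ} (c : Fin n → ℝ) (u : ellipsoid c → ellipsoid c) : Prop :=
  ∃ U, IsSmoothExtension c u U ∧ ∀ x ∈ ellipsoid c, tensionField c U x = 0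

/-! ## The sphere and its eigenmaps -/

/-- The weights of the unit sphere of `ℝⁿ`. -/
def sphereWeights (n : ℕ) : Fin n → ℝ := fun _ => 1

theorem ellipsoid_sphereWeights (n : ℕ) :
    ellipsoid (sphereWeights n) = Metric.sphere (0 : EuclideanSpace ℝ (Fin n)) 1 := by
  ext x
  simp [ellipsoid, sphereWeights, EuclideanSpace.norm_eq]

/-- An eigenmap, with eigenvalue `ev`, of the unit sphere of `ℝⁿ`: a harmonic self-map `χ` of
the sphere with `|dχ|² = ev` everywhere. -/
def IsEigenmap {n : ℕ} (χ : ellipsoid (sphereWeights n) → ellipsoid (sphereWeights n))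
    (ev : ℝ) : Prop :=
  ∃ U, IsSmoothExtension (sphereWeights n) χ U ∧
    (∀ x ∈ ellipsoid (sphereWeights n), tensionField (sphereWeights n) U x = 0) ∧
    ∀ x ∈ ellipsoid (sphereWeights n), normSqDiff (sphereWeights n) U x = ev

/-! ## The rotationally symmetric ellipsoid -/

/-- The weights of the `k`-dimensional ellipsoid
`E_a = {x ∈ ℝ^(k+1) | a⁻² x₁² + x₂² + ⋯ + x_(k+1)² = 1}`. -/
def weightsE (k : ℕ) (a : ℝ) : Fin (k + 1) → ℝ := Fin.cons ((a ^ 2)⁻¹) (fun _ => 1)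

/-- The point `(a cos ψ, sin ψ θ)` of `ℝ × ℝ^k = ℝ^(k+1)`. -/
def polarVec {k : ℕ} (a ψ : ℝ) (θ : EuclideanSpace ℝ (Fin k)) :
    EuclideanSpace ℝ (Fin (k + 1)) :=
  WithLp.toLp 2 (Fin.cons (a * Real.cos ψ) (fun i => Real.sin ψ * θ i))

theorem polarVec_mem {k : ℕ} {a : ℝ} (ha : a ≠ 0) (ψ : ℝ) {θ : EuclideanSpace ℝ (Fin k)}
    (hθ : θ ∈ ellipsoid (sphereWeights k)) :
    polarVec a ψ θ ∈ ellipsoid (weightsE k a) := by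
  have h : ∑ i, θ i ^ 2 = 1 := by simpa [ellipsoid, sphereWeights] using hθ
  have h2 : ∑ i, (Real.sin ψ * θ i) ^ 2 = Real.sin ψ ^ 2 := by
    simp_rw [mul_pow]
    rw [← Finset.mul_sum, h, mul_one]
  simp only [ellipsoid, Set.mem_ofPred_eq, weightsE, polarVec, Fin.sum_univ_succ,
    Fin.cons_zero, Fin.cons_succ, one_mul, h2]
  have := Real.sin_sq_add_cos_sq ψ
  field_simp
  linarith

/-- The coordinates `(ψ, θ)` on the ellipsoid `E_a`, `θ` in the unit sphere of `ℝ^k`. -/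
def polarE {k : ℕ} {a : ℝ} (ha : a ≠ 0) (ψ : ℝ) (θ : ellipsoid (sphereWeights k)) :
    ellipsoid (weightsE k a) :=
  ⟨polarVec a ψ θ, polarVec_mem ha ψ θ.2⟩

/-- The factor `a² sin² t + cos² t` of the metric of `E_a`. -/
def metricFactor (a t : ℝ) : ℝ := a ^ 2 * Real.sin t ^ 2 + Real.cos t ^ 2

/-- `f : [0, π] → ℝ` solves the reduced equation on `(0, π)`, is continuous up to the boundary,
and satisfies `f(0) = 0` and `f(π) = ℓ π` for some integer `ℓ`. Values of `f` outside `[0, π]`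
play no role. -/
structure IsReducedSolution (k d : ℕ) (a : ℝ) (f : ℝ → ℝ) : Prop where
  contDiffOn : ContDiffOn ℝ 2 f (Set.Ioo 0 Real.pi)
  ode : ∀ ψ ∈ Set.Ioo 0 Real.pi,
    deriv (deriv f) ψ =
      (d : ℝ) * (d + k - 2) / 2 * (metricFactor a ψ / metricFactor a (f ψ)) *
          (Real.sin (2 * f ψ) / Real.sin ψ ^ 2)
        - (k - 1) * Real.cot ψ * deriv f ψ
        - (a ^ 2 - 1) / 2 * (Real.sin (2 * f ψ) / metricFactor a (f ψ)) * deriv f ψ ^ 2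
        + (a ^ 2 - 1) / 2 * (Real.sin (2 * ψ) / metricFactor a ψ) * deriv f ψ
  continuousOn : ContinuousOn f (Set.Icc 0 Real.pi)
  left : f 0 = 0
  right : ∃ l : ℤ, f Real.pi = l * Real.pi

/-- The self-map `u` of `E_a` has the form `(ψ, θ) ↦ (f(ψ), χ(θ))`. -/
def HasForm {k : ℕ} {a : ℝ} (ha : a ≠ 0) (u : ellipsoid (weightsE k a) → ellipsoid (weightsE k a))
    (f : ℝ → ℝ) (χ : ellipsoid (sphereWeights k) → ellipsoid (sphereWeights k)) : Prop :=
  ∀ ψ ∈ Set.Icc 0 Real.pi, ∀ θ, u (polarE ha ψ θ) = polarE ha (f ψ) (χ θ)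

end

/-!
# Harmonic self-maps of rotational ellipsoids

Write `λ = d(d+k-2)`, `q = k-2`, and let `M` be the square root of the metric factor. A map
`(ψ, θ) ↦ (f(ψ), χ(θ))` with `χ` an eigenmap is harmonic if and only if `f` solves the reduced
equation, so everything comes down to producing solutions of a singular boundary value problem and
to showing that they give maps that are smooth at the poles.

*The reduced equation.* In the time `τ = log tan(ψ/2)`, and with the momentum `p = M(f) f' / M(ψ)`,
the equation is an autonomous system for `(ψ, f, p)` (`reducedField`) with a rest point at the pole.
Its unstable manifold is two-dimensional; on it `tan(f/2) = t^d P(t²)` with `t = tan(ψ/2)`, where `P`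
solves a singular initial value problem (`exists_singular_solution`). This gives a family of
solutions, parametrized by `κ ≥ 0` with `tan(ψ/2) = κ e^τ` and depending continuously on `κ`, also
at `κ = 0`, where `ψ = 0` and the system is the blow-up of the equation at the pole
(`exists_trajectory_family`). The energy `p²/2 - (λ/2) sin² f` decreases on the hemisphere
`ψ ≤ π/2` and starts at zero.

*Oscillation.* For `κ = 0` a Lyapunov function drives the solution to the rest point
`(f, p) = (π/2, 0)` (`exists_energy_lt`). The linearization there is `x'' + q x' + (λ/a²) x = 0`,
whose eigenvalues are not real precisely because `a² < 4λ/q²`. Hence the polar angle of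
`(π/2 - f, -p)` tends to `-∞` (`exists_rotation_rate`). By continuity the angle at which the
solution with parameter `κ` reaches the equator `ψ = π/2` is unbounded as `κ → 0`. Where `f = π/2`, that
is, where the angle lies in `π/2 + πℤ`, it decreases, so that crossings cannot be undone, and the
angle at the equator meets the levels `π/2 + πℤ` for infinitely many `κ`
(`infinite_cos_angle_eq_zero`, `infinite_symmetric_trajectories`). A solution with `f = π/2` at the
equator is continued by the reflection `f(π - ψ) = π - f(ψ)`, which gives infinitely many solutions
of the boundary value problem (`infinite_isSmoothProfile`). They are told apart by the coefficient
`P(0)`.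

*Geometry.* The tension field is the tangential part of the trace of the Hessian of the map as a
vector-valued function (`tensionField_eq`); this is computed along meridians and along great circles
of the parallels (`tensionField_polarVec_eq_zero`). As to smoothness at the poles, the extension of
an eigenmap `χ` that is homogeneous of degree `d` is harmonic away from the origin. An integration by
parts shows that it is smooth at the origin as well (`exists_contDiff_of_homogeneous_harmonic`), and
near a pole the map is a smooth function of `tan²(ψ/2)` and this extension
(`exists_isSmoothExtension_of_hasForm`). The tension field is continuous, so it vanishes at the poles
too.

These maps also prove that there are infinitely many harmonic self-maps, as soon as an eigenmap of
degree `d` exists. If there is none, that assertion is carried by the isometries of the ellipsoid, for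
instance the reflections in hyperplanes through the axis (`infinite_harmonic_reflections`).
-/

/-! ### Radial means -/

section SingularEquation

open MeasureTheory Set Filter Topology

/-- The weighted mean `z ↦ ∫₀¹ ρ^N h(z ρ²) dρ`. It inverts the singular operator
`w ↦ 2 z w' + (N + 1) w`. -/
noncomputable def radialMean (N : ℕ) (h : ℝ → ℝ) (z : ℝ) : ℝ :=
  ∫ ρ in (0 : ℝ)..1, ρ ^ N * h (z * ρ ^ 2)

theorem continuous_radialMean {X : Type*} [TopologicalSpace X] (N : ℕ) {h : X → ℝ → ℝ}
    (hh : Continuous (Function.uncurry h)) {z : X → ℝ} (hz : Continuous z) :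
    Continuous fun x => radialMean N (h x) (z x) := by
  unfold radialMean
  apply intervalIntegral.continuous_parametric_intervalIntegral_of_continuous'
  have : Continuous fun p : X × ℝ => Function.uncurry h (p.1, z p.1 * p.2 ^ 2) :=
    hh.comp (by fun_prop)
  simp only [Function.uncurry_def] at this ⊢
  fun_prop

theorem continuous_radialMean_apply (N : ℕ) {h : ℝ → ℝ} (hh : Continuous h) :
    Continuous (radialMean N h) :=
  continuous_radialMean (X := ℝ) N (h := fun _ => h) (by fun_prop) continuous_id

theorem norm_radialMean_le (N : ℕ) {h : ℝ → ℝ} {C : ℝ} (hC : ∀ z, ‖h z‖ ≤ C) (z : ℝ) :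
    ‖radialMean N h z‖ ≤ C := by
  have := intervalIntegral.norm_integral_le_of_norm_le_const (a := (0 : ℝ)) (b := 1) (C := C)
    (f := fun ρ => ρ ^ N * h (z * ρ ^ 2)) ?_
  · simpa [radialMean] using this
  · intro ρ hρ
    rw [uIoc_of_le zero_le_one] at hρ
    have h1 : |ρ ^ N| ≤ 1 := by
      rw [abs_of_nonneg (pow_nonneg hρ.1.le _)]
      exact pow_le_one₀ hρ.1.le hρ.2
    rw [norm_mul]
    have := hC (z * ρ ^ 2)
    calc ‖ρ ^ N‖ * ‖h (z * ρ ^ 2)‖ ≤ 1 * C :=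
          mul_le_mul h1 this (norm_nonneg _) zero_le_one
      _ = C := one_mul C

theorem radialMean_sub (N : ℕ) {g h : ℝ → ℝ} (hg : Continuous g) (hh : Continuous h) (z : ℝ) :
    radialMean N g z - radialMean N h z = radialMean N (fun x => g x - h x) z := by
  unfold radialMean
  rw [← intervalIntegral.integral_sub]
  · congr 1; ext ρ; ring
  · exact Continuous.intervalIntegrable (by fun_prop) _ _
  · exact Continuous.intervalIntegrable (by fun_prop) _ _

theorem hasDerivAt_radialMean (N : ℕ) {h : ℝ → ℝ} (hh : ContDiff ℝ 1 h) (z : ℝ) :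
    HasDerivAt (radialMean N h) (radialMean (N + 2) (deriv h) z) z := by
  have hd : Continuous (deriv h) := hh.continuous_deriv le_rfl
  have hc : Continuous h := hh.continuous
  obtain ⟨C, hC⟩ := (isCompact_Icc (a := -(|z| + 1)) (b := |z| + 1)).exists_bound_of_continuousOn
    hd.continuousOn
  have key := intervalIntegral.hasDerivAt_integral_of_dominated_loc_of_deriv_le
    (μ := volume) (a := (0 : ℝ)) (b := 1) (x₀ := z) (s := Metric.ball z 1)
    (F := fun z ρ => ρ ^ N * h (z * ρ ^ 2)) (F' := fun z ρ => ρ ^ (N + 2) * deriv h (z * ρ ^ 2))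
    (bound := fun _ => C) (Metric.ball_mem_nhds z one_pos) ?_ ?_ ?_ ?_ ?_ ?_
  · exact key.2
  · exact Eventually.of_forall fun x =>
      (Continuous.aestronglyMeasurable (by fun_prop))
  · exact Continuous.intervalIntegrable (by fun_prop) _ _
  · exact (Continuous.aestronglyMeasurable (by fun_prop))
  · refine Eventually.of_forall fun ρ hρ x hx => ?_
    rw [uIoc_of_le zero_le_one] at hρ
    have h1 : |ρ ^ (N + 2)| ≤ 1 := by
      rw [abs_of_nonneg (pow_nonneg hρ.1.le _)]
      exact pow_le_one₀ hρ.1.le hρ.2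
    have hρ2 : ρ ^ 2 ≤ 1 := pow_le_one₀ hρ.1.le hρ.2
    have hx' : |x| ≤ |z| + 1 := by
      have := abs_sub_abs_le_abs_sub x z
      have h3 : |x - z| < 1 := by simpa [Real.dist_eq] using hx
      linarith
    have h2 : |x * ρ ^ 2| ≤ |z| + 1 := by
      rw [abs_mul, abs_of_nonneg (sq_nonneg ρ)]
      calc |x| * ρ ^ 2 ≤ |x| * 1 := by gcongr
        _ ≤ _ := by linarith
    have := hC _ (abs_le.mp h2)
    rw [norm_mul]
    calc ‖ρ ^ (N + 2)‖ * ‖deriv h (x * ρ ^ 2)‖ ≤ 1 * C :=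
          mul_le_mul h1 this (norm_nonneg _) zero_le_one
      _ = C := one_mul C
  · exact Continuous.intervalIntegrable (by fun_prop) _ _
  · refine Eventually.of_forall fun ρ _ x _ => ?_
    have h1 : HasDerivAt h (deriv h (x * ρ ^ 2)) (x * ρ ^ 2) :=
      (hh.differentiable one_ne_zero _).hasDerivAt
    have h2 := (h1.comp x ((hasDerivAt_id x).mul_const (ρ ^ 2))).const_mul (ρ ^ N)
    exact h2.congr_deriv (by ring)

theorem contDiff_radialMean (n : ℕ) : ∀ (N : ℕ) {h : ℝ → ℝ}, ContDiff ℝ n h →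
    ContDiff ℝ n (radialMean N h) := by
  induction n with
  | zero =>
    intro N h hh
    exact contDiff_zero.2 (continuous_radialMean_apply N (contDiff_zero.1 hh))
  | succ n ih =>
    intro N h hh
    have h1 : ContDiff ℝ 1 h := hh.of_le (by norm_cast; omega)
    have hd := hasDerivAt_radialMean N h1
    push_cast at hh ⊢
    rw [contDiff_succ_iff_deriv] at hh ⊢
    refine ⟨fun z => (hd z).differentiableAt, by simp, ?_⟩
    rw [show deriv (radialMean N h) = radialMean (N + 2) (deriv h) from funext fun z => (hd z).deriv]
    exact ih _ hh.2.2

/-- Multiplication by the variable turns the weighted mean of `h` into a combination of an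
antiderivative of `h` and its weighted mean: one derivative is gained. -/
theorem mul_radialMean (N : ℕ) {h : ℝ → ℝ} (hh : Continuous h) (z : ℝ) :
    z * radialMean (N + 2) h z = (1 / 2) * (∫ t in (0 : ℝ)..z, h t) -
      ((N + 1) / 2) * radialMean N (fun z => ∫ t in (0 : ℝ)..z, h t) z := by
  set A : ℝ → ℝ := fun z => ∫ t in (0 : ℝ)..z, h t with hA
  have hAd : ∀ x, HasDerivAt A (h x) x := fun x => intervalIntegral.integral_hasDerivAt_right
    (hh.intervalIntegrable _ _) hh.stronglyMeasurable.stronglyMeasurableAtFilter hh.continuousAt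
  have hAc : Continuous A := continuous_iff_continuousAt.2 fun x => (hAd x).continuousAt
  have key := intervalIntegral.integral_mul_deriv_eq_deriv_mul (a := (0 : ℝ)) (b := 1)
    (u := fun ρ => ρ ^ (N + 1)) (u' := fun ρ => (N + 1) * ρ ^ N)
    (v := fun ρ => A (z * ρ ^ 2)) (v' := fun ρ => h (z * ρ ^ 2) * (z * (2 * ρ))) ?_ ?_ ?_ ?_
  · simp only [one_pow, mul_one, one_mul, ne_eq, Nat.succ_ne_zero, not_false_eq_true, zero_pow,
      zero_mul, sub_zero] at key
    have e1 : (∫ ρ in (0 : ℝ)..1, ρ ^ (N + 1) * (h (z * ρ ^ 2) * (z * (2 * ρ)))) =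
        2 * z * radialMean (N + 2) h z := by
      rw [radialMean, ← intervalIntegral.integral_const_mul]
      congr 1; ext ρ; ring
    have e2 : (∫ ρ in (0 : ℝ)..1, (N + 1) * ρ ^ N * A (z * ρ ^ 2)) =
        (N + 1) * radialMean N A z := by
      rw [radialMean, ← intervalIntegral.integral_const_mul]
      congr 1; ext ρ; ring
    rw [e1, e2] at key
    linarith
  · intro ρ _
    simpa using hasDerivAt_pow (N + 1) ρ
  · intro ρ _
    have := (hAd (z * ρ ^ 2)).comp ρ (((hasDerivAt_pow 2 ρ)).const_mul z)
    exact this.congr_deriv (by simp)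
  · exact Continuous.intervalIntegrable (by fun_prop) _ _
  · exact Continuous.intervalIntegrable (by fun_prop) _ _

/-- The weighted mean solves `2 z w' + (N + 1) w = h`, for merely continuous `h`. -/
theorem hasDerivAt_mul_radialMean (N : ℕ) {h : ℝ → ℝ} (hh : Continuous h) (z : ℝ) :
    HasDerivAt (fun z => z * radialMean (N + 2) h z)
      (h z / 2 - (N + 1) / 2 * radialMean (N + 2) h z) z := by
  have hAd : ∀ x, HasDerivAt (fun z => ∫ t in (0 : ℝ)..z, h t) (h x) x := fun x =>
    intervalIntegral.integral_hasDerivAt_right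
    (hh.intervalIntegrable _ _) hh.stronglyMeasurable.stronglyMeasurableAtFilter hh.continuousAt
  have hd : deriv (fun z => ∫ t in (0 : ℝ)..z, h t) = h := funext fun x => (hAd x).deriv
  have h1 : ContDiff ℝ 1 (fun z => ∫ t in (0 : ℝ)..z, h t) :=
    contDiff_one_iff_deriv.2 ⟨fun x => (hAd x).differentiableAt, by rwa [hd]⟩
  have h2 := hasDerivAt_radialMean N h1 z
  rw [hd] at h2
  have h3 := ((hAd z).const_mul (1 / 2)).sub (h2.const_mul (((N : ℝ) + 1) / 2))
  rw [show (fun z => z * radialMean (N + 2) h z) = fun z => (1 / 2) * (∫ t in (0 : ℝ)..z, h t) -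
    ((N + 1) / 2) * radialMean N (fun z => ∫ t in (0 : ℝ)..z, h t) z from
    funext fun z => mul_radialMean N hh z]
  exact h3.congr_deriv (by ring)

theorem contDiff_integral {n : ℕ} {h : ℝ → ℝ} (hh : ContDiff ℝ n h) :
    ContDiff ℝ (n + 1) (fun z => ∫ t in (0 : ℝ)..z, h t) := by
  have hAd : ∀ x, HasDerivAt (fun z => ∫ t in (0 : ℝ)..z, h t) (h x) x := fun x =>
    intervalIntegral.integral_hasDerivAt_right (hh.continuous.intervalIntegrable _ _)
      hh.continuous.stronglyMeasurable.stronglyMeasurableAtFilter hh.continuous.continuousAt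
  rw [contDiff_succ_iff_deriv]
  refine ⟨fun x => (hAd x).differentiableAt, by simp, ?_⟩
  rwa [show deriv (fun z => ∫ t in (0 : ℝ)..z, h t) = h from funext fun x => (hAd x).deriv]

theorem contDiff_mul_radialMean {n : ℕ} (N : ℕ) {h : ℝ → ℝ} (hh : ContDiff ℝ n h) :
    ContDiff ℝ (n + 1) (fun z => z * radialMean (N + 2) h z) := by
  have h1 := contDiff_integral hh
  have h2 : ContDiff ℝ ((n + 1 : ℕ) : ℕ∞ω) (fun z => ∫ t in (0 : ℝ)..z, h t) := by exact_mod_cast h1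
  have h3 := contDiff_radialMean (n + 1) N h2
  rw [show (fun z => z * radialMean (N + 2) h z) = fun z => (1 / 2) * (∫ t in (0 : ℝ)..z, h t) -
      ((N + 1) / 2) * radialMean N (fun z => ∫ t in (0 : ℝ)..z, h t) z from
      funext fun z => mul_radialMean N hh.continuous z]
  push_cast at h3
  fun_prop

end SingularEquation

/-! ### A singular initial value problem -/

section SingularEquation

open MeasureTheory Set Filter Topology

/-- A function that is smooth near `q₀` agrees near `q₀` with a smooth compactly supported one. -/
theorem exists_contDiff_hasCompactSupport_eventuallyEq {E : Type*} [NormedAddCommGroup E]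
    [NormedSpace ℝ E] [FiniteDimensional ℝ E] {Ψ : E → ℝ} {q₀ : E}
    (hΨ : ∀ᶠ q in 𝓝 q₀, ContDiffAt ℝ ∞ Ψ q) :
    ∃ Φ : E → ℝ, ContDiff ℝ ∞ Φ ∧ HasCompactSupport Φ ∧ Φ =ᶠ[𝓝 q₀] Ψ := by
  obtain ⟨r, hr, hball⟩ := Metric.eventually_nhds_iff_ball.1 hΨ
  let b : ContDiffBump q₀ := ⟨r / 4, r / 2, by positivity, by linarith⟩
  refine ⟨fun q => b q * Ψ q, ?_, ?_, ?_⟩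
  · rw [contDiff_iff_contDiffAt]
    intro q
    by_cases hq : q ∈ Metric.closedBall q₀ (r / 2)
    · have : ContDiffAt ℝ ∞ Ψ q := hball q (by
        rw [Metric.mem_closedBall] at hq; rw [Metric.mem_ball]; linarith)
      exact b.contDiffAt.mul this
    · have h0 : ∀ᶠ x in 𝓝 q, b x * Ψ x = 0 := by
        filter_upwards [Metric.isClosed_closedBall.isOpen_compl.mem_nhds hq] with x hx
        rw [b.zero_of_le_dist, zero_mul]
        have : ¬ dist x q₀ ≤ r / 2 := hx
        exact (not_le.1 this).le
      exact (contDiffAt_const (c := (0 : ℝ))).congr_of_eventuallyEq h0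
  · exact b.hasCompactSupport.mul_right
  · filter_upwards [b.eventuallyEq_one] with q hq
    simp [hq]

/-- The smooth dependence of the right-hand side of the integral equation on the unknown, along
an unknown `w` of class `C^n`. -/
theorem contDiff_singular_rhs {n : ℕ} {Φ : ℝ × ℝ × ℝ × ℝ → ℝ} (hΦ : ContDiff ℝ ∞ Φ)
    (b : ContDiffBump (0 : ℝ)) (c : ℝ) {v : ℝ → ℝ} (hv : ContDiff ℝ n fun z => ∫ t in (0 : ℝ)..z, v t)
    (hzv : ContDiff ℝ n fun z => z * v z) :
    ContDiff ℝ n fun z => b z * Φ (c, z, 1 + ∫ t in (0 : ℝ)..z, v t, z * v z) := by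
  have h1 : ContDiff ℝ n Φ := hΦ.of_le (mod_cast le_top)
  exact b.contDiff.mul (h1.comp (by fun_prop))

/-- The singular initial value problem `4 z P'' + 2 (N + 3) P' = Ψ(c, z, P, z P')`, `P(0) = 1`:
for `(c, z)` near `0` there is a solution that is smooth in `z` on both sides of the singular point
and depends continuously on the parameter `c`. It is the fixed point of
`w ↦ (1/2) ∫₀¹ ρ^(N+2) Ψ(c, zρ², 1 + ∫ w, zρ² w(zρ²)) dρ`, where `w = P'`. -/
theorem exists_singular_solution (N : ℕ) {Ψ : ℝ × ℝ × ℝ × ℝ → ℝ}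
    (hΨ : ∀ᶠ q in 𝓝 ((0 : ℝ), (0 : ℝ), (1 : ℝ), (0 : ℝ)), ContDiffAt ℝ ∞ Ψ q) {e : ℝ} (he : 0 < e) :
    ∃ ε > 0, ∃ P w : ℝ → ℝ → ℝ, Continuous (Function.uncurry P) ∧ Continuous (Function.uncurry w) ∧
      (∀ c, ContDiff ℝ ∞ (P c)) ∧ (∀ c, ContDiff ℝ ∞ (w c)) ∧ (∀ c, P c 0 = 1) ∧
      (∀ c z, HasDerivAt (P c) (w c z) z) ∧
      ∀ c z, |c| ≤ ε → |z| ≤ ε → |P c z - 1| ≤ e ∧ |z * w c z| ≤ e ∧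
        4 * z * deriv (w c) z + 2 * (N + 3) * w c z = Ψ (c, z, P c z, z * w c z) := by
  obtain ⟨Φ, hΦ, hΦc, hΦeq⟩ := exists_contDiff_hasCompactSupport_eventuallyEq hΨ
  obtain ⟨L, hL⟩ := ContDiff.lipschitzWith_of_hasCompactSupport hΦc (n := ∞) hΦ (by simp)
  obtain ⟨C, hC⟩ := hΦc.exists_bound_of_continuous hΦ.continuous
  have hC0 : 0 ≤ C := (norm_nonneg _).trans (hC 0)
  have hΦcont : Continuous Φ := hΦ.continuous
  -- The cut-off in `z` is so narrow that the integral operator is a contraction.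
  set δ : ℝ := 1 / (4 * (L + 1)) with hδ
  have hδ0 : 0 < δ := by positivity
  let b : ContDiffBump (0 : ℝ) := ⟨δ, 2 * δ, hδ0, by linarith⟩
  have hbn : ∀ z, ‖b z‖ ≤ 1 := fun z => by
    rw [Real.norm_of_nonneg b.nonneg]; exact b.le_one
  have hbc : Continuous b := b.continuous
  let S : BoundedContinuousFunction (ℝ × ℝ) ℝ → ℝ → ℝ → ℝ := fun w c z =>
    b z * Φ (c, z, 1 + ∫ t in (0 : ℝ)..z, w (c, t), z * w (c, z))
  have hScont : ∀ w, Continuous (Function.uncurry (S w)) := by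
    intro w
    have h1 : Continuous fun p : ℝ × ℝ => ∫ t in (0 : ℝ)..p.2, w (p.1, t) :=
      intervalIntegral.continuous_parametric_primitive_of_continuous
        (f := fun c t => w (c, t)) (by simpa [Function.uncurry_def] using w.continuous)
    simp only [S, Function.uncurry_def]
    fun_prop
  have hSb : ∀ w c z, ‖S w c z‖ ≤ C := fun w c z => by
    rw [norm_mul]
    calc _ ≤ 1 * C := mul_le_mul (hbn z) (hC _) (norm_nonneg _) zero_le_one
      _ = C := one_mul C
  have hSl : ∀ w w' c z, ‖S w c z - S w' c z‖ ≤ (1 / 2) * ‖w - w'‖ := by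
    intro w w' c z
    have hww : ∀ t, |w (c, t) - w' (c, t)| ≤ ‖w - w'‖ := fun t =>
      (w - w').norm_coe_le_norm (c, t)
    simp only [S]
    rw [← mul_sub, norm_mul]
    by_cases hz : |z| ≤ 2 * δ
    · have hint : ‖(∫ t in (0 : ℝ)..z, w (c, t)) - ∫ t in (0 : ℝ)..z, w' (c, t)‖ ≤
          |z| * ‖w - w'‖ := by
        rw [← intervalIntegral.integral_sub]
        · have := intervalIntegral.norm_integral_le_of_norm_le_const (a := (0 : ℝ)) (b := z)
            (C := ‖w - w'‖) (f := fun t => w (c, t) - w' (c, t)) (fun t _ => hww t)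
          rw [sub_zero, mul_comm] at this
          exact this
        · exact Continuous.intervalIntegrable (by fun_prop) _ _
        · exact Continuous.intervalIntegrable (by fun_prop) _ _
      have hd := hL.dist_le_mul (c, z, 1 + ∫ t in (0 : ℝ)..z, w (c, t), z * w (c, z))
        (c, z, 1 + ∫ t in (0 : ℝ)..z, w' (c, t), z * w' (c, z))
      have hd2 : dist ((c, z, 1 + ∫ t in (0 : ℝ)..z, w (c, t), z * w (c, z)) : ℝ × ℝ × ℝ × ℝ)
        (c, z, 1 + ∫ t in (0 : ℝ)..z, w' (c, t), z * w' (c, z)) ≤ |z| * ‖w - w'‖ := by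
        simp only [Prod.dist_eq, dist_self, dist_add_left]
        refine max_le (by positivity) (max_le (by positivity) (max_le ?_ ?_))
        · rw [dist_eq_norm]; exact hint
        · rw [Real.dist_eq, ← mul_sub, abs_mul]
          exact mul_le_mul_of_nonneg_left (hww z) (abs_nonneg z)
      rw [dist_eq_norm] at hd
      calc _ ≤ 1 * (L * (2 * δ * ‖w - w'‖)) := by
            refine mul_le_mul (hbn z) (hd.trans ?_) (norm_nonneg _) zero_le_one
            gcongr
            exact hd2.trans (by gcongr)
        _ = (L / (L + 1)) * (1 / 2) * ‖w - w'‖ := by rw [hδ]; field_simp; ring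
        _ ≤ 1 * (1 / 2) * ‖w - w'‖ := by
            gcongr
            rw [div_le_one (by positivity)]; linarith
        _ = _ := by ring
    · have : b z = 0 := b.zero_of_le_dist (by
        rw [Real.dist_eq, sub_zero]; exact (not_le.1 hz).le)
      rw [this]; simp
  let T : BoundedContinuousFunction (ℝ × ℝ) ℝ → BoundedContinuousFunction (ℝ × ℝ) ℝ := fun w =>
    BoundedContinuousFunction.ofNormedAddCommGroup
      (fun p => (1 / 2) * radialMean (N + 2) (S w p.1) p.2)
      (by
        refine continuous_const.mul (continuous_radialMean (N + 2)
          (h := fun p : ℝ × ℝ => S w p.1) ?_ continuous_snd)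
        exact (hScont w).comp (by fun_prop : Continuous fun q : (ℝ × ℝ) × ℝ => (q.1.1, q.2)))
      C (by
        intro p
        rw [norm_mul]
        have := norm_radialMean_le (N + 2) (hSb w p.1) p.2
        rw [Real.norm_of_nonneg (by norm_num : (0 : ℝ) ≤ 1 / 2)]
        linarith [norm_nonneg (radialMean (N + 2) (S w p.1) p.2)])
  have hTapp : ∀ w c z, T w (c, z) = (1 / 2) * radialMean (N + 2) (S w c) z := fun _ _ _ => rfl
  have hSc : ∀ w c, Continuous (S w c) := fun w c =>
    (hScont w).comp (by fun_prop : Continuous fun z : ℝ => (c, z))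
  have hT : ContractingWith (1 / 2) T := by
    refine ⟨by rw [← NNReal.coe_lt_coe]; norm_num, LipschitzWith.of_dist_le_mul fun w w' => ?_⟩
    rw [BoundedContinuousFunction.dist_le (by positivity)]
    rintro ⟨c, z⟩
    rw [hTapp, hTapp, Real.dist_eq, ← mul_sub, radialMean_sub _ (hSc w c) (hSc w' c), abs_mul]
    have := norm_radialMean_le (N + 2) (hSl w w' c) z
    rw [Real.norm_eq_abs] at this
    rw [dist_eq_norm]
    have h0 := norm_nonneg (w - w')
    rw [abs_of_pos (by norm_num : (0 : ℝ) < 1 / 2)]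
    push_cast
    linarith
  obtain ⟨w, hw, -⟩ := hT.exists_fixedPoint 0 (edist_ne_top _ _)
  have hweq : ∀ c z, w (c, z) = (1 / 2) * radialMean (N + 2) (S w c) z := fun c z => by
    rw [← hTapp, hw]
  have hwc : ∀ c, Continuous fun z => w (c, z) := fun c => by fun_prop
  -- Each gain of a derivative for `z w(z)` is passed on to `w` by the fixed point equation.
  have hstep : ∀ (c : ℝ) (n : ℕ), ContDiff ℝ n (fun z => w (c, z)) := by
    intro c n
    induction n with
    | zero => exact contDiff_zero.2 (hwc c)
    | succ n ih =>
      have h1 : ContDiff ℝ n (S w c) := by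
        refine contDiff_singular_rhs hΦ b c ?_ (contDiff_id.mul ih)
        exact (contDiff_integral ih).of_le (by norm_cast; omega)
      have h2 : ContDiff ℝ ((n + 1 : ℕ) : ℕ∞ω) fun z => z * w (c, z) := by
        have := (contDiff_mul_radialMean N h1).const_smul (1 / 2 : ℝ)
        push_cast
        convert this using 2 with z
        rw [hweq, smul_eq_mul]; ring
      have h3 : ContDiff ℝ ((n + 1 : ℕ) : ℕ∞ω) (S w c) := by
        refine contDiff_singular_rhs hΦ b c ?_ h2
        exact_mod_cast contDiff_integral ih
      have h4 := (contDiff_radialMean (n + 1) (N + 2) h3).const_smul (1 / 2 : ℝ)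
      convert h4 using 2 with z
      rw [hweq, smul_eq_mul]
  have hsmooth : ∀ c, ContDiff ℝ ∞ (fun z => w (c, z)) := fun c => contDiff_infty.2 (hstep c)
  have hPd : ∀ c z, HasDerivAt (fun z => 1 + ∫ t in (0 : ℝ)..z, w (c, t)) (w (c, z)) z :=
    fun c z => (intervalIntegral.integral_hasDerivAt_right ((hwc c).intervalIntegrable _ _)
      (hwc c).stronglyMeasurable.stronglyMeasurableAtFilter (hwc c).continuousAt).const_add 1
  have hPc : Continuous fun p : ℝ × ℝ => ∫ t in (0 : ℝ)..p.2, w (p.1, t) :=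
    intervalIntegral.continuous_parametric_primitive_of_continuous
      (f := fun c t => w (c, t)) (by simpa [Function.uncurry_def] using w.continuous)
  have hq : Tendsto (fun p : ℝ × ℝ => ((p.1, p.2, 1 + ∫ t in (0 : ℝ)..p.2, w (p.1, t),
      p.2 * w (p.1, p.2)) : ℝ × ℝ × ℝ × ℝ)) (𝓝 (0, 0)) (𝓝 (0, 0, 1, 0)) := by
    have : Continuous (fun p : ℝ × ℝ => ((p.1, p.2, 1 + ∫ t in (0 : ℝ)..p.2, w (p.1, t),
      p.2 * w (p.1, p.2)) : ℝ × ℝ × ℝ × ℝ)) := by fun_prop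
    have h := this.tendsto (0, 0)
    simpa using h
  have hev : ∀ᶠ p : ℝ × ℝ in 𝓝 (0, 0), (|(1 + ∫ t in (0 : ℝ)..p.2, w (p.1, t)) - 1| ≤ e ∧
      |p.2 * w (p.1, p.2)| ≤ e) ∧ |p.2| < δ ∧
      Φ (p.1, p.2, 1 + ∫ t in (0 : ℝ)..p.2, w (p.1, t), p.2 * w (p.1, p.2)) =
      Ψ (p.1, p.2, 1 + ∫ t in (0 : ℝ)..p.2, w (p.1, t), p.2 * w (p.1, p.2)) := by
    refine Filter.Eventually.and ?_ (Filter.Eventually.and ?_ (hq.eventually hΦeq))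
    · have hball : Metric.closedBall ((0 : ℝ), (0 : ℝ), (1 : ℝ), (0 : ℝ)) e ∈
        𝓝 ((0 : ℝ), (0 : ℝ), (1 : ℝ), (0 : ℝ)) := Metric.closedBall_mem_nhds _ he
      filter_upwards [hq hball] with p hp
      simp only [mem_preimage, Metric.mem_closedBall, Prod.dist_eq, max_le_iff, Real.dist_eq,
        sub_zero] at hp
      exact ⟨hp.2.2.1, hp.2.2.2⟩
    · have : Tendsto (fun p : ℝ × ℝ => |p.2|) (𝓝 (0, 0)) (𝓝 |0|) :=
        (continuous_snd.abs).tendsto (0, 0)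
      exact this.eventually_lt_const (by simpa using hδ0)
  obtain ⟨r, hr, hball⟩ := Metric.eventually_nhds_iff_ball.1 hev
  refine ⟨r / 2, by positivity, fun c z => 1 + ∫ t in (0 : ℝ)..z, w (c, t), fun c z => w (c, z),
    ?_, ?_, ?_, hsmooth, by simp, hPd, ?_⟩
  · simp only [Function.uncurry_def]; fun_prop
  · simpa [Function.uncurry_def] using w.continuous
  · intro c
    rw [contDiff_infty_iff_deriv]
    refine ⟨fun z => (hPd c z).differentiableAt, ?_⟩
    rw [show deriv (fun z => 1 + ∫ t in (0 : ℝ)..z, w (c, t)) = fun z => w (c, z) from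
      funext fun z => (hPd c z).deriv]
    exact hsmooth c
  · intro c z hc hz
    obtain ⟨⟨h1, h2⟩, h3, h4⟩ := hball (c, z) (by
      simp only [Metric.mem_ball, Prod.dist_eq, Real.dist_eq, sub_zero]
      exact max_lt (by linarith) (by linarith))
    refine ⟨h1, h2, ?_⟩
    rw [← h4]
    have hb1 : b z = 1 := b.one_of_mem_closedBall (by
      rw [Metric.mem_closedBall, Real.dist_eq, sub_zero]; exact h3.le)
    have hS : S w c z = Φ (c, z, 1 + ∫ t in (0 : ℝ)..z, w (c, t), z * w (c, z)) := by
      simp only [S, hb1, one_mul]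
    rw [← hS]
    have hd1 := (hasDerivAt_mul_radialMean N (hSc w c) z).const_mul (1 / 2 : ℝ)
    have hwd : HasDerivAt (fun z => w (c, z)) (deriv (fun z => w (c, z)) z) z :=
      ((hsmooth c).differentiable (by simp) z).hasDerivAt
    have hd2 := (hasDerivAt_id z).mul hwd
    have hfun : (fun y => (1 / 2 : ℝ) * (y * radialMean (N + 2) (S w c) y)) =
        fun y => y * w (c, y) := by
      funext y; rw [hweq]; ring
    rw [hfun] at hd1
    have := hd1.unique hd2
    simp only [id] at this
    rw [show radialMean (N + 2) (S w c) z = 2 * w (c, z) by rw [hweq]; ring] at this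
    linarith

end SingularEquation

section ReducedEquation

open Set Filter Topology

/-! ### The metric factor -/

theorem metricFactor_eq (a x : ℝ) : metricFactor a x = 1 + (a ^ 2 - 1) * Real.sin x ^ 2 := by
  rw [metricFactor, Real.cos_sq']; ring

theorem metricFactor_pos {a : ℝ} (ha : a ≠ 0) (x : ℝ) : 0 < metricFactor a x := by
  have h := Real.sin_sq_add_cos_sq x
  have ha2 : 0 < a ^ 2 := by positivity
  rw [metricFactor]
  rcases eq_or_ne (Real.cos x) 0 with hc | hc
  · rw [hc] at h ⊢
    have : Real.sin x ^ 2 = 1 := by linarith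
    rw [this]; simpa using ha2
  · positivity

theorem contDiff_metricFactor (a : ℝ) : ContDiff ℝ ∞ (metricFactor a) := by
  unfold metricFactor
  fun_prop

theorem hasDerivAt_metricFactor (a x : ℝ) :
    HasDerivAt (metricFactor a) ((a ^ 2 - 1) * Real.sin (2 * x)) x := by
  have h := (((Real.hasDerivAt_sin x).pow 2).const_mul (a ^ 2)).add ((Real.hasDerivAt_cos x).pow 2)
  refine h.congr_deriv ?_
  rw [Real.sin_two_mul]; norm_num; ring

/-- The square root of the metric factor: the length element of the meridian of the ellipsoid. -/
noncomputable def lengthFactor (a x : ℝ) : ℝ := Real.sqrt (metricFactor a x)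

theorem lengthFactor_pos {a : ℝ} (ha : a ≠ 0) (x : ℝ) : 0 < lengthFactor a x :=
  Real.sqrt_pos.2 (metricFactor_pos ha x)

theorem sq_lengthFactor {a : ℝ} (ha : a ≠ 0) (x : ℝ) :
    lengthFactor a x ^ 2 = metricFactor a x := Real.sq_sqrt (metricFactor_pos ha x).le

theorem contDiff_lengthFactor {a : ℝ} (ha : a ≠ 0) : ContDiff ℝ ∞ (lengthFactor a) :=
  (contDiff_metricFactor a).sqrt fun x => (metricFactor_pos ha x).ne'

theorem hasDerivAt_lengthFactor {a : ℝ} (ha : a ≠ 0) (x : ℝ) :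
    HasDerivAt (lengthFactor a) ((a ^ 2 - 1) * Real.sin (2 * x) / (2 * lengthFactor a x)) x :=
  (hasDerivAt_metricFactor a x).sqrt (metricFactor_pos ha x).ne'

@[simp] theorem lengthFactor_zero (a : ℝ) : lengthFactor a 0 = 1 := by
  simp [lengthFactor, metricFactor]

theorem lengthFactor_pi_div_two (a : ℝ) : lengthFactor a (Real.pi / 2) = |a| := by
  simp [lengthFactor, metricFactor, Real.sqrt_sq_eq_abs]

theorem lengthFactor_pi_sub (a x : ℝ) : lengthFactor a (Real.pi - x) = lengthFactor a x := by
  simp [lengthFactor, metricFactor, Real.sin_pi_sub, Real.cos_pi_sub]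

/-! ### Half-angle substitution -/

theorem sin_two_mul_arctan (x : ℝ) : Real.sin (2 * Real.arctan x) = 2 * x / (1 + x ^ 2) := by
  have hc : Real.cos (Real.arctan x) ≠ 0 := (Real.cos_arctan_pos x).ne'
  have h1 : Real.sin (Real.arctan x) = x * Real.cos (Real.arctan x) := by
    conv_rhs => rw [← Real.tan_arctan x]
    rw [Real.arctan_tan (by linarith [Real.neg_pi_div_two_lt_arctan x]) (Real.arctan_lt_pi_div_two x),
      Real.tan_mul_cos hc]
  rw [Real.sin_two_mul, h1, show 2 * (x * Real.cos (Real.arctan x)) * Real.cos (Real.arctan x) =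
    2 * x * Real.cos (Real.arctan x) ^ 2 by ring, Real.cos_sq_arctan]
  ring

theorem cos_two_mul_arctan (x : ℝ) :
    Real.cos (2 * Real.arctan x) = (1 - x ^ 2) / (1 + x ^ 2) := by
  have : 1 + x ^ 2 ≠ 0 := by positivity
  rw [Real.cos_two_mul, Real.cos_sq_arctan]
  field_simp
  ring

/-- The metric factor at `2 arctan x`, as a rational function of `y = x²`. -/
noncomputable def metricRat (a y : ℝ) : ℝ := 1 + y * (4 * (a ^ 2 - 1) / (1 + y) ^ 2)

theorem metricFactor_two_mul_arctan (a x : ℝ) :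
    metricFactor a (2 * Real.arctan x) = metricRat a (x ^ 2) := by
  have : 1 + x ^ 2 ≠ 0 := by positivity
  rw [metricFactor_eq, sin_two_mul_arctan, metricRat]
  field_simp
  ring

/-! ### The first-order system -/

/-- The reduced equation as a first-order autonomous system for `(ψ, f, p)`. The time `τ` is
`log tan(ψ/2)` up to a constant, so `ψ' = sin ψ`; the momentum is `p = M(f) f' / M(ψ)` with the
length factor `M`, and `q = k - 2`. Its invariant plane `ψ = 0` carries the equation obtained by
blowing up the pole. -/
noncomputable def reducedField (q lam a : ℝ) (s : ℝ × ℝ × ℝ) : ℝ × ℝ × ℝ :=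
  (Real.sin s.1, lengthFactor a s.1 * s.2.2 / lengthFactor a s.2.1,
    lengthFactor a s.1 * (lam / 2 * Real.sin (2 * s.2.1)) / lengthFactor a s.2.1 -
      q * Real.cos s.1 * s.2.2)

theorem contDiff_reducedField (q lam : ℝ) {a : ℝ} (ha : a ≠ 0) :
    ContDiff ℝ ∞ (reducedField q lam a) := by
  have h := contDiff_lengthFactor ha
  have h0 : ∀ s : ℝ × ℝ × ℝ, lengthFactor a s.2.1 ≠ 0 := fun s => (lengthFactor_pos ha _).ne'
  unfold reducedField
  have h1 : ContDiff ℝ ∞ fun s : ℝ × ℝ × ℝ => lengthFactor a s.1 := h.comp contDiff_fst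
  have h2 : ContDiff ℝ ∞ fun s : ℝ × ℝ × ℝ => lengthFactor a s.2.1 :=
    h.comp (contDiff_fst.comp contDiff_snd)
  refine ContDiff.prodMk (by fun_prop) (ContDiff.prodMk ?_ ?_)
  · exact ContDiff.div (by fun_prop) h2 h0
  · exact (ContDiff.div (by fun_prop) h2 h0).sub (by fun_prop)

/-- The second-order equation for `f` in the time `τ` gives the equation for the momentum. -/
theorem hasDerivAt_momentum {q lam a : ℝ} (ha : a ≠ 0) {ψ f f₁ : ℝ → ℝ} {τ f₂ : ℝ}
    (hψ : HasDerivAt ψ (Real.sin (ψ τ)) τ) (hf : HasDerivAt f (f₁ τ) τ) (hf₁ : HasDerivAt f₁ f₂ τ)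
    (h : f₂ = -((a ^ 2 - 1) * Real.sin (2 * f τ) * f₁ τ ^ 2 / (2 * metricFactor a (f τ))) +
      (a ^ 2 - 1) * Real.sin (2 * ψ τ) * Real.sin (ψ τ) * f₁ τ / (2 * metricFactor a (ψ τ)) +
      metricFactor a (ψ τ) / metricFactor a (f τ) * (lam / 2 * Real.sin (2 * f τ)) -
      q * Real.cos (ψ τ) * f₁ τ) :
    HasDerivAt (fun t => lengthFactor a (f t) * f₁ t / lengthFactor a (ψ t))
      (lengthFactor a (ψ τ) * (lam / 2 * Real.sin (2 * f τ)) / lengthFactor a (f τ) -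
      q * Real.cos (ψ τ) * (lengthFactor a (f τ) * f₁ τ / lengthFactor a (ψ τ))) τ := by
  have h1 := (hasDerivAt_lengthFactor ha (f τ)).comp τ hf
  have h2 := (hasDerivAt_lengthFactor ha (ψ τ)).comp τ hψ
  have hp1 := lengthFactor_pos ha (f τ)
  have hp2 := lengthFactor_pos ha (ψ τ)
  refine ((h1.mul hf₁).div h2 hp2.ne').congr_deriv ?_
  rw [← sq_lengthFactor ha, ← sq_lengthFactor ha] at h
  rw [h]
  simp only [Function.comp_apply, Pi.mul_apply]
  field_simp
  ring

/-- The right-hand side of the singular equation for `P`, where `tan(f/2) = r^d P(c, r²)` and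
`tan(ψ/2) = √c r`; the arguments are `(c, z, P, z P')` with `z = r²`. -/
noncomputable def poleField (k d : ℕ) (a : ℝ) (x : ℝ × ℝ × ℝ × ℝ) : ℝ :=
  let c := x.1
  let z := x.2.1
  let P := x.2.2.1
  let A := d * P + 2 * x.2.2.2
  let g := z ^ (d - 1)
  let H := z * (g * P ^ 2)
  2 * (g * P * A ^ 2 / (1 + H)) + 2 * (k - 2) * c * A / (1 + c * z)
    + d * (d + k - 2) * P * ((c * (4 * (a ^ 2 - 1) / (1 + c * z) ^ 2) * (1 - H)
        - g * P ^ 2 * (4 * (a ^ 2 - 1) / (1 + H) ^ 2) * (1 + H) - 2 * (g * P ^ 2))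
        / (metricRat a H * (1 + H)))
    + (a ^ 2 - 1) * (4 * c * (1 - c * z) * A) / ((1 + c * z) ^ 3 * metricRat a (c * z))
    - 4 * (a ^ 2 - 1) * (g * P * A ^ 2 * (1 - H)) / ((1 + H) ^ 3 * metricRat a H)

theorem eventually_contDiffAt_poleField (k : ℕ) {d : ℕ} (a : ℝ) :
    ∀ᶠ x in 𝓝 ((0 : ℝ), (0 : ℝ), (1 : ℝ), (0 : ℝ)), ContDiffAt ℝ ∞ (poleField k d a) x := by
  have c1 : ContinuousAt (fun x : ℝ × ℝ × ℝ × ℝ => 1 + x.1 * x.2.1) (0, 0, 1, 0) := by fun_prop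
  have c2 : ContinuousAt (fun x : ℝ × ℝ × ℝ × ℝ =>
    1 + x.2.1 * (x.2.1 ^ (d - 1) * x.2.2.1 ^ 2)) (0, 0, 1, 0) := by fun_prop
  have c3 : ContinuousAt (fun x : ℝ × ℝ × ℝ × ℝ => metricRat a (x.1 * x.2.1)) (0, 0, 1, 0) := by
    unfold metricRat
    refine ContinuousAt.add (by fun_prop) (ContinuousAt.mul (by fun_prop)
      (ContinuousAt.div (by fun_prop) (by fun_prop) (by simp)))
  have c4 : ContinuousAt (fun x : ℝ × ℝ × ℝ × ℝ =>
    metricRat a (x.2.1 * (x.2.1 ^ (d - 1) * x.2.2.1 ^ 2))) (0, 0, 1, 0) := by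
    unfold metricRat
    refine ContinuousAt.add (by fun_prop) (ContinuousAt.mul (by fun_prop)
      (ContinuousAt.div (by fun_prop) (by fun_prop) (by simp)))
  filter_upwards [c1.eventually_ne (by simp : _ ≠ (0 : ℝ)),
    c2.eventually_ne (by simp : _ ≠ (0 : ℝ)), c3.eventually_ne (by simp [metricRat] : _ ≠ (0 : ℝ)),
    c4.eventually_ne (by simp [metricRat] : _ ≠ (0 : ℝ))] with x h1 h2 h3 h4
  unfold poleField
  unfold metricRat at h3 h4 ⊢
  dsimp only
  have hd1 : ContDiffAt ℝ ∞ (fun x : ℝ × ℝ × ℝ × ℝ => 1 + x.1 * x.2.1) x := by fun_prop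
  have hd2 : ContDiffAt ℝ ∞ (fun x : ℝ × ℝ × ℝ × ℝ =>
    1 + x.2.1 * (x.2.1 ^ (d - 1) * x.2.2.1 ^ 2)) x := by fun_prop
  have hm3 := mul_ne_zero (pow_ne_zero 3 h1) h3
  have hm4 := mul_ne_zero (pow_ne_zero 3 h2) h4
  have hm5 := mul_ne_zero h4 h2
  have hp1 := pow_ne_zero 2 h1
  have hp2 := pow_ne_zero 2 h2
  fun_prop (disch := assumption)

end ReducedEquation

/-! ### Solutions near the pole -/

section ReducedEquation

open Set Filter Topology

/-- If `h = r^d P(c, r²)` with `P` solving the singular equation, then `h` solves the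
second-order equation for `tan(f/2)` in the time `τ = log r`. -/
theorem poleField_identity {k d : ℕ} (hd : 1 ≤ d) (a c P u z Q : ℝ) (hQ : Q ^ 2 = z ^ d)
    (h3 : 0 < metricRat a ((Q * P) ^ 2)) :
    Q * z * poleField k d a (c, z, P, u) =
      2 * (Q * P) * (Q * (d * P + 2 * u)) ^ 2 / (1 + (Q * P) ^ 2)
      - 4 * (a ^ 2 - 1) * (Q * P) * (1 - (Q * P) ^ 2) * (Q * (d * P + 2 * u)) ^ 2 /
        ((1 + (Q * P) ^ 2) ^ 3 * metricRat a ((Q * P) ^ 2))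
      + (a ^ 2 - 1) * (4 * (c * z) * (1 - c * z)) * (Q * (d * P + 2 * u)) /
        ((1 + c * z) ^ 3 * metricRat a (c * z))
      + d * (d + k - 2) * (Q * P) * (metricRat a (c * z) / metricRat a ((Q * P) ^ 2) *
        ((1 - (Q * P) ^ 2) / (1 + (Q * P) ^ 2)) - 1)
      + 2 * (k - 2) * (c * z) / (1 + c * z) * (Q * (d * P + 2 * u)) := by
  obtain ⟨m, rfl⟩ : ∃ m, d = m + 1 := ⟨d - 1, by omega⟩
  have hg : Q ^ 2 = z * z ^ m := by rw [hQ, pow_succ']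
  have hH : z * (z ^ m * P ^ 2) = (Q * P) ^ 2 := by rw [mul_pow, hg]; ring
  have hH0 : 0 < 1 + (Q * P) ^ 2 := by positivity
  simp only [poleField, Nat.add_sub_cancel]
  rw [hH]
  set A : ℝ := ((m + 1 : ℕ) : ℝ) * P + 2 * u with hA
  set H : ℝ := (Q * P) ^ 2 with hHdef
  set g : ℝ := z ^ m with hgdef
  have e1 : Q * z * (2 * (g * P * A ^ 2 / (1 + H))) = 2 * (Q * P) * (Q * A) ^ 2 / (1 + H) := by
    rw [mul_pow Q A, hg]; ring
  have e2 : Q * z * (4 * (a ^ 2 - 1) * (g * P * A ^ 2 * (1 - H)) / ((1 + H) ^ 3 * metricRat a H)) =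
      4 * (a ^ 2 - 1) * (Q * P) * (1 - H) * (Q * A) ^ 2 / ((1 + H) ^ 3 * metricRat a H) := by
    rw [mul_pow Q A, hg]; ring
  have e4 : z * ((c * (4 * (a ^ 2 - 1) / (1 + c * z) ^ 2) * (1 - H)
        - g * P ^ 2 * (4 * (a ^ 2 - 1) / (1 + H) ^ 2) * (1 + H) - 2 * (g * P ^ 2))
        / (metricRat a H * (1 + H))) =
        metricRat a (c * z) / metricRat a H * ((1 - H) / (1 + H)) - 1 := by
    rw [← mul_div_assoc, div_mul_div_comm, eq_sub_iff_add_eq, div_add_one (by positivity)]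
    congr 1
    have hz : z * (g * P ^ 2) = H := hH
    have : z * (c * (4 * (a ^ 2 - 1) / (1 + c * z) ^ 2) * (1 - H)
        - g * P ^ 2 * (4 * (a ^ 2 - 1) / (1 + H) ^ 2) * (1 + H) - 2 * (g * P ^ 2)) =
        (c * z) * (4 * (a ^ 2 - 1) / (1 + c * z) ^ 2) * (1 - H)
        - (z * (g * P ^ 2)) * (4 * (a ^ 2 - 1) / (1 + H) ^ 2) * (1 + H)
        - 2 * (z * (g * P ^ 2)) := by ring
    rw [this, hz, metricRat, metricRat]
    ring
  rw [← e4]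
  linear_combination e1 - e2

/-- The unstable manifold of the rest point `(0, 0, 0)` of the reduced system, parametrized by
`κ`: solutions with `tan(ψ/2) = κ e^τ` and `tan(f/2) = e^{dτ} P(e^{2τ})`, up to scaling. -/
theorem exists_local_trajectory {k d : ℕ} (hk : 3 ≤ k) (hd : 1 ≤ d) {a : ℝ} (ha : a ≠ 0) :
    ∃ r > 0, ∃ κ₀ > 0, ∃ f p : ℝ → ℝ → ℝ,
      ContinuousOn (fun κ => f κ 0) (Icc 0 κ₀) ∧ ContinuousOn (fun κ => p κ 0) (Icc 0 κ₀) ∧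
      ∀ κ ∈ Icc 0 κ₀,
        (∀ τ < 1 / 2, HasDerivAt (fun t => (2 * Real.arctan (κ * Real.exp t), f κ t, p κ t))
          (reducedField (k - 2) (d * (d + k - 2)) a
            (2 * Real.arctan (κ * Real.exp τ), f κ τ, p κ τ)) τ) ∧
        (∀ τ < 1 / 2, 0 < f κ τ ∧ f κ τ < Real.pi / 2 ∧ 0 < p κ τ ∧ κ * Real.exp τ < 1) ∧
        Tendsto (f κ) atBot (𝓝 0) ∧ Tendsto (p κ) atBot (𝓝 0) ∧
        (0 < κ → ∃ P : ℝ → ℝ, ContDiff ℝ ∞ P ∧ P 0 = (r / κ) ^ d ∧ ∀ τ < 1 / 2,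
          f κ τ = 2 * Real.arctan ((κ * Real.exp τ) ^ d * P ((κ * Real.exp τ) ^ 2))) := by
  have hkR : (3 : ℝ) ≤ k := by exact_mod_cast hk
  have hdR : (1 : ℝ) ≤ d := by exact_mod_cast hd
  obtain ⟨ε, hε, P, w, hPc, hwc, hPs, hws, hP0, hPd, hsol⟩ :=
    exists_singular_solution (2 * d + k - 3) (eventually_contDiffAt_poleField k (d := d) a)
      (e := 1 / 8) (by norm_num)
  have hN : ((2 * d + k - 3 : ℕ) : ℝ) = 2 * d + k - 3 := by
    rw [Nat.cast_sub (by omega)]; push_cast; ring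
  -- `r² e ≤ min ε (1/4)` keeps `z = r² e^{2τ}` in the domain of the singular solution.
  set r : ℝ := Real.sqrt (min ε (1 / 4) / 4) with hr
  have hr0 : 0 < r := Real.sqrt_pos.2 (by positivity)
  have hr2 : r ^ 2 = min ε (1 / 4) / 4 := Real.sq_sqrt (by positivity)
  set κ₀ : ℝ := r * min (Real.sqrt ε) (1 / 2) with hκ₀
  have hκ₀0 : 0 < κ₀ := by positivity
  let R : ℝ → ℝ := fun t => r * Real.exp t
  let c : ℝ → ℝ := fun κ => (κ / r) ^ 2
  let Q : ℝ → ℝ := fun t => R t ^ d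
  let h : ℝ → ℝ → ℝ := fun κ t => Q t * P (c κ) (R t ^ 2)
  let A : ℝ → ℝ → ℝ := fun κ t => d * P (c κ) (R t ^ 2) + 2 * (R t ^ 2 * w (c κ) (R t ^ 2))
  let h₁ : ℝ → ℝ → ℝ := fun κ t => Q t * A κ t
  let f₁ : ℝ → ℝ → ℝ := fun κ t => 2 * h₁ κ t / (1 + h κ t ^ 2)
  let f : ℝ → ℝ → ℝ := fun κ t => 2 * Real.arctan (h κ t)
  let ψ : ℝ → ℝ → ℝ := fun κ t => 2 * Real.arctan (κ * Real.exp t)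
  let p : ℝ → ℝ → ℝ := fun κ t => lengthFactor a (f κ t) * f₁ κ t / lengthFactor a (ψ κ t)
  have hMc : Continuous (lengthFactor a) := (contDiff_lengthFactor ha).continuous
  have hM0 : ∀ x, lengthFactor a x ≠ 0 := fun x => (lengthFactor_pos ha x).ne'
  have hh2 : ∀ κ t, 1 + h κ t ^ 2 ≠ 0 := fun κ t => by positivity
  have hRpos : ∀ t, 0 < R t := fun t => by positivity
  have hQpos : ∀ t, 0 < Q t := fun t => pow_pos (hRpos t) d
  have hRd : ∀ t, HasDerivAt R (R t) t := fun t => (Real.hasDerivAt_exp t).const_mul r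
  have hzd : ∀ t, HasDerivAt (fun t => R t ^ 2) (2 * R t ^ 2) t := fun t =>
    ((hRd t).pow 2).congr_deriv (by norm_num; ring)
  have hQd : ∀ t, HasDerivAt Q (d * Q t) t := fun t => by
    refine ((hRd t).pow d).congr_deriv ?_
    obtain ⟨m, rfl⟩ : ∃ m, d = m + 1 := ⟨d - 1, by omega⟩
    simp only [Nat.add_sub_cancel, Q, pow_succ]; ring
  have hfc : Continuous fun x : ℝ × ℝ => P (c x.1) (R x.2 ^ 2) :=
    hPc.comp (by fun_prop : Continuous fun x : ℝ × ℝ => (c x.1, R x.2 ^ 2))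
  have hwc' : Continuous fun x : ℝ × ℝ => w (c x.1) (R x.2 ^ 2) :=
    hwc.comp (by fun_prop : Continuous fun x : ℝ × ℝ => (c x.1, R x.2 ^ 2))
  have hQc : Continuous Q := by fun_prop
  have hhc : Continuous fun x : ℝ × ℝ => h x.1 x.2 := by simp only [h]; fun_prop
  have hh1c : Continuous fun x : ℝ × ℝ => h₁ x.1 x.2 := by simp only [h₁, A]; fun_prop
  have hffc : Continuous fun x : ℝ × ℝ => f x.1 x.2 := by simp only [f]; fun_prop
  have hψc : Continuous fun x : ℝ × ℝ => ψ x.1 x.2 := by simp only [ψ]; fun_prop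
  have hf1c : Continuous fun x : ℝ × ℝ => f₁ x.1 x.2 := by
    simp only [f₁]; exact Continuous.div (by fun_prop) (by fun_prop) fun x => hh2 _ _
  have hpc : Continuous fun x : ℝ × ℝ => p x.1 x.2 :=
    Continuous.div (by fun_prop) (by fun_prop) fun x => hM0 _
  have hslice : Continuous fun κ : ℝ => (κ, (0 : ℝ)) := by fun_prop
  refine ⟨r, hr0, κ₀, hκ₀0, f, p, (hffc.comp hslice).continuousOn, (hpc.comp hslice).continuousOn,
    ?_⟩
  rintro κ ⟨hκ0, hκ1⟩
  have hc0 : 0 ≤ c κ := sq_nonneg _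
  have hdiv : κ / r ≤ min (Real.sqrt ε) (1 / 2) := by
    rw [div_le_iff₀ hr0, mul_comm]; exact hκ1
  have hdiv0 : 0 ≤ κ / r := by positivity
  have hc1 : |c κ| ≤ ε := by
    rw [abs_of_nonneg hc0]
    calc c κ ≤ Real.sqrt ε ^ 2 := by
          simp only [c]; gcongr; exact hdiv.trans (min_le_left _ _)
      _ = ε := Real.sq_sqrt hε.le
  have hexp1 : Real.exp 1 < 4 := lt_trans Real.exp_one_lt_d9 (by norm_num)
  have hexp : ∀ t < (1 / 2 : ℝ), Real.exp t ^ 2 < 4 := fun t ht => by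
    rw [← Real.exp_nat_mul]
    refine lt_of_le_of_lt (Real.exp_le_exp.2 ?_) hexp1
    push_cast; linarith
  have hz : ∀ t < (1 / 2 : ℝ), R t ^ 2 ≤ min ε (1 / 4) := fun t ht => by
    simp only [R]; rw [mul_pow, hr2]
    have := hexp t ht
    have h0 : 0 < min ε (1 / 4) := by positivity
    nlinarith
  have hz1 : ∀ t < (1 / 2 : ℝ), |R t ^ 2| ≤ ε := fun t ht => by
    rw [abs_of_nonneg (by positivity)]; exact (hz t ht).trans (min_le_left _ _)
  have hRle : ∀ t < (1 / 2 : ℝ), R t ≤ 1 / 2 := fun t ht => by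
    have h4 := (hz t ht).trans (min_le_right _ _)
    refine abs_le_of_sq_le_sq' ?_ (by norm_num) |>.2
    linarith
  have hQle : ∀ t < (1 / 2 : ℝ), Q t ≤ 1 / 2 := fun t ht =>
    (pow_le_of_le_one (hRpos t).le ((hRle t ht).trans (by norm_num)) (by omega)).trans (hRle t ht)
  have hcz : ∀ t, c κ * R t ^ 2 = (κ * Real.exp t) ^ 2 := fun t => by
    simp only [c, R]; field_simp
  have hPb : ∀ t < (1 / 2 : ℝ), 7 / 8 ≤ P (c κ) (R t ^ 2) ∧ P (c κ) (R t ^ 2) ≤ 9 / 8 :=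
    fun t ht => by
      have := abs_le.1 (hsol (c κ) (R t ^ 2) hc1 (hz1 t ht)).1
      constructor <;> linarith
  have hAb : ∀ t < (1 / 2 : ℝ), 0 < A κ t ∧ A κ t ≤ 2 * d + 1 := fun t ht => by
    have h1 := abs_le.1 (hsol (c κ) (R t ^ 2) hc1 (hz1 t ht)).2.1
    have h2 := hPb t ht
    simp only [A]
    constructor <;> nlinarith
  have hhpos : ∀ t < (1 / 2 : ℝ), 0 < h κ t := fun t ht =>
    mul_pos (hQpos t) (by linarith [(hPb t ht).1])
  have hh1 : ∀ t < (1 / 2 : ℝ), h κ t < 1 := fun t ht => by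
    have h1 := hPb t ht
    have h2 := hQle t ht
    have h3 := hQpos t
    simp only [h]
    nlinarith
  have hhd : ∀ t, HasDerivAt (h κ) (h₁ κ t) t := fun t => by
    refine ((hQd t).mul ((hPd (c κ) (R t ^ 2)).comp t (hzd t))).congr_deriv ?_
    simp only [h₁, A, Function.comp_apply]; ring
  have hAd : ∀ t, HasDerivAt (A κ) (2 * (d + 2) * (R t ^ 2 * w (c κ) (R t ^ 2)) +
      4 * (R t ^ 2) ^ 2 * deriv (w (c κ)) (R t ^ 2)) t := fun t => by
    have hwd : HasDerivAt (w (c κ)) (deriv (w (c κ)) (R t ^ 2)) (R t ^ 2) :=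
      ((hws (c κ)).differentiable (by simp) _).hasDerivAt
    refine ((((hPd (c κ) (R t ^ 2)).comp t (hzd t)).const_mul (d : ℝ)).add
      (((hzd t).mul (hwd.comp t (hzd t))).const_mul 2)).congr_deriv ?_
    simp only [Function.comp_apply]; ring
  let h₂ : ℝ → ℝ := fun t => d * (d + k - 2) * h κ t - (k - 2) * h₁ κ t +
      Q t * R t ^ 2 * poleField k d a (c κ, R t ^ 2, P (c κ) (R t ^ 2), R t ^ 2 * w (c κ) (R t ^ 2))
  have hh1d : ∀ t < (1 / 2 : ℝ), HasDerivAt (h₁ κ) (h₂ t) t := fun t ht => by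
    refine ((hQd t).mul (hAd t)).congr_deriv ?_
    have hode := (hsol (c κ) (R t ^ 2) hc1 (hz1 t ht)).2.2
    rw [hN] at hode
    simp only [h₂]
    rw [← hode]
    simp only [h, h₁, A]; ring
  have hψd : ∀ t, HasDerivAt (ψ κ) (Real.sin (ψ κ t)) t := fun t => by
    refine ((((Real.hasDerivAt_exp t).const_mul κ).arctan).const_mul 2).congr_deriv ?_
    simp only [ψ]; rw [sin_two_mul_arctan]; ring
  have hfd : ∀ t, HasDerivAt (f κ) (f₁ κ t) t := fun t => by
    refine ((hhd t).arctan.const_mul 2).congr_deriv ?_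
    simp only [f₁]; ring
  have hf1d : ∀ t < (1 / 2 : ℝ), HasDerivAt (f₁ κ)
      (2 * h₂ t / (1 + h κ t ^ 2) - 4 * h κ t * h₁ κ t ^ 2 / (1 + h κ t ^ 2) ^ 2) t :=
    fun t ht => by
      refine (((hh1d t ht).const_mul 2).div (((hhd t).pow 2).const_add 1) (hh2 κ t)).congr_deriv ?_
      have := hh2 κ t
      simp only [Pi.pow_apply]
      field_simp
      ring
  have hpd : ∀ t < (1 / 2 : ℝ), HasDerivAt (p κ)
      (lengthFactor a (ψ κ t) * (d * (d + k - 2) / 2 * Real.sin (2 * f κ t)) /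
        lengthFactor a (f κ t) - (k - 2) * Real.cos (ψ κ t) * p κ t) t := fun t ht => by
    refine hasDerivAt_momentum ha (hψd t) (hfd t) (hf1d t ht) ?_
    have hm1 : metricFactor a (f κ t) = metricRat a (h κ t ^ 2) :=
      metricFactor_two_mul_arctan a (h κ t)
    have hm2 : metricFactor a (ψ κ t) = metricRat a (c κ * R t ^ 2) := by
      rw [hcz]; exact metricFactor_two_mul_arctan a _
    have hp1 : 0 < metricRat a (h κ t ^ 2) := hm1 ▸ metricFactor_pos ha _
    have hp2 : 0 < metricRat a (c κ * R t ^ 2) := hm2 ▸ metricFactor_pos ha _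
    have hp3 : 0 < 1 + c κ * R t ^ 2 := by positivity
    have hp4 : 0 < 1 + h κ t ^ 2 := by positivity
    have hid := poleField_identity (k := k) hd a (c κ) (P (c κ) (R t ^ 2))
      (R t ^ 2 * w (c κ) (R t ^ 2)) (R t ^ 2) (Q t) (by simp only [Q]; ring) hp1
    have hs1 : Real.sin (2 * f κ t) = 4 * h κ t * (1 - h κ t ^ 2) / (1 + h κ t ^ 2) ^ 2 := by
      rw [Real.sin_two_mul]; simp only [f]; rw [sin_two_mul_arctan, cos_two_mul_arctan]
      field_simp; ring
    have hs2 : Real.sin (2 * ψ κ t) * Real.sin (ψ κ t) =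
        8 * (c κ * R t ^ 2) * (1 - c κ * R t ^ 2) / (1 + c κ * R t ^ 2) ^ 3 := by
      rw [Real.sin_two_mul, hcz]; simp only [ψ]; rw [sin_two_mul_arctan, cos_two_mul_arctan]
      have : 1 + (κ * Real.exp t) ^ 2 ≠ 0 := by positivity
      field_simp; ring
    have hs3 : Real.cos (ψ κ t) = (1 - c κ * R t ^ 2) / (1 + c κ * R t ^ 2) := by
      rw [hcz]; exact cos_two_mul_arctan _
    rw [mul_assoc (a ^ 2 - 1) (Real.sin (2 * ψ κ t)), hs2, hs1, hs3, hm1, hm2]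
    have hh2' : h₂ t = d * (d + k - 2) * h κ t - (k - 2) * h₁ κ t + _ :=
      congrArg (fun x => d * (d + k - 2) * h κ t - (k - 2) * h₁ κ t + x) hid
    rw [hh2']
    change _ = -((a ^ 2 - 1) * _ * (2 * h₁ κ t / (1 + h κ t ^ 2)) ^ 2 / _) +
      _ * (2 * h₁ κ t / (1 + h κ t ^ 2)) / _ + _ - _ * (2 * h₁ κ t / (1 + h κ t ^ 2))
    change 2 * (_ - _ + (2 * h κ t * h₁ κ t ^ 2 / (1 + h κ t ^ 2) - 4 * (a ^ 2 - 1) * h κ t *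
      (1 - h κ t ^ 2) * h₁ κ t ^ 2 / ((1 + h κ t ^ 2) ^ 3 * metricRat a (h κ t ^ 2)) +
      _ * h₁ κ t / _ + d * (d + k - 2) * h κ t * (metricRat a (c κ * R t ^ 2) /
      metricRat a (h κ t ^ 2) * ((1 - h κ t ^ 2) / (1 + h κ t ^ 2)) - 1) + _ * h₁ κ t)) / _ - _ = _
    generalize h₁ κ t = y at *
    generalize c κ * R t ^ 2 = x at *
    generalize h κ t = v at *
    generalize metricRat a (v ^ 2) = m₁ at *
    generalize metricRat a x = m₂ at *
    field_simp
    ring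
  have hκe : ∀ t < (1 / 2 : ℝ), κ * Real.exp t < 1 := fun t ht => by
    have h1 : κ * Real.exp t = (κ / r) * R t := by simp only [R]; field_simp
    have h2 := hRle t ht
    have h3 := hdiv.trans (min_le_right _ _)
    rw [h1]
    nlinarith [hRpos t]
  have hR0 : Tendsto R atBot (𝓝 0) := by
    simpa using Real.tendsto_exp_atBot.const_mul r
  have hQ0 : Tendsto Q atBot (𝓝 0) := by
    simpa [show d ≠ 0 by omega] using hR0.pow d
  have hz0 : Tendsto (fun t => R t ^ 2) atBot (𝓝 0) := by simpa using hR0.pow 2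
  have hPz : Tendsto (fun t => P (c κ) (R t ^ 2)) atBot (𝓝 1) := by
    have := ((hPs (c κ)).continuous.tendsto 0).comp hz0
    rwa [hP0] at this
  have hwz : Tendsto (fun t => w (c κ) (R t ^ 2)) atBot (𝓝 (w (c κ) 0)) :=
    ((hws (c κ)).continuous.tendsto 0).comp hz0
  have hh0 : Tendsto (h κ) atBot (𝓝 0) := by simpa using hQ0.mul hPz
  have hf0 : Tendsto (f κ) atBot (𝓝 0) := by
    simpa using ((Real.continuous_arctan.tendsto 0).comp hh0).const_mul 2
  have hA0 : Tendsto (A κ) atBot (𝓝 d) := by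
    simpa using (hPz.const_mul (d : ℝ)).add ((hz0.mul hwz).const_mul 2)
  have hh10 : Tendsto (h₁ κ) atBot (𝓝 0) := by simpa using hQ0.mul hA0
  have hψ0 : Tendsto (ψ κ) atBot (𝓝 0) := by
    have h1 : Tendsto (fun t => κ * Real.exp t) atBot (𝓝 0) := by
      simpa using Real.tendsto_exp_atBot.const_mul κ
    simpa using ((Real.continuous_arctan.tendsto 0).comp h1).const_mul 2
  have hf10 : Tendsto (f₁ κ) atBot (𝓝 0) := by
    have : Tendsto (f₁ κ) atBot (𝓝 (2 * 0 / (1 + 0 ^ 2))) :=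
      (hh10.const_mul 2).div ((hh0.pow 2).const_add 1) (by norm_num)
    simpa only [mul_zero, zero_div] using this
  refine ⟨fun t ht => ?_, fun t ht => ?_, hf0, ?_, fun hκ => ?_⟩
  · refine ((hψd t).prodMk ((hfd t).prodMk (hpd t ht))).congr_deriv ?_
    have e1 : f₁ κ t = lengthFactor a (ψ κ t) * p κ t / lengthFactor a (f κ t) := by
      have := hM0 (ψ κ t)
      have := hM0 (f κ t)
      simp only [p]
      field_simp
    rw [e1]
    rfl
  · refine ⟨?_, ?_, ?_, hκe t ht⟩
    · exact mul_pos two_pos (Real.arctan_pos.2 (hhpos t ht))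
    · have : Real.arctan (h κ t) < Real.pi / 4 := by
        rw [← Real.arctan_one]; exact Real.arctan_strictMono (hh1 t ht)
      simp only [f]; linarith
    · have h1 : 0 < h₁ κ t := mul_pos (hQpos t) (hAb t ht).1
      have h2 := lengthFactor_pos ha (f κ t)
      have h3 := lengthFactor_pos ha (ψ κ t)
      simp only [p, f₁]
      positivity
  · have h1 := (hMc.tendsto 0).comp hf0
    have h2 := (hMc.tendsto 0).comp hψ0
    have : Tendsto (p κ) atBot (𝓝 (lengthFactor a 0 * 0 / lengthFactor a 0)) :=
      (h1.mul hf10).div h2 (hM0 0)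
    simpa only [mul_zero, zero_div] using this
  · refine ⟨fun x => (r / κ) ^ d * P (c κ) ((r / κ) ^ 2 * x), ?_, by simp [hP0], fun t ht => ?_⟩
    · have := hPs (c κ)
      fun_prop
    · have e1 : (r / κ) ^ 2 * (κ * Real.exp t) ^ 2 = R t ^ 2 := by
        simp only [R]; field_simp
      have e2 : (κ * Real.exp t) ^ d * (r / κ) ^ d = Q t := by
        simp only [Q, R]; rw [← mul_pow]; congr 1; field_simp
      simp only [f, h]
      rw [e1, ← mul_assoc, e2]

end ReducedEquation

/-! ### Global flows and truncation of the momentum -/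

section Flow

open Set Filter Topology

open scoped NNReal

theorem dist_le_exp_of_trajectories {E : Type*} [NormedAddCommGroup E] [NormedSpace ℝ E]
    {v : E → E} {K : ℝ≥0} (hL : LipschitzWith K v) {f g : ℝ → E}
    (hf : ∀ t, HasDerivAt f (v (f t)) t) (hg : ∀ t, HasDerivAt g (v (g t)) t) (t : ℝ) :
    dist (f t) (g t) ≤ dist (f 0) (g 0) * Real.exp (K * |t|) := by
  have main : ∀ {w : E → E}, LipschitzWith K w → ∀ {f g : ℝ → E},
      (∀ t, HasDerivAt f (w (f t)) t) → (∀ t, HasDerivAt g (w (g t)) t) → ∀ t, 0 ≤ t →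
      dist (f t) (g t) ≤ dist (f 0) (g 0) * Real.exp (K * t) := by
    intro w hw f g hf hg t ht
    have := dist_le_of_trajectories_ODE (v := fun _ => w) (a := 0) (b := t) (fun _ => hw)
      (fun s _ => (hf s).continuousAt.continuousWithinAt)
      (fun s _ => (hf s).hasDerivWithinAt)
      (fun s _ => (hg s).continuousAt.continuousWithinAt)
      (fun s _ => (hg s).hasDerivWithinAt) le_rfl t ⟨ht, le_rfl⟩
    rwa [sub_zero] at this
  rcases le_total 0 t with ht | ht
  · rw [abs_of_nonneg ht]; exact main hL hf hg t ht
  · have hrev : ∀ {f : ℝ → E}, (∀ t, HasDerivAt f (v (f t)) t) →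
        ∀ t, HasDerivAt (fun s => f (-s)) (-v (f (-t))) t := fun hf t => by
      have := (hf (-t)).scomp t (hasDerivAt_neg t)
      exact this.congr_deriv (by simp)
    have := main (w := fun x => -v x) hL.neg (hrev hf) (hrev hg) (-t) (by linarith)
    rw [abs_of_nonpos ht]
    simpa using this

theorem eq_of_trajectories {E : Type*} [NormedAddCommGroup E] [NormedSpace ℝ E]
    {v : E → E} {K : ℝ≥0} (hL : LipschitzWith K v) {f g : ℝ → E}
    (hf : ∀ t, HasDerivAt f (v (f t)) t) (hg : ∀ t, HasDerivAt g (v (g t)) t) {t₀ : ℝ}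
    (h : f t₀ = g t₀) : f = g :=
  ODE_solution_unique_univ (v := fun _ => v) (s := fun _ => univ) (fun _ => hL.lipschitzOnWith)
    (fun t => ⟨hf t, trivial⟩) (fun t => ⟨hg t, trivial⟩) h

/-- A bounded, globally Lipschitz vector field has a global flow. The boundedness makes the
Picard-Lindelöf theorem applicable on time intervals of any length. -/
theorem exists_global_flow {E : Type*} [NormedAddCommGroup E] [NormedSpace ℝ E] [CompleteSpace E]
    {v : E → E} {C K : ℝ≥0} (hb : ∀ x, ‖v x‖ ≤ C) (hL : LipschitzWith K v) :
    ∃ Φ : E → ℝ → E, (∀ x, Φ x 0 = x) ∧ (∀ x t, HasDerivAt (Φ x) (v (Φ x t)) t) ∧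
      Continuous (Function.uncurry Φ) := by
  have hex : ∀ (x : E) (n : ℕ), ∃ α : ℝ → E, α 0 = x ∧
      ∀ t ∈ Ioo (-(n + 1 : ℝ)) (n + 1), HasDerivAt α (v (α t)) t := by
    intro x n
    have h0 : (0 : ℝ) ∈ Icc (-(n + 1 : ℝ)) (n + 1) := ⟨by linarith [n.cast_nonneg (α := ℝ)], by positivity⟩
    have hpl : IsPicardLindelof (fun _ => v) (tmin := -(n + 1 : ℝ)) (tmax := n + 1) ⟨0, h0⟩ x
        (C * (n + 1)) 0 C K :=
      { lipschitzOnWith := fun t _ => hL.lipschitzOnWith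
        continuousOn := fun _ _ => continuousOn_const
        norm_le := fun t _ x _ => hb x
        mul_max_le := by simp }
    obtain ⟨α, hα0, hα⟩ := hpl.exists_eq_forall_mem_Icc_hasDerivWithinAt₀
    exact ⟨α, hα0, fun t ht => (hα t ⟨ht.1.le, ht.2.le⟩).hasDerivAt (Icc_mem_nhds ht.1 ht.2)⟩
  choose α hα0 hα using hex
  have hagree : ∀ x (n m : ℕ) (t : ℝ), |t| < n + 1 → |t| < m + 1 → α x n t = α x m t := by
    intro x n m t hn hm
    wlog hnm : n ≤ m generalizing n m
    · exact (this m n hm hn (by omega)).symm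
    have hnm' : (n : ℝ) ≤ m := by exact_mod_cast hnm
    refine ODE_solution_unique_of_mem_Ioo (v := fun _ => v) (s := fun _ => univ)
      (fun _ _ => hL.lipschitzOnWith) (a := -(n + 1 : ℝ)) (b := n + 1) (t₀ := 0)
      ⟨by linarith [n.cast_nonneg (α := ℝ)], by positivity⟩
      (fun t ht => ⟨hα x n t ht, trivial⟩)
      (fun t ht => ⟨hα x m t ⟨by linarith [ht.1], by linarith [ht.2]⟩, trivial⟩)
      (by rw [hα0, hα0]) (abs_lt.1 hn)
  let Φ : E → ℝ → E := fun x t => α x ⌈|t|⌉₊ t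
  have hΦ : ∀ x t, HasDerivAt (Φ x) (v (Φ x t)) t := by
    intro x t
    have ht : |t| < ⌈|t|⌉₊ + 1 := (Nat.le_ceil _).trans_lt (lt_add_one _)
    have hev : Φ x =ᶠ[𝓝 t] α x ⌈|t|⌉₊ := by
      have : ∀ᶠ s : ℝ in 𝓝 t, |s| < (⌈|t|⌉₊ : ℝ) + 1 := continuous_abs.continuousAt.eventually_lt_const ht
      filter_upwards [this] with s hs
      exact hagree x _ _ s ((Nat.le_ceil _).trans_lt (lt_add_one _)) hs
    exact (hα x _ t (abs_lt.1 ht)).congr_of_eventuallyEq hev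
  have hΦ0 : ∀ x, Φ x 0 = x := fun x => hα0 x _
  refine ⟨Φ, hΦ0, hΦ, ?_⟩
  rw [continuous_iff_continuousAt]
  rintro ⟨x, t⟩
  rw [ContinuousAt, tendsto_iff_dist_tendsto_zero]
  have hbound : ∀ y : E × ℝ, dist (Function.uncurry Φ y) (Function.uncurry Φ (x, t)) ≤
      dist y.1 x * Real.exp (K * |y.2|) + dist (Φ x y.2) (Φ x t) := fun y => by
    have := dist_le_exp_of_trajectories hL (hΦ y.1) (hΦ x) y.2
    rw [hΦ0, hΦ0] at this
    exact (dist_triangle _ (Φ x y.2) _).trans (add_le_add_left this _)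
  refine squeeze_zero (fun _ => dist_nonneg) hbound ?_
  have hc : Continuous (Φ x) := continuous_iff_continuousAt.2 fun t => (hΦ x t).continuousAt
  have : Continuous fun y : E × ℝ => dist y.1 x * Real.exp (K * |y.2|) + dist (Φ x y.2) (Φ x t) := by
    fun_prop
  simpa using this.tendsto (x, t)

end Flow

section BoundedLipschitz

/-- Bounded and Lipschitz real functions. -/
def IsBoundedLipschitz {X : Type*} [PseudoMetricSpace X] (g : X → ℝ) : Prop :=
  ∃ C K : ℝ, (∀ x, |g x| ≤ C) ∧ ∀ x y, |g x - g y| ≤ K * dist x y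

variable {X Y : Type*} [PseudoMetricSpace X] [PseudoMetricSpace Y]

theorem IsBoundedLipschitz.mul {g h : X → ℝ} (hg : IsBoundedLipschitz g)
    (hh : IsBoundedLipschitz h) : IsBoundedLipschitz fun x => g x * h x := by
  obtain ⟨C, K, hC, hK⟩ := hg
  obtain ⟨C', K', hC', hK'⟩ := hh
  refine ⟨C * C', C * K' + K * C', fun x => ?_, fun x y => ?_⟩
  · rw [abs_mul]
    exact mul_le_mul (hC x) (hC' x) (abs_nonneg _) ((abs_nonneg _).trans (hC x))
  · have e : g x * h x - g y * h y = g x * (h x - h y) + (g x - g y) * h y := by ring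
    rw [e]
    have h1 : |g x * (h x - h y)| ≤ C * (K' * dist x y) := by
      rw [abs_mul]
      exact mul_le_mul (hC x) (hK' x y) (abs_nonneg _) ((abs_nonneg _).trans (hC x))
    have h2 : |(g x - g y) * h y| ≤ K * dist x y * C' := by
      rw [abs_mul]
      exact mul_le_mul (hK x y) (hC' y) (abs_nonneg _) ((abs_nonneg _).trans (hK x y))
    have := abs_add_le (g x * (h x - h y)) ((g x - g y) * h y)
    linarith

theorem IsBoundedLipschitz.sub {g h : X → ℝ} (hg : IsBoundedLipschitz g)
    (hh : IsBoundedLipschitz h) : IsBoundedLipschitz fun x => g x - h x := by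
  obtain ⟨C, K, hC, hK⟩ := hg
  obtain ⟨C', K', hC', hK'⟩ := hh
  refine ⟨C + C', K + K', fun x => ?_, fun x y => ?_⟩
  · exact (abs_sub _ _).trans (add_le_add (hC x) (hC' x))
  · have e : g x - h x - (g y - h y) = (g x - g y) - (h x - h y) := by ring
    rw [e, add_mul]
    exact (abs_sub _ _).trans (add_le_add (hK x y) (hK' x y))

theorem IsBoundedLipschitz.comp {g : Y → ℝ} (hg : IsBoundedLipschitz g) {i : X → Y}
    (hi : LipschitzWith 1 i) : IsBoundedLipschitz fun x => g (i x) := by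
  obtain ⟨C, K, hC, hK⟩ := hg
  refine ⟨C, |K|, fun x => hC _, fun x y => (hK _ _).trans ?_⟩
  have := hi.dist_le_mul x y
  rw [NNReal.coe_one, one_mul] at this
  exact mul_le_mul (le_abs_self K) this dist_nonneg (abs_nonneg K)

theorem isBoundedLipschitz_const (c : ℝ) : IsBoundedLipschitz fun _ : X => c :=
  ⟨|c|, 0, fun _ => le_rfl, fun _ _ => by simp⟩

theorem isBoundedLipschitz_of_deriv {g g' : ℝ → ℝ} (hg : ∀ x, HasDerivAt g (g' x) x) {C K : ℝ}
    (hC : ∀ x, |g x| ≤ C) (hK : ∀ x, |g' x| ≤ K) : IsBoundedLipschitz g := by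
  refine ⟨C, K, hC, fun x y => ?_⟩
  exact convex_univ.norm_image_sub_le_of_norm_hasDerivWithin_le
    (fun x _ => (hg x).hasDerivWithinAt) (fun x _ => hK x) (Set.mem_univ y) (Set.mem_univ x)

theorem exists_lipschitzWith_of_isBoundedLipschitz {X : Type*} [SeminormedAddCommGroup X]
    {g₁ g₂ g₃ : X → ℝ} (h₁ : IsBoundedLipschitz g₁) (h₂ : IsBoundedLipschitz g₂)
    (h₃ : IsBoundedLipschitz g₃) :
    ∃ C K : NNReal, (∀ x, ‖(g₁ x, g₂ x, g₃ x)‖ ≤ C) ∧ LipschitzWith K fun x => (g₁ x, g₂ x, g₃ x) := by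
  obtain ⟨C₁, K₁, hC₁, hK₁⟩ := h₁
  obtain ⟨C₂, K₂, hC₂, hK₂⟩ := h₂
  obtain ⟨C₃, K₃, hC₃, hK₃⟩ := h₃
  refine ⟨Real.toNNReal (max C₁ (max C₂ C₃)), Real.toNNReal (max K₁ (max K₂ K₃)), fun x => ?_,
    LipschitzWith.of_dist_le_mul fun x y => ?_⟩
  · refine le_trans ?_ (Real.le_coe_toNNReal _)
    simp only [Prod.norm_def, Real.norm_eq_abs]
    exact max_le_max (hC₁ x) (max_le_max (hC₂ x) (hC₃ x))
  · have h0 : ∀ {K}, K ≤ max K₁ (max K₂ K₃) →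
        K * dist x y ≤ Real.toNNReal (max K₁ (max K₂ K₃)) * dist x y := fun h =>
      mul_le_mul_of_nonneg_right (h.trans (Real.le_coe_toNNReal _)) dist_nonneg
    simp only [Prod.dist_eq, Real.dist_eq]
    refine max_le ((hK₁ x y).trans (h0 (le_max_left _ _))) (max_le ((hK₂ x y).trans (h0 ?_))
      ((hK₃ x y).trans (h0 ?_)))
    · exact (le_max_left _ _).trans (le_max_right _ _)
    · exact (le_max_right _ _).trans (le_max_right _ _)

end BoundedLipschitz

section ReducedFlow

theorem min_le_metricFactor (a x : ℝ) : min 1 (a ^ 2) ≤ metricFactor a x := by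
  have h := Real.sin_sq_add_cos_sq x
  have h1 := min_le_left 1 (a ^ 2)
  have h2 := min_le_right 1 (a ^ 2)
  rw [metricFactor]
  nlinarith [sq_nonneg (Real.sin x), sq_nonneg (Real.cos x)]

theorem metricFactor_le (a x : ℝ) : metricFactor a x ≤ 1 + a ^ 2 := by
  have h := Real.sin_sq_add_cos_sq x
  rw [metricFactor]
  nlinarith [sq_nonneg (Real.sin x), sq_nonneg (Real.cos x), sq_nonneg a]

theorem isBoundedLipschitz_lengthFactor {a : ℝ} (ha : a ≠ 0) :
    IsBoundedLipschitz (lengthFactor a) ∧ IsBoundedLipschitz fun x => (lengthFactor a x)⁻¹ := by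
  set μ := Real.sqrt (min 1 (a ^ 2)) with hμ
  have hμ0 : 0 < μ := Real.sqrt_pos.2 (by positivity)
  have hlow : ∀ x, μ ≤ lengthFactor a x := fun x => Real.sqrt_le_sqrt (min_le_metricFactor a x)
  have hsin : ∀ x, |(a ^ 2 - 1) * Real.sin (2 * x)| ≤ |a ^ 2 - 1| := fun x => by
    rw [abs_mul]
    exact mul_le_of_le_one_right (abs_nonneg _) (Real.abs_sin_le_one _)
  have hd : ∀ x, |(a ^ 2 - 1) * Real.sin (2 * x) / (2 * lengthFactor a x)| ≤
      |a ^ 2 - 1| / (2 * μ) := fun x => by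
    have h := lengthFactor_pos ha x
    rw [abs_div, abs_of_pos (by positivity : 0 < 2 * lengthFactor a x)]
    have := hlow x
    have := hsin x
    gcongr
  constructor
  · refine isBoundedLipschitz_of_deriv (hasDerivAt_lengthFactor ha)
      (C := Real.sqrt (1 + a ^ 2)) (fun x => ?_) hd
    rw [abs_of_pos (lengthFactor_pos ha x)]
    exact Real.sqrt_le_sqrt (metricFactor_le a x)
  · refine isBoundedLipschitz_of_deriv
      (fun x => (hasDerivAt_lengthFactor ha x).inv (lengthFactor_pos ha x).ne')
      (C := μ⁻¹) (K := |a ^ 2 - 1| / (2 * μ) / μ ^ 2) (fun x => ?_) (fun x => ?_)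
    · rw [abs_inv, abs_of_pos (lengthFactor_pos ha x)]
      exact inv_anti₀ hμ0 (hlow x)
    · rw [abs_div, abs_neg, abs_of_pos (by have := lengthFactor_pos ha x; positivity :
        0 < lengthFactor a x ^ 2)]
      have := hd x
      have := hlow x
      gcongr

/-- The truncation of `p` to `[-B, B]`. -/
noncomputable def clip (B p : ℝ) : ℝ := max (-B) (min B p)

theorem abs_clip_le {B : ℝ} (hB : 0 ≤ B) (p : ℝ) : |clip B p| ≤ B :=
  abs_le.2 ⟨le_max_left _ _, max_le (by linarith) (min_le_left _ _)⟩

theorem clip_eq_self {B p : ℝ} (h : |p| ≤ B) : clip B p = p := by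
  rw [clip, min_eq_right (abs_le.1 h).2, max_eq_right (abs_le.1 h).1]

theorem eq_of_abs_clip_lt {B p : ℝ} (h : |clip B p| < B) : clip B p = p := by
  have h' := abs_lt.1 h
  unfold clip at *
  rcases le_total B p with h1 | h1
  · rw [min_eq_left h1] at h'
    have := le_max_right (-B) B
    linarith
  · rw [min_eq_right h1] at h' ⊢
    rcases le_total (-B) p with h2 | h2
    · exact max_eq_right h2
    · rw [max_eq_left h2] at h'; linarith

theorem isBoundedLipschitz_clip {B : ℝ} (hB : 0 ≤ B) : IsBoundedLipschitz (clip B) := by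
  refine ⟨B, 1, abs_clip_le hB, fun x y => ?_⟩
  rw [one_mul, Real.dist_eq]
  have h1 := abs_max_sub_max_le_abs (min B x) (min B y) (-B)
  have h2 := abs_min_sub_min_le_max B x B y
  rw [sub_self, abs_zero, max_eq_right (abs_nonneg _)] at h2
  rw [max_comm (min B x), max_comm (min B y)] at h1
  exact h1.trans h2

/-- The antiderivative of the truncation: the kinetic energy of the truncated system. -/
noncomputable def clipEnergy (B p : ℝ) : ℝ := p * clip B p - clip B p ^ 2 / 2

theorem hasDerivAt_clipEnergy {B : ℝ} (hB : 0 ≤ B) (p : ℝ) :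
    HasDerivAt (clipEnergy B) (clip B p) p := by
  rw [hasDerivAt_iff_isLittleO]
  have hbound : ∀ x, ‖clipEnergy B x - clipEnergy B p - (x - p) • clip B p‖ ≤
      1 * ‖‖x - p‖ ^ 2‖ := fun x => by
    rw [one_mul, norm_pow, norm_norm, Real.norm_eq_abs, Real.norm_eq_abs, sq_abs, smul_eq_mul]
    unfold clipEnergy clip
    rw [abs_le]
    rcases le_total B x with h1 | h1 <;> rcases le_total B p with h2 | h2 <;>
    rcases le_total (-B) x with h3 | h3 <;> rcases le_total (-B) p with h4 | h4 <;>
    simp only [min_eq_left, min_eq_right, max_eq_left, max_eq_right, *,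
      max_eq_right (show -B ≤ B by linarith)] <;> constructor <;> nlinarith
  refine (Asymptotics.IsBigO.of_bound 1 (Filter.Eventually.of_forall hbound)).trans_isLittleO ?_
  exact Asymptotics.isLittleO_pow_sub_sub p (by norm_num)

theorem sq_clip_le {B : ℝ} (hB : 0 ≤ B) (p : ℝ) : clip B p ^ 2 / 2 ≤ clipEnergy B p := by
  unfold clipEnergy clip
  rcases le_total B p with h1 | h1 <;> rcases le_total (-B) p with h2 | h2 <;>
    simp only [min_eq_left, min_eq_right, max_eq_left, max_eq_right, *,
      max_eq_right (show -B ≤ B by linarith)] <;> nlinarith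

/-- The reduced system with truncated momentum. -/
noncomputable def clippedField (q lam a B : ℝ) (s : ℝ × ℝ × ℝ) : ℝ × ℝ × ℝ :=
  reducedField q lam a (s.1, s.2.1, clip B s.2.2)

theorem exists_bound_clippedField (q lam : ℝ) {a B : ℝ} (ha : a ≠ 0) (hB : 0 ≤ B) :
    ∃ C K : NNReal, (∀ s, ‖clippedField q lam a B s‖ ≤ C) ∧
      LipschitzWith K (clippedField q lam a B) := by
  have p1 : LipschitzWith 1 (fun s : ℝ × ℝ × ℝ => s.1) := LipschitzWith.prod_fst
  have p2 : LipschitzWith 1 (fun s : ℝ × ℝ × ℝ => s.2.1) := by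
    have := LipschitzWith.prod_fst.comp (LipschitzWith.prod_snd (α := ℝ) (β := ℝ × ℝ))
    rwa [one_mul] at this
  have p3 : LipschitzWith 1 (fun s : ℝ × ℝ × ℝ => s.2.2) := by
    have := LipschitzWith.prod_snd.comp (LipschitzWith.prod_snd (α := ℝ) (β := ℝ × ℝ))
    rwa [one_mul] at this
  have hsin : IsBoundedLipschitz Real.sin := isBoundedLipschitz_of_deriv Real.hasDerivAt_sin
    Real.abs_sin_le_one Real.abs_cos_le_one
  have hcos : IsBoundedLipschitz Real.cos := isBoundedLipschitz_of_deriv Real.hasDerivAt_cos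
    Real.abs_cos_le_one (fun x => by rw [abs_neg]; exact Real.abs_sin_le_one x)
  have hsin2 : IsBoundedLipschitz fun x => Real.sin (2 * x) := by
    refine isBoundedLipschitz_of_deriv (g' := fun x => Real.cos (2 * x) * 2) (C := 1) (K := 2)
      (fun x => ?_) (fun x => Real.abs_sin_le_one _) (fun x => ?_)
    · exact ((Real.hasDerivAt_sin (2 * x)).comp x ((hasDerivAt_id x).const_mul 2)).congr_deriv
        (by simp)
    · rw [abs_mul, abs_two]; linarith [Real.abs_cos_le_one (2 * x)]
  obtain ⟨hM, hMi⟩ := isBoundedLipschitz_lengthFactor ha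
  have hp : IsBoundedLipschitz fun s : ℝ × ℝ × ℝ => clip B s.2.2 :=
    (isBoundedLipschitz_clip hB).comp p3
  have e : clippedField q lam a B = fun s => (Real.sin s.1,
      lengthFactor a s.1 * clip B s.2.2 * (lengthFactor a s.2.1)⁻¹,
      lengthFactor a s.1 * (lam / 2 * Real.sin (2 * s.2.1)) * (lengthFactor a s.2.1)⁻¹ -
      q * Real.cos s.1 * clip B s.2.2) := rfl
  rw [e]
  exact exists_lipschitzWith_of_isBoundedLipschitz (hsin.comp p1)
    (((hM.comp p1).mul hp).mul (hMi.comp p2))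
    ((((hM.comp p1).mul ((isBoundedLipschitz_const _).mul (hsin2.comp p2))).mul
      (hMi.comp p2)).sub (((isBoundedLipschitz_const _).mul (hcos.comp p1)).mul hp))

end ReducedFlow

/-! ### The family of solutions starting at the pole -/

section ReducedFamily

open Set Filter Topology

/-- The energy `p²/2 - (λ/2) sin² f` is damped on the hemisphere `ψ ≤ π/2`. -/
theorem hasDerivAt_energy {q lam a : ℝ} (ha : a ≠ 0) {ψ f p : ℝ → ℝ} {τ : ℝ}
    (h : HasDerivAt (fun t => (ψ t, f t, p t)) (reducedField q lam a (ψ τ, f τ, p τ)) τ) :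
    HasDerivAt (fun t => p t ^ 2 / 2 - lam / 2 * Real.sin (f t) ^ 2)
      (-(q * Real.cos (ψ τ) * p τ ^ 2)) τ := by
  have hf : HasDerivAt f (lengthFactor a (ψ τ) * p τ / lengthFactor a (f τ)) τ := h.snd.fst
  have hp : HasDerivAt p (lengthFactor a (ψ τ) * (lam / 2 * Real.sin (2 * f τ)) /
    lengthFactor a (f τ) - q * Real.cos (ψ τ) * p τ) τ := h.snd.snd
  refine (((hp.pow 2).div_const 2).sub ((hf.sin.pow 2).const_mul (lam / 2))).congr_deriv ?_
  have := (lengthFactor_pos ha (f τ)).ne'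
  rw [Real.sin_two_mul]
  field_simp
  ring

theorem hasDerivAt_clippedEnergy {q lam a B : ℝ} (ha : a ≠ 0) (hB : 0 ≤ B) {ψ f p : ℝ → ℝ} {τ : ℝ}
    (h : HasDerivAt (fun t => (ψ t, f t, p t)) (clippedField q lam a B (ψ τ, f τ, p τ)) τ) :
    HasDerivAt (fun t => clipEnergy B (p t) - lam / 2 * Real.sin (f t) ^ 2)
      (-(q * Real.cos (ψ τ) * clip B (p τ) ^ 2)) τ := by
  have hf : HasDerivAt f (lengthFactor a (ψ τ) * clip B (p τ) / lengthFactor a (f τ)) τ :=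
    h.snd.fst
  have hp : HasDerivAt p (lengthFactor a (ψ τ) * (lam / 2 * Real.sin (2 * f τ)) /
    lengthFactor a (f τ) - q * Real.cos (ψ τ) * clip B (p τ)) τ := h.snd.snd
  refine (((hasDerivAt_clipEnergy hB (p τ)).comp τ hp).sub
    ((hf.sin.pow 2).const_mul (lam / 2))).congr_deriv ?_
  have := (lengthFactor_pos ha (f τ)).ne'
  rw [Real.sin_two_mul]
  field_simp
  ring

theorem cos_two_mul_arctan_nonneg {x : ℝ} (h0 : 0 ≤ x) (h1 : x ≤ 1) :
    0 ≤ Real.cos (2 * Real.arctan x) := by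
  rw [cos_two_mul_arctan]
  have : x ^ 2 ≤ 1 := pow_le_one₀ h0 h1
  exact div_nonneg (by linarith) (by positivity)

theorem clippedField_eq {q lam a B ψ f p : ℝ} (h : clip B p = p) :
    clippedField q lam a B (ψ, f, p) = reducedField q lam a (ψ, f, p) := by
  simp only [clippedField, h]

/-- The one-parameter family of solutions of the reduced system that start at the pole. The momenta
are truncated at a height `B` that they do not reach while `ψ ≤ π/2`. For `κ = 0` the solution
lies in the invariant plane `ψ = 0`. -/
theorem exists_trajectory_family {k d : ℕ} (hk : 3 ≤ k) (hd : 1 ≤ d) {a : ℝ} (ha : a ≠ 0) :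
    ∃ B > 0, ∃ r > 0, ∃ κ₀ > 0, ∃ f p : ℝ → ℝ → ℝ,
      Continuous (Function.uncurry f) ∧ Continuous (Function.uncurry p) ∧
      ∀ κ ∈ Icc 0 κ₀,
        (∀ τ, HasDerivAt (fun t => (2 * Real.arctan (κ * Real.exp t), f κ t, p κ t))
          (clippedField (k - 2) (d * (d + k - 2)) a B
            (2 * Real.arctan (κ * Real.exp τ), f κ τ, p κ τ)) τ) ∧
        (∀ τ ≤ 0, 0 < f κ τ ∧ f κ τ < Real.pi / 2 ∧ κ * Real.exp τ < 1) ∧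
        (∀ τ, κ * Real.exp τ ≤ 1 → |p κ τ| < B ∧
          p κ τ ^ 2 / 2 - (d * (d + k - 2) : ℝ) / 2 * Real.sin (f κ τ) ^ 2 < 0) ∧
        (0 < κ → ∃ P : ℝ → ℝ, ContDiff ℝ ∞ P ∧ P 0 = (r / κ) ^ d ∧ ∀ τ ≤ 0,
          f κ τ = 2 * Real.arctan ((κ * Real.exp τ) ^ d * P ((κ * Real.exp τ) ^ 2))) := by
  obtain ⟨r, hr, κ₀, hκ₀, f, p, hfc, hpc, hloc⟩ := exists_local_trajectory hk hd ha
  have hkR : (3 : ℝ) ≤ k := by exact_mod_cast hk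
  have hdR : (1 : ℝ) ≤ d := by exact_mod_cast hd
  set q : ℝ := k - 2 with hq
  set lam : ℝ := d * (d + k - 2) with hlam
  have hq0 : 0 < q := by rw [hq]; linarith
  have hlam0 : 0 < lam := by rw [hlam]; nlinarith
  set B : ℝ := Real.sqrt lam + 1 with hBdef
  have hB0 : 0 < B := by positivity
  have hlamB : ∀ x : ℝ, x ^ 2 ≤ lam → |x| < B := fun x hx => by
    have := Real.abs_le_sqrt hx
    linarith
  obtain ⟨C, K, hC, hK⟩ := exists_bound_clippedField q lam ha hB0.le
  obtain ⟨Φ, hΦ0, hΦ, hΦc⟩ := exists_global_flow hC hK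
  -- Energy of the local solutions.
  have hE : ∀ κ ∈ Icc 0 κ₀, ∀ τ < 1 / 2,
      p κ τ ^ 2 / 2 - lam / 2 * Real.sin (f κ τ) ^ 2 < 0 := by
    intro κ hκ
    obtain ⟨hd1, hb1, hf0, hp0, -⟩ := hloc κ hκ
    set E : ℝ → ℝ := fun t => p κ t ^ 2 / 2 - lam / 2 * Real.sin (f κ t) ^ 2 with hEdef
    have hEd : ∀ τ < 1 / 2, HasDerivAt E _ τ := fun τ hτ => hasDerivAt_energy ha (hd1 τ hτ)
    have hanti : StrictAntiOn E (Iio (1 / 2)) := by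
      refine strictAntiOn_of_deriv_neg (convex_Iio _)
        (fun τ hτ => (hEd τ hτ).continuousAt.continuousWithinAt) fun τ hτ => ?_
      rw [interior_Iio] at hτ
      rw [(hEd τ hτ).deriv]
      have hpos := hb1 τ hτ
      have hcos : 0 < Real.cos (2 * Real.arctan (κ * Real.exp τ)) := by
        rw [cos_two_mul_arctan]
        have h0 : 0 ≤ κ * Real.exp τ := mul_nonneg hκ.1 (Real.exp_pos τ).le
        have : (κ * Real.exp τ) ^ 2 < 1 := pow_lt_one₀ h0 hpos.2.2.2 two_ne_zero
        exact div_pos (by linarith) (by positivity)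
      have := hpos.2.2.1
      have : 0 < q * Real.cos (2 * Real.arctan (κ * Real.exp τ)) * p κ τ ^ 2 := by positivity
      linarith
    have hlim : Tendsto E atBot (𝓝 0) := by
      have h1 := (hp0.pow 2).div_const 2
      have h2 := (((Real.continuous_sin.tendsto 0).comp hf0).pow 2).const_mul (lam / 2)
      simpa using h1.sub h2
    have hle : ∀ τ < 1 / 2, E τ ≤ 0 := fun τ hτ => by
      refine ge_of_tendsto hlim ?_
      filter_upwards [eventually_le_atBot τ] with t ht
      exact hanti.antitoneOn (lt_of_le_of_lt ht hτ) hτ ht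
    intro τ hτ
    exact (hanti (show τ - 1 < 1 / 2 by linarith) hτ (by linarith)).trans_le
      (hle (τ - 1) (by linarith))
  have hpB : ∀ κ ∈ Icc 0 κ₀, ∀ τ < 1 / 2, |p κ τ| < B := fun κ hκ τ hτ => by
    refine hlamB _ ?_
    have := hE κ hκ τ hτ
    have := Real.sin_sq_le_one (f κ τ)
    nlinarith
  -- Clamping the parameter makes the initial data continuous on the whole line.
  let pr : ℝ → ℝ := fun κ => (projIcc 0 κ₀ hκ₀.le κ : ℝ)
  have hprc : Continuous pr := continuous_subtype_val.comp continuous_projIcc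
  have hpr : ∀ κ ∈ Icc 0 κ₀, pr κ = κ := fun κ hκ => by simp only [pr, projIcc_of_mem hκ₀.le hκ]
  have hprm : ∀ κ, pr κ ∈ Icc 0 κ₀ := fun κ => (projIcc 0 κ₀ hκ₀.le κ).2
  let init : ℝ → ℝ × ℝ × ℝ := fun κ => (2 * Real.arctan (pr κ), f (pr κ) 0, p (pr κ) 0)
  have hinit : Continuous init := by
    refine (continuous_const.mul (Real.continuous_arctan.comp hprc)).prodMk
      ((hfc.comp_continuous hprc hprm).prodMk (hpc.comp_continuous hprc hprm))
  have hG : Continuous fun x : ℝ × ℝ => Φ (init x.1) x.2 :=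
    hΦc.comp (by fun_prop : Continuous fun x : ℝ × ℝ => (init x.1, x.2))
  have hlocal : ∀ κ ∈ Icc 0 κ₀, ∀ τ ≤ 0,
      Φ (init κ) τ = (2 * Real.arctan (κ * Real.exp τ), f κ τ, p κ τ) := by
    intro κ hκ τ hτ
    refine ODE_solution_unique_of_mem_Ioo (v := fun _ => clippedField q lam a B)
      (f := Φ (init κ)) (g := fun t => (2 * Real.arctan (κ * Real.exp t), f κ t, p κ t))
      (s := fun _ => univ) (fun _ _ => hK.lipschitzOnWith) (a := τ - 1) (b := 1 / 2) (t₀ := 0)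
      ⟨by linarith, by norm_num⟩ (fun t _ => ⟨hΦ _ t, trivial⟩) (fun t ht => ⟨?_, trivial⟩) ?_
      ⟨by linarith, by linarith⟩
    · have := (hloc κ hκ).1 t ht.2
      rwa [← clippedField_eq (clip_eq_self (hpB κ hκ t ht.2).le)] at this
    · rw [hΦ0]; simp only [init, hpr κ hκ, Real.exp_zero, mul_one]
  have hψ : ∀ κ ∈ Icc 0 κ₀, ∀ τ, (Φ (init κ) τ).1 = 2 * Real.arctan (κ * Real.exp τ) := by
    intro κ hκ τ
    have hsin : LipschitzWith 1 Real.sin := by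
      refine LipschitzWith.of_dist_le_mul fun x y => ?_
      have := convex_univ.norm_image_sub_le_of_norm_hasDerivWithin_le
        (fun x _ => (Real.hasDerivAt_sin x).hasDerivWithinAt) (fun x _ => Real.abs_cos_le_one x)
        (Set.mem_univ y) (Set.mem_univ x)
      simpa [dist_eq_norm] using this
    have h1 : ∀ t, HasDerivAt (fun t => (Φ (init κ) t).1) (Real.sin (Φ (init κ) t).1) t :=
      fun t => (hΦ (init κ) t).fst
    have h2 : ∀ t, HasDerivAt (fun t => 2 * Real.arctan (κ * Real.exp t))
        (Real.sin (2 * Real.arctan (κ * Real.exp t))) t := fun t => by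
      refine ((((Real.hasDerivAt_exp t).const_mul κ).arctan).const_mul 2).congr_deriv ?_
      rw [sin_two_mul_arctan]; ring
    exact congrFun (eq_of_trajectories hsin h1 h2 (t₀ := 0) (by
      simp only [hΦ0, init, hpr κ hκ, Real.exp_zero, mul_one])) τ
  refine ⟨B, hB0, r, hr, κ₀, hκ₀, fun κ τ => (Φ (init κ) τ).2.1, fun κ τ => (Φ (init κ) τ).2.2,
    by simp only [Function.uncurry_def]; fun_prop, by simp only [Function.uncurry_def]; fun_prop,
    fun κ hκ => ?_⟩
  have htraj : ∀ τ, (2 * Real.arctan (κ * Real.exp τ), (Φ (init κ) τ).2.1, (Φ (init κ) τ).2.2) =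
      Φ (init κ) τ := fun τ => by rw [← hψ κ hκ τ]
  have hderiv : ∀ τ, HasDerivAt (fun t => (2 * Real.arctan (κ * Real.exp t), (Φ (init κ) t).2.1,
      (Φ (init κ) t).2.2)) (clippedField q lam a B
        (2 * Real.arctan (κ * Real.exp τ), (Φ (init κ) τ).2.1, (Φ (init κ) τ).2.2)) τ := by
    intro τ
    rw [funext htraj, htraj τ]
    exact hΦ _ τ
  refine ⟨hderiv, fun τ hτ => ?_, fun τ hτ => ?_, fun hκ0 => ?_⟩
  · have := (hloc κ hκ).2.1 τ (by linarith)
    simp only [hlocal κ hκ τ hτ]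
    exact ⟨this.1, this.2.1, this.2.2.2⟩
  · rcases le_total τ 0 with h0 | h0
    · simp only [hlocal κ hκ τ h0]
      exact ⟨hpB κ hκ τ (by linarith), hE κ hκ τ (by linarith)⟩
    · set E : ℝ → ℝ := fun t => clipEnergy B (Φ (init κ) t).2.2 -
        lam / 2 * Real.sin (Φ (init κ) t).2.1 ^ 2 with hEdef
      have hEd : ∀ t, HasDerivAt E _ t := fun t => hasDerivAt_clippedEnergy ha hB0.le (hderiv t)
      have hanti : AntitoneOn E (Icc 0 τ) := by
        refine antitoneOn_of_deriv_nonpos (convex_Icc _ _)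
          (fun t _ => (hEd t).continuousAt.continuousWithinAt)
          (fun t _ => (hEd t).differentiableAt.differentiableWithinAt) fun t ht => ?_
        rw [interior_Icc] at ht
        rw [(hEd t).deriv]
        have hcos : 0 ≤ Real.cos (2 * Real.arctan (κ * Real.exp t)) := by
          refine cos_two_mul_arctan_nonneg (mul_nonneg hκ.1 (Real.exp_pos t).le) (le_trans ?_ hτ)
          exact mul_le_mul_of_nonneg_left (Real.exp_le_exp.2 ht.2.le) hκ.1
        have : 0 ≤ q * Real.cos (2 * Real.arctan (κ * Real.exp t)) *
          clip B (Φ (init κ) t).2.2 ^ 2 := by positivity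
        linarith
      have hE0 : E 0 < 0 := by
        have h1 := hE κ hκ 0 (by norm_num)
        have h2 := clip_eq_self (hpB κ hκ 0 (by norm_num)).le
        simp only [hEdef, hlocal κ hκ 0 le_rfl, clipEnergy, h2]
        linarith
      have hEτ : E τ < 0 := (hanti ⟨le_rfl, h0⟩ ⟨h0, le_rfl⟩ h0).trans_lt hE0
      have hsq := sq_clip_le hB0.le (Φ (init κ) τ).2.2
      have hsin := Real.sin_sq_le_one (Φ (init κ) τ).2.1
      have hclip : |clip B (Φ (init κ) τ).2.2| < B := hlamB _ (by
        simp only [hEdef] at hEτ; nlinarith)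
      have heq := eq_of_abs_clip_lt hclip
      refine ⟨by rwa [heq] at hclip, ?_⟩
      simp only [hEdef, clipEnergy, heq] at hEτ
      linarith
  · obtain ⟨P, hP, hP0, hPf⟩ := (hloc κ hκ).2.2.2.2 hκ0
    refine ⟨P, hP, hP0, fun τ hτ => ?_⟩
    simp only [hlocal κ hκ τ hτ]
    exact hPf τ (by linarith)

end ReducedFamily

/-! ### Oscillation about the equator in the blown-up system -/

section Oscillation

open Set Filter Topology

/-- A function `θ` with the derivative of the polar angle of `(X, Y)` and a correct initial value is
the polar angle, up to multiples of `π`. -/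
theorem mul_sin_eq_mul_cos_of_angle {X Y X' Y' θ : ℝ → ℝ} (hX : ∀ t, HasDerivAt X (X' t) t)
    (hY : ∀ t, HasDerivAt Y (Y' t) t) (h0 : ∀ t, X t ^ 2 + Y t ^ 2 ≠ 0)
    (hθ : ∀ t, HasDerivAt θ ((X t * Y' t - Y t * X' t) / (X t ^ 2 + Y t ^ 2)) t)
    (hi : X 0 * Real.sin (θ 0) = Y 0 * Real.cos (θ 0)) (t : ℝ) :
    X t * Real.sin (θ t) = Y t * Real.cos (θ t) := by
  set g : ℝ → ℝ := fun t => (X t * Real.sin (θ t) - Y t * Real.cos (θ t)) ^ 2 /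
    (X t ^ 2 + Y t ^ 2) with hg
  have hgd : ∀ t, HasDerivAt g 0 t := fun t => by
    have h1 := ((hX t).mul (hθ t).sin).sub ((hY t).mul (hθ t).cos)
    have h2 := ((hX t).pow 2).add ((hY t).pow 2)
    refine ((h1.pow 2).div h2 (h0 t)).congr_deriv ?_
    have := h0 t
    simp only [Pi.mul_apply, Pi.sub_apply, Pi.add_apply, Pi.pow_apply]
    rw [div_eq_zero_iff]
    left
    generalize Real.sin (θ t) = s at *
    generalize Real.cos (θ t) = c at *
    field_simp
    ring
  have hconst := is_const_of_deriv_eq_zero (fun t => (hgd t).differentiableAt)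
    (fun t => (hgd t).deriv) t 0
  have hg0 : g 0 = 0 := by simp only [hg]; rw [hi]; simp
  rw [hg0] at hconst
  simp only [hg] at hconst
  rw [div_eq_zero_iff, or_iff_left (h0 t)] at hconst
  have := pow_eq_zero_iff (two_ne_zero) |>.1 hconst
  linarith

/-- The algebraic estimate behind the Lyapunov function `E - η p sin 2f`. -/
theorem lyapunov_rate {q lam μ ν η w P S C : ℝ} (hlam : 0 < lam) (hν : 0 < ν)
    (hη : 0 < η) (hw1 : ν⁻¹ ≤ w) (hw2 : w ≤ μ⁻¹) (hC : -1 ≤ C)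
    (hηκ : η * (q ^ 2 * ν / lam + 2 * μ⁻¹) = q / 2) :
    -(q * P ^ 2) - η * ((lam / 2 * S * w - q * P) * S + P * (C * (2 * (P * w)))) ≤
      -(q / 2 * P ^ 2 + η * lam / (4 * ν) * S ^ 2) := by
  have hν' : 0 < ν⁻¹ := inv_pos.2 hν
  have b1 : lam / 2 * ν⁻¹ * S ^ 2 ≤ lam / 2 * w * S ^ 2 := by gcongr
  have b2 : -(2 * μ⁻¹ * P ^ 2) ≤ 2 * (C * w) * P ^ 2 := by
    have h1 : -μ⁻¹ ≤ C * w := by nlinarith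
    have := mul_le_mul_of_nonneg_right h1 (sq_nonneg P)
    linarith
  have b3 : q * P * S ≤ lam / 4 * ν⁻¹ * S ^ 2 + q ^ 2 * ν / lam * P ^ 2 := by
    have e : lam / 4 * ν⁻¹ * S ^ 2 + q ^ 2 * ν / lam * P ^ 2 - q * P * S =
        ν / (4 * lam) * (lam * ν⁻¹ * S - 2 * q * P) ^ 2 := by field_simp; ring
    have h2 : 0 ≤ ν / (4 * lam) * (lam * ν⁻¹ * S - 2 * q * P) ^ 2 := by positivity
    linarith
  have b4 : lam / 4 * ν⁻¹ * S ^ 2 - (q ^ 2 * ν / lam + 2 * μ⁻¹) * P ^ 2 ≤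
      (lam / 2 * S * w - q * P) * S + P * (C * (2 * (P * w))) := by linarith
  have b5 := mul_le_mul_of_nonneg_left b4 hη.le
  have b6 : η * (lam / 4 * ν⁻¹ * S ^ 2 - (q ^ 2 * ν / lam + 2 * μ⁻¹) * P ^ 2) =
      η * lam / (4 * ν) * S ^ 2 - q / 2 * P ^ 2 := by
    rw [← hηκ, mul_sub]; field_simp
  linarith

/-- In the blown-up system at the pole the energy descends to its minimum `-λ/2`. The strict
Lyapunov function `E - η p sin 2f` excludes any other behaviour. -/
theorem exists_energy_lt {q lam a : ℝ} (ha : a ≠ 0) (hq : 0 < q) (hlam : 0 < lam) {f p : ℝ → ℝ}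
    (hf : ∀ t, HasDerivAt f (p t / lengthFactor a (f t)) t)
    (hp : ∀ t, HasDerivAt p (lam / 2 * Real.sin (2 * f t) / lengthFactor a (f t) - q * p t) t)
    (hE : p 0 ^ 2 / 2 - lam / 2 * Real.sin (f 0) ^ 2 < 0) {ε : ℝ} (hε : 0 < ε) :
    ∃ T ≥ 0, ∀ t ≥ T, p t ^ 2 + lam * Real.cos (f t) ^ 2 < ε := by
  set E : ℝ → ℝ := fun t => p t ^ 2 / 2 - lam / 2 * Real.sin (f t) ^ 2 with hEdef
  have hM := fun t => lengthFactor_pos ha (f t)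
  have hEd : ∀ t, HasDerivAt E (-(q * p t ^ 2)) t := fun t => by
    refine ((((hp t).pow 2).div_const 2).sub (((hf t).sin.pow 2).const_mul (lam / 2))).congr_deriv ?_
    have := (hM t).ne'
    rw [Real.sin_two_mul]
    field_simp
    ring
  have hanti : Antitone E := antitone_of_deriv_nonpos (fun t => (hEd t).differentiableAt)
    fun t => by rw [(hEd t).deriv]; have := mul_nonneg hq.le (sq_nonneg (p t)); linarith
  have hEeq : ∀ t, p t ^ 2 + lam * Real.cos (f t) ^ 2 = 2 * E t + lam := fun t => by
    simp only [hEdef]; rw [Real.cos_sq']; ring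
  by_contra! hcon
  have hlow : ∀ t ≥ 0, ε ≤ p t ^ 2 + lam * Real.cos (f t) ^ 2 := fun t ht => by
    obtain ⟨s, hs, hs'⟩ := hcon t ht
    have := hanti hs
    rw [hEeq] at hs' ⊢
    linarith
  -- Constants of the Lyapunov estimate.
  set μ := Real.sqrt (min 1 (a ^ 2)) with hμ
  have hμ0 : 0 < μ := Real.sqrt_pos.2 (by positivity)
  have hMlow : ∀ t, μ ≤ lengthFactor a (f t) := fun t =>
    Real.sqrt_le_sqrt (min_le_metricFactor a (f t))
  set ν := Real.sqrt (1 + a ^ 2) with hν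
  have hν0 : 0 < ν := Real.sqrt_pos.2 (by positivity)
  have hMup : ∀ t, lengthFactor a (f t) ≤ ν := fun t => Real.sqrt_le_sqrt (metricFactor_le a (f t))
  set κ := q ^ 2 * ν / lam + 2 * μ⁻¹ with hκ
  have hκ0 : 0 < κ := by positivity
  set η := q / (2 * κ) with hη
  have hη0 : 0 < η := by positivity
  have hηκ : η * κ = q / 2 := by rw [hη]; field_simp
  set V : ℝ → ℝ := fun t => E t - η * (p t * Real.sin (2 * f t)) with hV
  set s₀ := -(2 * E 0) / lam with hs₀
  have hE0 : E 0 < 0 := hE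
  have hs₀0 : 0 < s₀ := div_pos (by linarith) hlam
  set c := min (q / 2) (η * lam / (4 * ν)) * (min 1 (4 * s₀ / lam) * ε) with hc
  have hc0 : 0 < c := by positivity
  have hVd : ∀ t, HasDerivAt V (-(q * p t ^ 2) - η * ((lam / 2 * Real.sin (2 * f t) /
      lengthFactor a (f t) - q * p t) * Real.sin (2 * f t) +
      p t * (Real.cos (2 * f t) * (2 * (p t / lengthFactor a (f t)))))) t := fun t =>
    (hEd t).sub (((hp t).mul ((hf t).const_mul 2).sin).const_mul η)
  have hVle : ∀ t ≥ 0, -(q * p t ^ 2) - η * ((lam / 2 * Real.sin (2 * f t) /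
      lengthFactor a (f t) - q * p t) * Real.sin (2 * f t) +
      p t * (Real.cos (2 * f t) * (2 * (p t / lengthFactor a (f t))))) ≤ -c := by
    intro t ht
    have hrate := lyapunov_rate (P := p t) (S := Real.sin (2 * f t)) hlam hν0 hη0
      (inv_anti₀ (hM t) (hMup t)) (inv_anti₀ hμ0 (hMlow t)) (Real.neg_one_le_cos (2 * f t)) hηκ
    simp only [div_eq_mul_inv _ (lengthFactor a (f t))]
    refine hrate.trans (neg_le_neg ?_)
    set S := Real.sin (2 * f t) with hS
    have hsin : s₀ ≤ Real.sin (f t) ^ 2 := by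
      have h1 := hanti ht
      rw [hs₀, div_le_iff₀ hlam]
      have h2 : E t = p t ^ 2 / 2 - lam / 2 * Real.sin (f t) ^ 2 := rfl
      linarith [sq_nonneg (p t)]
    have hS2 : 4 * s₀ * Real.cos (f t) ^ 2 ≤ S ^ 2 := by
      have : S ^ 2 = 4 * Real.sin (f t) ^ 2 * Real.cos (f t) ^ 2 := by
        rw [hS, Real.sin_two_mul]; ring
      rw [this]; gcongr
    have hlast : min 1 (4 * s₀ / lam) * ε ≤ p t ^ 2 + S ^ 2 := by
      have h1 := min_le_left 1 (4 * s₀ / lam)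
      have h2 := min_le_right 1 (4 * s₀ / lam)
      have h3 : 0 ≤ min 1 (4 * s₀ / lam) := by positivity
      calc min 1 (4 * s₀ / lam) * ε ≤ min 1 (4 * s₀ / lam) *
            (p t ^ 2 + lam * Real.cos (f t) ^ 2) := by gcongr; exact hlow t ht
        _ = min 1 (4 * s₀ / lam) * p t ^ 2 + min 1 (4 * s₀ / lam) *
            (lam * Real.cos (f t) ^ 2) := by ring
        _ ≤ 1 * p t ^ 2 + 4 * s₀ / lam * (lam * Real.cos (f t) ^ 2) := by gcongr
        _ = p t ^ 2 + 4 * s₀ * Real.cos (f t) ^ 2 := by field_simp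
        _ ≤ _ := by linarith
    have h1 := min_le_left (q / 2) (η * lam / (4 * ν))
    have h2 := min_le_right (q / 2) (η * lam / (4 * ν))
    calc c ≤ min (q / 2) (η * lam / (4 * ν)) * (p t ^ 2 + S ^ 2) := by
          rw [hc]; gcongr
      _ = min (q / 2) (η * lam / (4 * ν)) * p t ^ 2 +
          min (q / 2) (η * lam / (4 * ν)) * S ^ 2 := by ring
      _ ≤ _ := by gcongr
  have hdecay : ∀ t ≥ 0, V t ≤ V 0 - c * t := fun t ht => by
    have := image_le_of_deriv_right_le_deriv_boundary (f := V) (a := 0) (b := t)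
      (B := fun t => V 0 - c * t) (B' := fun _ => -c)
      (fun s _ => (hVd s).continuousAt.continuousWithinAt)
      (fun s _ => (hVd s).hasDerivWithinAt) (by simp)
      (by fun_prop) (fun s _ => ?_) (fun s hs => hVle s hs.1) ⟨ht, le_rfl⟩
    · exact this
    · exact (((hasDerivAt_id s).const_mul c).const_sub (V 0)).hasDerivWithinAt.congr_deriv (by simp)
  have hpb : ∀ t ≥ 0, |p t| ≤ 1 + lam := fun t ht => by
    have h1 : E t ≤ E 0 := hanti ht
    have h2 : E t = p t ^ 2 / 2 - lam / 2 * Real.sin (f t) ^ 2 := rfl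
    have h3 := Real.sin_sq_le_one (f t)
    refine abs_le_of_sq_le_sq ?_ (by positivity)
    nlinarith
  have hVlow : ∀ t ≥ 0, -(lam / 2) - η * (1 + lam) ≤ V t := fun t ht => by
    have h1 : E t = p t ^ 2 / 2 - lam / 2 * Real.sin (f t) ^ 2 := rfl
    have h2 := Real.sin_sq_le_one (f t)
    have h3 : p t * Real.sin (2 * f t) ≤ 1 + lam := by
      refine (le_abs_self _).trans ?_
      rw [abs_mul]
      exact (mul_le_of_le_one_right (abs_nonneg _) (Real.abs_sin_le_one _)).trans (hpb t ht)
    have h4 := mul_le_mul_of_nonneg_left h3 hη0.le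
    have h5 : V t = E t - η * (p t * Real.sin (2 * f t)) := rfl
    nlinarith [sq_nonneg (p t)]
  set t₁ := (|V 0| + lam / 2 + η * (1 + lam) + 1) / c with ht₁
  have ht₁0 : 0 ≤ t₁ := by positivity
  have h1 := hdecay t₁ ht₁0
  have h2 := hVlow t₁ ht₁0
  have h3 : c * t₁ = |V 0| + lam / 2 + η * (1 + lam) + 1 := by rw [ht₁]; field_simp
  have := le_abs_self (V 0)
  linarith

/-- Near the rest point `(π/2, 0)` of the blown-up system the polar angle of `(π/2 - f, -p)`
decreases at a definite rate. This is where the smallness of `a` enters: the linearization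
`x'' + q x' + (λ/a²) x = 0` has non-real eigenvalues. -/
theorem exists_rotation_rate {q lam a : ℝ} (ha : a ≠ 0) (hlam : 0 < lam)
    (hsmall : q ^ 2 * a ^ 2 < 4 * lam) :
    ∃ δ > 0, ∃ ξ > 0, ∀ X Y : ℝ, |X| < ξ →
      δ * (X ^ 2 + Y ^ 2) ≤ lam / 2 * (X * Real.sin (2 * X)) / lengthFactor a (Real.pi / 2 - X) +
        q * (X * Y) + Y ^ 2 / lengthFactor a (Real.pi / 2 - X) := by
  have ha2 : 0 < a ^ 2 := by positivity
  obtain ⟨s, hs1, hs2⟩ : ∃ s, q ^ 2 / (4 * lam) < s ∧ s < 1 / a ^ 2 := exists_between (by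
    rw [div_lt_div_iff₀ (by positivity) ha2]; linarith)
  have hs0 : 0 < s := lt_of_le_of_lt (by positivity) hs1
  set q₀ := Real.sqrt s with hq₀
  have hq₀0 : 0 < q₀ := Real.sqrt_pos.2 hs0
  have hq₀s : q₀ ^ 2 = s := Real.sq_sqrt hs0.le
  have hq₀a : q₀ < |a|⁻¹ := by
    rw [hq₀, ← Real.sqrt_sq (inv_nonneg.2 (abs_nonneg a))]
    refine Real.sqrt_lt_sqrt hs0.le ?_
    rw [inv_pow, sq_abs, ← one_div]; exact hs2
  have hMc : Continuous fun X => lengthFactor a (Real.pi / 2 - X) :=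
    (contDiff_lengthFactor ha).continuous.comp (by fun_prop)
  have hMi : Continuous fun X => (lengthFactor a (Real.pi / 2 - X))⁻¹ :=
    hMc.inv₀ fun X => (lengthFactor_pos ha _).ne'
  have hsc : Continuous fun X => Real.sinc (2 * X) * (lengthFactor a (Real.pi / 2 - X))⁻¹ :=
    (Real.continuous_sinc.comp (by fun_prop)).mul hMi
  have e1 : ∀ᶠ X in 𝓝 (0 : ℝ), q₀ < (lengthFactor a (Real.pi / 2 - X))⁻¹ :=
    hMi.continuousAt.eventually_const_lt (by
      beta_reduce; rw [sub_zero, lengthFactor_pi_div_two]; exact hq₀a)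
  have e2 : ∀ᶠ X in 𝓝 (0 : ℝ), q₀ < Real.sinc (2 * X) * (lengthFactor a (Real.pi / 2 - X))⁻¹ :=
    hsc.continuousAt.eventually_const_lt (by
      beta_reduce; rw [sub_zero, lengthFactor_pi_div_two, mul_zero, Real.sinc_zero, one_mul]; exact hq₀a)
  obtain ⟨ξ, hξ, hball⟩ := Metric.eventually_nhds_iff.1 (e1.and e2)
  have hdet : 0 < lam * q₀ * q₀ - q ^ 2 / 4 := by
    rw [div_lt_iff₀ (by positivity)] at hs1
    rw [mul_assoc, ← sq, hq₀s]; linarith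
  -- `δ` is the determinant of the quadratic form divided by its trace.
  set δ := (lam * q₀ * q₀ - q ^ 2 / 4) / (lam * q₀ + q₀) with hδ
  have hδ0 : 0 < δ := by positivity
  have hδeq : δ * (lam * q₀ + q₀) = lam * q₀ * q₀ - q ^ 2 / 4 := by rw [hδ]; field_simp
  refine ⟨δ, hδ0, ξ, hξ, fun X Y hX => ?_⟩
  obtain ⟨h1, h2⟩ := hball (show dist X 0 < ξ by rwa [Real.dist_eq, sub_zero])
  set w := (lengthFactor a (Real.pi / 2 - X))⁻¹ with hw
  have hsinc : X * Real.sin (2 * X) = 2 * X ^ 2 * Real.sinc (2 * X) := by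
    rcases eq_or_ne X 0 with rfl | h0
    · simp
    · rw [Real.sinc_of_ne_zero (by simpa using h0)]; field_simp
  have hA : lam * q₀ * X ^ 2 ≤ lam / 2 * (X * Real.sin (2 * X)) / lengthFactor a (Real.pi / 2 - X) := by
    rw [div_eq_mul_inv, ← hw, hsinc]
    have : lam * q₀ * X ^ 2 ≤ lam * (Real.sinc (2 * X) * w) * X ^ 2 := by gcongr
    linarith
  have hB : q₀ * Y ^ 2 ≤ Y ^ 2 / lengthFactor a (Real.pi / 2 - X) := by
    rw [div_eq_mul_inv, ← hw, mul_comm]; gcongr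
  have hpos : δ < lam * q₀ := by
    rw [hδ, div_lt_iff₀ (by positivity)]
    nlinarith [sq_nonneg q, sq_nonneg (lam * q₀), mul_pos hlam hq₀0]
  -- Completing the square in the quadratic form.
  have hform : 0 ≤ (lam * q₀ - δ) * X ^ 2 + q * (X * Y) + (q₀ - δ) * Y ^ 2 := by
    have h3 : 0 < lam * q₀ - δ := by linarith
    have h4 : (lam * q₀ - δ) * ((lam * q₀ - δ) * X ^ 2 + q * (X * Y) + (q₀ - δ) * Y ^ 2) =
        ((lam * q₀ - δ) * X + q / 2 * Y) ^ 2 + δ ^ 2 * Y ^ 2 := by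
      linear_combination -Y ^ 2 * hδeq
    have h5 : 0 ≤ (lam * q₀ - δ) * ((lam * q₀ - δ) * X ^ 2 + q * (X * Y) + (q₀ - δ) * Y ^ 2) := by
      rw [h4]; positivity
    exact nonneg_of_mul_nonneg_right h5 h3
  linarith

end Oscillation

/-! ### Solutions symmetric with respect to the equator -/

section Crossings

open Set Filter Topology

/-- If the angle `θ κ` crosses the levels `π/2 + π ℤ` only downwards before the time `-log κ`, and
`θ 0` tends to `-∞`, then `θ κ (-log κ)` meets these levels for infinitely many `κ`. -/
theorem infinite_cos_angle_eq_zero {κ₀ : ℝ} (hκ₀ : 0 < κ₀) {θ : ℝ → ℝ → ℝ} {θ' : ℝ → ℝ → ℝ}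
    (hθc : Continuous fun z : Icc 0 κ₀ × ℝ => θ z.1 z.2)
    (hθ : ∀ κ ∈ Icc 0 κ₀, ∀ τ, HasDerivAt (θ κ) (θ' κ τ) τ)
    (hneg : ∀ κ ∈ Icc 0 κ₀, ∀ τ, κ * Real.exp τ ≤ 1 → Real.cos (θ κ τ) = 0 → θ' κ τ < 0)
    (hlim : Tendsto (θ 0) atTop atBot) :
    {κ ∈ Ioc 0 κ₀ | Real.cos (θ κ (-Real.log κ)) = 0}.Infinite := by
  set L : ℕ → ℝ := fun n => -(Real.pi / 2) - n * Real.pi with hL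
  have hcosL : ∀ n, Real.cos (L n) = 0 := fun n => by
    simp only [hL]
    rw [Real.cos_sub_nat_mul_pi, Real.cos_neg, Real.cos_pi_div_two, mul_zero]
  have hlow : ∀ n, ∃ κ ∈ Ioc 0 κ₀, θ κ (-Real.log κ) ≤ L n := by
    intro n
    obtain ⟨T, hT⟩ := ((hlim.eventually_lt_atBot (L n)).and (eventually_ge_atTop 0)).exists
    have hev : ∀ᶠ κ in 𝓝[>] (0 : ℝ), ∀ h : κ ∈ Icc 0 κ₀, θ κ T < L n := by
      have h1 : Continuous fun z : Icc 0 κ₀ => θ z T :=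
        hθc.comp (f := fun z : Icc 0 κ₀ => (z, T)) (by fun_prop)
      have h2 : ∀ᶠ z : Icc 0 κ₀ in 𝓝 ⟨0, left_mem_Icc.2 hκ₀.le⟩, θ z T < L n :=
      h1.continuousAt.eventually_lt_const hT.1
      rw [nhds_subtype_eq_comap, eventually_comap] at h2
      filter_upwards [nhdsWithin_le_nhds h2] with κ hκ h using hκ ⟨κ, h⟩ rfl
    obtain ⟨κ, ⟨hκ1, hκ2⟩, hκ3⟩ := (hev.and ((Ioo_mem_nhdsGT hκ₀ : Ioo 0 κ₀ ∈ _))|>.and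
      (Ioo_mem_nhdsGT (Real.exp_pos (-T)) : Ioo 0 (Real.exp (-T)) ∈ _)).exists
    have hκI : κ ∈ Icc 0 κ₀ := ⟨hκ2.1.le, hκ2.2.le⟩
    have hTle : T ≤ -Real.log κ := by
      have := Real.log_le_log hκ3.1 hκ3.2.le
      rw [Real.log_exp] at this
      linarith
    refine ⟨κ, ⟨hκ2.1, hκ2.2.le⟩, ?_⟩
    refine image_le_of_deriv_right_lt_deriv_boundary' (f := θ κ) (a := T) (b := -Real.log κ)
      (B := fun _ => L n) (B' := fun _ => 0)
      (fun s _ => (hθ κ hκI s).continuousAt.continuousWithinAt)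
      (fun s _ => (hθ κ hκI s).hasDerivWithinAt) (hκ1 hκI).le continuousOn_const
      (fun s _ => hasDerivWithinAt_const _ _ _) (fun s hs he => ?_) ⟨hTle, le_rfl⟩
    refine hneg κ hκI s ?_ (he ▸ hcosL n)
    calc κ * Real.exp s ≤ κ * Real.exp (-Real.log κ) := by
          have := hs.2.le; have := hκ2.1.le; gcongr
      _ = 1 := by rw [Real.exp_neg, Real.exp_log hκ2.1, mul_inv_cancel₀ hκ2.1.ne']
  have hΘc : ContinuousOn (fun κ => θ κ (-Real.log κ)) (Ioc 0 κ₀) := by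
    rw [continuousOn_iff_continuous_domRestrict]
    refine hθc.comp (f := fun z : Ioc 0 κ₀ =>
      ((⟨z, z.2.1.le, z.2.2⟩ : Icc 0 κ₀), -Real.log z)) ?_
    refine Continuous.prodMk (by fun_prop) (Continuous.neg ?_)
    exact Continuous.log continuous_subtype_val fun z => z.2.1.ne'
  obtain ⟨N, hN⟩ : ∃ N : ℕ, ∀ n, L (N + n) ≤ θ κ₀ (-Real.log κ₀) := by
    obtain ⟨N, hN⟩ := exists_nat_ge (|θ κ₀ (-Real.log κ₀)|)
    refine ⟨N, fun n => ?_⟩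
    have h1 := neg_abs_le (θ κ₀ (-Real.log κ₀))
    have h2 : (N : ℝ) * 1 ≤ N * Real.pi := by gcongr; linarith [Real.pi_gt_three]
    have h3 : 0 ≤ n * Real.pi := by positivity
    simp only [hL]
    push_cast
    linarith [Real.pi_pos]
  have hex : ∀ n, ∃ κ ∈ Ioc 0 κ₀, θ κ (-Real.log κ) = L (N + n) := by
    intro n
    obtain ⟨κ, hκ, hκL⟩ := hlow (N + n)
    have hsub : Icc κ κ₀ ⊆ Ioc 0 κ₀ := fun x hx => ⟨hκ.1.trans_le hx.1, hx.2⟩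
    obtain ⟨x, hx, hxe⟩ := intermediate_value_Icc hκ.2 (hΘc.mono hsub) ⟨hκL, hN n⟩
    exact ⟨x, hsub hx, hxe⟩
  choose g hg hgL using hex
  refine infinite_of_injective_forall_mem (f := g) (fun m n hmn => ?_) fun n => ⟨hg n, ?_⟩
  · have h1 := hgL m
    rw [hmn, hgL n] at h1
    simp only [hL] at h1
    have h2 : ((N + n : ℕ) : ℝ) * Real.pi = ((N + m : ℕ) : ℝ) * Real.pi := by linarith
    have h3 := mul_right_cancel₀ Real.pi_ne_zero h2
    have : N + n = N + m := by exact_mod_cast h3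
    omega
  · rw [hgL n]; exact hcosL _

theorem cos_eq_zero_iff_of_mul_sin_eq {X Y θ : ℝ} (h0 : X ^ 2 + Y ^ 2 ≠ 0)
    (h : X * Real.sin θ = Y * Real.cos θ) : Real.cos θ = 0 ↔ X = 0 := by
  have hsc := Real.sin_sq_add_cos_sq θ
  constructor
  · intro hc
    rw [hc, mul_zero] at h
    rcases mul_eq_zero.1 h with h | h
    · exact h
    · rw [h, hc] at hsc; norm_num at hsc
  · rintro rfl
    have hY : Y ≠ 0 := by rintro rfl; simp at h0
    rw [zero_mul] at h
    exact (mul_eq_zero.1 h.symm).resolve_left hY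

/-- A solution of the blown-up system at the pole that starts with negative energy rotates about
the rest point `(π/2, 0)` at a definite rate from some time on. -/
theorem exists_eventual_rotation {q lam a : ℝ} (ha : a ≠ 0) (hq : 0 < q) (hlam : 0 < lam)
    (hsmall : q ^ 2 * a ^ 2 < 4 * lam) {f p : ℝ → ℝ}
    (hf : ∀ t, HasDerivAt f (p t / lengthFactor a (f t)) t)
    (hp : ∀ t, HasDerivAt p (lam / 2 * Real.sin (2 * f t) / lengthFactor a (f t) - q * p t) t)
    (hE : ∀ t, p t ^ 2 / 2 - lam / 2 * Real.sin (f t) ^ 2 < 0)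
    (hf0 : 0 < f 0) (hfπ : f 0 < Real.pi) :
    ∃ δ > 0, ∃ T ≥ 0, ∀ t ≥ T,
      -(Real.pi / 2 - f t) * (lam / 2 * Real.sin (2 * f t) / lengthFactor a (f t) - q * p t) -
        p t * (p t / lengthFactor a (f t)) ≤ -(δ * ((Real.pi / 2 - f t) ^ 2 + p t ^ 2)) := by
  obtain ⟨δ, hδ, ξ, hξ, hrot⟩ := exists_rotation_rate ha hlam hsmall
  have hsin : ∀ t, Real.sin (f t) ≠ 0 := fun t h => by
    have := hE t
    rw [h] at this
    nlinarith [sq_nonneg (p t)]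
  have hcont : Continuous f := continuous_iff_continuousAt.2 fun t => (hf t).continuousAt
  have hord := (isPreconnected_range hcont).ordConnected
  have hrange : ∀ t, 0 < f t ∧ f t < Real.pi := fun t => by
    constructor
    · by_contra! h
      obtain ⟨s, hs⟩ := hord.out (mem_range_self t) (mem_range_self 0) ⟨h, hf0.le⟩
      exact hsin s (by rw [hs, Real.sin_zero])
    · by_contra! h
      obtain ⟨s, hs⟩ := hord.out (mem_range_self 0) (mem_range_self t) ⟨hfπ.le, h⟩
      exact hsin s (by rw [hs, Real.sin_pi])
  obtain ⟨T, hT0, hT⟩ := exists_energy_lt ha hq hlam hf hp (hE 0)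
    (ε := lam * (2 / Real.pi * ξ) ^ 2) (by positivity)
  refine ⟨δ, hδ, T, hT0, fun t ht => ?_⟩
  have hX : |Real.pi / 2 - f t| < ξ := by
    have h1 := hT t ht
    have h2 : lam * Real.cos (f t) ^ 2 < lam * (2 / Real.pi * ξ) ^ 2 := by
      linarith [sq_nonneg (p t)]
    have h3 := lt_of_mul_lt_mul_left h2 hlam.le
    have h4 : 2 / Real.pi * |Real.pi / 2 - f t| ≤ |Real.cos (f t)| := by
      have h6 := Real.mul_abs_le_abs_sin (x := Real.pi / 2 - f t)
        (abs_le.2 ⟨by linarith [(hrange t).2], by linarith [(hrange t).1]⟩)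
      rwa [Real.sin_pi_div_two_sub] at h6
    have h5 : |Real.cos (f t)| < 2 / Real.pi * ξ := abs_lt_of_sq_lt_sq h3 (by positivity)
    exact lt_of_mul_lt_mul_left (h4.trans_lt h5) (by positivity)
  have := hrot (Real.pi / 2 - f t) (-p t) hX
  rw [show Real.pi / 2 - (Real.pi / 2 - f t) = f t by ring,
    show 2 * (Real.pi / 2 - f t) = Real.pi - 2 * f t by ring, Real.sin_pi_sub] at this
  rw [neg_sq] at this
  have e : -(Real.pi / 2 - f t) * (lam / 2 * Real.sin (2 * f t) / lengthFactor a (f t) - q * p t) -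
        p t * (p t / lengthFactor a (f t)) =
      -(lam / 2 * ((Real.pi / 2 - f t) * Real.sin (2 * f t)) / lengthFactor a (f t) +
        q * ((Real.pi / 2 - f t) * -p t) + p t ^ 2 / lengthFactor a (f t)) := by ring
  rw [e]
  exact neg_le_neg this

/-- Infinitely many members of the family of solutions pass through the symmetric value `π/2` at
the equator. -/
theorem infinite_symmetric_trajectories {q lam a B : ℝ} (ha : a ≠ 0) (hB : 0 ≤ B) (hq : 0 < q)
    (hlam : 0 < lam) (hsmall : q ^ 2 * a ^ 2 < 4 * lam) {κ₀ : ℝ} (hκ₀ : 0 < κ₀) {f p : ℝ → ℝ → ℝ}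
    (hfc : Continuous (Function.uncurry f)) (hpc : Continuous (Function.uncurry p))
    (hfp : ∀ κ ∈ Icc 0 κ₀, ∀ τ,
      HasDerivAt (fun t => (2 * Real.arctan (κ * Real.exp t), f κ t, p κ t))
        (clippedField q lam a B (2 * Real.arctan (κ * Real.exp τ), f κ τ, p κ τ)) τ)
    (hf0 : ∀ κ ∈ Icc 0 κ₀, 0 < f κ 0 ∧ f κ 0 < Real.pi / 2)
    (hE : ∀ κ ∈ Icc 0 κ₀, ∀ τ, κ * Real.exp τ ≤ 1 → |p κ τ| < B ∧
      p κ τ ^ 2 / 2 - lam / 2 * Real.sin (f κ τ) ^ 2 < 0) :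
    {κ ∈ Ioc 0 κ₀ | f κ (-Real.log κ) = Real.pi / 2}.Infinite := by
  obtain ⟨C, K, hC, hK⟩ := exists_bound_clippedField q lam ha hB
  set F : ℝ → ℝ → ℝ × ℝ × ℝ := fun κ τ => (2 * Real.arctan (κ * Real.exp τ), f κ τ, p κ τ) with hF
  set W : ℝ → ℝ → ℝ × ℝ × ℝ := fun κ τ => clippedField q lam a B (F κ τ) with hW
  have hfd : ∀ κ ∈ Icc 0 κ₀, ∀ τ, HasDerivAt (f κ) (W κ τ).2.1 τ := fun κ hκ τ =>
    (hfp κ hκ τ).snd.fst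
  have hpd : ∀ κ ∈ Icc 0 κ₀, ∀ τ, HasDerivAt (p κ) (W κ τ).2.2 τ := fun κ hκ τ =>
    (hfp κ hκ τ).snd.snd
  -- The trajectory does not meet the rest point.
  have hne : ∀ κ ∈ Icc 0 κ₀, ∀ τ, (Real.pi / 2 - f κ τ) ^ 2 + (-p κ τ) ^ 2 ≠ 0 := by
    intro κ hκ τ h
    have h1 : f κ τ = Real.pi / 2 := by nlinarith [sq_nonneg (-p κ τ), sq_nonneg (Real.pi / 2 - f κ τ)]
    have h2 : p κ τ = 0 := by nlinarith [sq_nonneg (-p κ τ), sq_nonneg (Real.pi / 2 - f κ τ)]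
    have hrest : ∀ t, HasDerivAt (fun t => (2 * Real.arctan (κ * Real.exp t), Real.pi / 2, (0 : ℝ)))
        (clippedField q lam a B (2 * Real.arctan (κ * Real.exp t), Real.pi / 2, 0)) t := fun t => by
      have h3 : HasDerivAt (fun t => 2 * Real.arctan (κ * Real.exp t)) _ t := (hfp κ hκ t).fst
      refine HasDerivAt.congr_deriv (h3.prodMk ((hasDerivAt_const t (Real.pi / 2)).prodMk
        (hasDerivAt_const t (0 : ℝ)))) ?_
      have hcl : clip B 0 = 0 := clip_eq_self (by simpa using hB)
      rw [clippedField_eq hcl]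
      simp [clippedField, reducedField, mul_div_cancel₀]
    have := congrFun (eq_of_trajectories hK (hfp κ hκ) hrest (t₀ := τ) (by rw [h1, h2])) 0
    have h4 : f κ 0 = Real.pi / 2 := congrArg (fun s : ℝ × ℝ × ℝ => s.2.1) this
    linarith [(hf0 κ hκ).2]
  set Ω : ℝ → ℝ → ℝ := fun κ τ => ((Real.pi / 2 - f κ τ) * (-(W κ τ).2.2) -
    (-p κ τ) * (-(W κ τ).2.1)) / ((Real.pi / 2 - f κ τ) ^ 2 + (-p κ τ) ^ 2) with hΩ
  have hfc' : Continuous fun z : Icc 0 κ₀ × ℝ => f z.1 z.2 :=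
    hfc.comp (f := fun z : Icc 0 κ₀ × ℝ => ((z.1 : ℝ), z.2)) (by fun_prop)
  have hpc' : Continuous fun z : Icc 0 κ₀ × ℝ => p z.1 z.2 :=
    hpc.comp (f := fun z : Icc 0 κ₀ × ℝ => ((z.1 : ℝ), z.2)) (by fun_prop)
  have hWc : Continuous fun z : Icc 0 κ₀ × ℝ => W z.1 z.2 := by
    refine hK.continuous.comp (Continuous.prodMk ?_ (hfc'.prodMk hpc'))
    exact continuous_const.mul (Real.continuous_arctan.comp (by fun_prop))
  have hΩc : Continuous fun z : Icc 0 κ₀ × ℝ => Ω z.1 z.2 := by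
    refine Continuous.div ?_ (by fun_prop) fun z => hne z.1 z.1.2 z.2
    have h1 : Continuous fun z : Icc 0 κ₀ × ℝ => (W z.1 z.2).2.1 := hWc.snd.fst
    have h2 : Continuous fun z : Icc 0 κ₀ × ℝ => (W z.1 z.2).2.2 := hWc.snd.snd
    fun_prop
  set θ : ℝ → ℝ → ℝ := fun κ τ => Real.arctan (-p κ 0 / (Real.pi / 2 - f κ 0)) +
    ∫ s in (0 : ℝ)..τ, Ω κ s with hθ
  have hΩcκ : ∀ κ ∈ Icc 0 κ₀, Continuous (Ω κ) := fun κ hκ =>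
    hΩc.comp (f := fun s : ℝ => ((⟨κ, hκ⟩ : Icc 0 κ₀), s)) (by fun_prop)
  have hθd : ∀ κ ∈ Icc 0 κ₀, ∀ τ, HasDerivAt (θ κ) (Ω κ τ) τ := fun κ hκ τ =>
    ((hΩcκ κ hκ).integral_hasStrictDerivAt 0 τ).hasDerivAt.const_add _
  have hθc : Continuous fun z : Icc 0 κ₀ × ℝ => θ z.1 z.2 := by
    refine Continuous.add ?_ (intervalIntegral.continuous_parametric_primitive_of_continuous
      (f := fun (κ : Icc 0 κ₀) s => Ω κ s) hΩc)
    refine Real.continuous_arctan.comp (Continuous.div ?_ ?_ fun z => ?_)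
    · exact (hpc'.comp (f := fun z : Icc 0 κ₀ × ℝ => (z.1, (0 : ℝ))) (by fun_prop)).neg
    · exact continuous_const.sub
        (hfc'.comp (f := fun z : Icc 0 κ₀ × ℝ => (z.1, (0 : ℝ))) (by fun_prop))
    · have := (hf0 z.1 z.1.2).2
      exact (sub_pos.2 this).ne'
  have hangle : ∀ κ ∈ Icc 0 κ₀, ∀ τ,
      (Real.pi / 2 - f κ τ) * Real.sin (θ κ τ) = -p κ τ * Real.cos (θ κ τ) := fun κ hκ τ => by
    refine mul_sin_eq_mul_cos_of_angle (fun t => (hfd κ hκ t).const_sub (Real.pi / 2))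
      (fun t => (hpd κ hκ t).neg) (hne κ hκ) (fun t => ?_) ?_ τ
    · exact hθd κ hκ t
    · have h1 : (0 : ℝ) < Real.pi / 2 - f κ 0 := sub_pos.2 (hf0 κ hκ).2
      simp only [hθ, intervalIntegral.integral_same, add_zero]
      have h2 := (Real.cos_arctan_pos (-p κ 0 / (Real.pi / 2 - f κ 0))).ne'
      have h3 := Real.tan_eq_sin_div_cos (Real.arctan (-p κ 0 / (Real.pi / 2 - f κ 0)))
      rw [Real.tan_arctan, div_eq_div_iff h1.ne' h2] at h3
      change (Real.pi / 2 - f κ 0) * _ = -p κ 0 * _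
      rw [h3]; ring
  have hiff : ∀ κ ∈ Icc 0 κ₀, ∀ τ, Real.cos (θ κ τ) = 0 ↔ Real.pi / 2 - f κ τ = 0 :=
    fun κ hκ τ => cos_eq_zero_iff_of_mul_sin_eq (hne κ hκ τ) (hangle κ hκ τ)
  have hWeq : ∀ κ ∈ Icc 0 κ₀, ∀ τ, κ * Real.exp τ ≤ 1 → W κ τ = reducedField q lam a (F κ τ) :=
    fun κ hκ τ h => clippedField_eq (clip_eq_self (hE κ hκ τ h).1.le)
  have hinf := infinite_cos_angle_eq_zero hκ₀ hθc hθd ?_ ?_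
  · refine hinf.mono fun κ hκ => ⟨hκ.1, ?_⟩
    have := (hiff κ ⟨hκ.1.1.le, hκ.1.2⟩ _).1 hκ.2
    linarith
  · intro κ hκ τ h1 hc
    have hX := (hiff κ hκ τ).1 hc
    have hne' := hne κ hκ τ
    simp only [hΩ]
    rw [hX] at hne' ⊢
    rw [hWeq κ hκ τ h1]
    simp only [reducedField, hF]
    have hM1 := lengthFactor_pos ha (2 * Real.arctan (κ * Real.exp τ))
    have hM2 := lengthFactor_pos ha (f κ τ)
    have hp0 : 0 < (p κ τ) ^ 2 := by
      have : (p κ τ) ^ 2 ≠ 0 := by simpa using hne'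
      positivity
    refine div_neg_of_neg_of_pos ?_ (by rw [neg_sq]; positivity)
    have : 0 < lengthFactor a (2 * Real.arctan (κ * Real.exp τ)) * (p κ τ) ^ 2 /
      lengthFactor a (f κ τ) := by positivity
    calc _ = -(lengthFactor a (2 * Real.arctan (κ * Real.exp τ)) * (p κ τ) ^ 2 /
      lengthFactor a (f κ τ)) := by ring
      _ < 0 := by linarith
  · have h0 : (0 : ℝ) ∈ Icc 0 κ₀ := ⟨le_rfl, hκ₀.le⟩
    have hW0 : ∀ τ, W 0 τ = (0, p 0 τ / lengthFactor a (f 0 τ),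
        lam / 2 * Real.sin (2 * f 0 τ) / lengthFactor a (f 0 τ) - q * p 0 τ) := fun τ => by
      rw [hWeq 0 h0 τ (by simp)]
      simp [reducedField, hF]
    obtain ⟨δ, hδ, T, hT0, hT⟩ := exists_eventual_rotation ha hq hlam hsmall
      (fun t => (hfd 0 h0 t).congr_deriv (by rw [hW0])) (fun t => (hpd 0 h0 t).congr_deriv (by rw [hW0]))
      (fun t => (hE 0 h0 t (by simp)).2) (hf0 0 h0).1 (by linarith [(hf0 0 h0).2, Real.pi_pos])
    have hdec : ∀ t ≥ T, θ 0 t ≤ θ 0 T - δ * (t - T) := fun t ht => by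
      refine image_le_of_deriv_right_le_deriv_boundary (f := θ 0) (a := T) (b := t)
        (B := fun t => θ 0 T - δ * (t - T)) (B' := fun _ => -δ)
        (fun s _ => (hθd 0 h0 s).continuousAt.continuousWithinAt)
        (fun s _ => (hθd 0 h0 s).hasDerivWithinAt) (by simp)
        (by fun_prop) (fun s _ => ?_) (fun s hs => ?_) ⟨ht, le_rfl⟩
      · exact ((((hasDerivAt_id s).sub_const T).const_mul δ).const_sub
          (θ 0 T)).hasDerivWithinAt.congr_deriv (by simp)
      · have h1 := hT s hs.1
        simp only [hΩ]
        rw [div_le_iff₀ (lt_of_le_of_ne (by positivity) (hne 0 h0 s).symm), hW0]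
        rw [neg_sq]
        calc _ = -(Real.pi / 2 - f 0 s) * (lam / 2 * Real.sin (2 * f 0 s) /
              lengthFactor a (f 0 s) - q * p 0 s) - p 0 s * (p 0 s / lengthFactor a (f 0 s)) := by
              ring
          _ ≤ _ := h1
          _ = _ := by ring
    refine tendsto_atBot_mono' atTop (eventually_ge_atTop T |>.mono hdec) ?_
    have h1 : Tendsto (fun t : ℝ => δ * (t - T)) atTop atTop :=
      (tendsto_atTop_add_const_right _ (-T) tendsto_id).const_mul_atTop hδ
    simpa [sub_eq_add_neg] using tendsto_atBot_add_const_left _ (θ 0 T)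
      (tendsto_neg_atTop_atBot.comp h1)

end Crossings

/-! ### Profiles -/

section Profiles

open Set Filter Topology

/-- A solution `f` of the reduced boundary value problem with the properties that make
`(ψ, θ) ↦ (f(ψ), χ(θ))` smooth: `f` is smooth inside, symmetric with respect to the equator, and
`tan(f/2) = t^d P(t²)` near the pole, where `t = tan(ψ/2)`. The number `v = P(0)` distinguishes
different solutions. -/
structure IsSmoothProfile (k d : ℕ) (a v : ℝ) (f : ℝ → ℝ) : Prop where
  isReducedSolution : IsReducedSolution k d a f
  contDiffOn : ContDiffOn ℝ ∞ f (Ioo 0 Real.pi)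
  map_pi_sub : ∀ ψ ∈ Icc 0 Real.pi, f (Real.pi - ψ) = Real.pi - f ψ
  pole : ∃ P : ℝ → ℝ, ContDiff ℝ ∞ P ∧ P 0 = v ∧ ∀ᶠ ψ in 𝓝[≥] 0,
    f ψ = 2 * Real.arctan (Real.tan (ψ / 2) ^ d * P (Real.tan (ψ / 2) ^ 2))

theorem contDiff_of_trajectory {E : Type*} [NormedAddCommGroup E] [NormedSpace ℝ E] {v : E → E}
    (hv : ContDiff ℝ ∞ v) {γ : ℝ → E} (hγ : ∀ t, HasDerivAt γ (v (γ t)) t) : ContDiff ℝ ∞ γ := by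
  rw [contDiff_infty]
  intro n
  induction n with
  | zero =>
    exact contDiff_zero.2 (continuous_iff_continuousAt.2 fun t => (hγ t).continuousAt)
  | succ n ih =>
    have : deriv γ = fun t => v (γ t) := funext fun t => (hγ t).deriv
    rw [Nat.cast_succ, contDiff_succ_iff_deriv]
    refine ⟨fun t => (hγ t).differentiableAt, by simp, ?_⟩
    rw [this]
    exact (hv.of_le (by exact_mod_cast le_top)).comp ih

theorem tan_half_pos {ψ : ℝ} (hψ : ψ ∈ Ioo 0 Real.pi) : 0 < Real.tan (ψ / 2) :=
  Real.tan_pos_of_pos_of_lt_pi_div_two (by linarith [hψ.1]) (by linarith [hψ.2])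

theorem two_mul_arctan_tan_half {ψ : ℝ} (hψ : ψ ∈ Ioo 0 Real.pi) :
    2 * Real.arctan (Real.tan (ψ / 2)) = ψ := by
  rw [Real.arctan_tan (by linarith [hψ.1, Real.pi_pos]) (by linarith [hψ.2])]; ring

theorem hasDerivAt_log_tan_half {ψ : ℝ} (hψ : ψ ∈ Ioo 0 Real.pi) :
    HasDerivAt (fun x => Real.log (Real.tan (x / 2))) (1 / Real.sin ψ) ψ := by
  have hc : 0 < Real.cos (ψ / 2) :=
    Real.cos_pos_of_mem_Ioo ⟨by linarith [hψ.1, Real.pi_pos], by linarith [hψ.2]⟩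
  have hs : 0 < Real.sin (ψ / 2) :=
    Real.sin_pos_of_pos_of_lt_pi (by linarith [hψ.1]) (by linarith [hψ.2, Real.pi_pos])
  have h1 : HasDerivAt (fun x => Real.tan (x / 2)) (1 / Real.cos (ψ / 2) ^ 2 * (1 / 2)) ψ :=
    HasDerivAt.comp (h₂ := Real.tan) (h := fun x => x / 2) ψ (Real.hasDerivAt_tan hc.ne')
      ((hasDerivAt_id ψ).div_const 2)
  refine (h1.log (tan_half_pos hψ).ne').congr_deriv ?_
  have h2 : Real.sin ψ = 2 * Real.sin (ψ / 2) * Real.cos (ψ / 2) := by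
    rw [← Real.sin_two_mul]; ring_nf
  rw [h2, Real.tan_eq_sin_div_cos]
  field_simp

/-- A symmetric trajectory of the reduced system, written as a function of `ψ`, is a profile. -/
theorem exists_isSmoothProfile {k d : ℕ} (hd : 1 ≤ d) {a : ℝ} (ha : a ≠ 0) {g p : ℝ → ℝ}
    (hgp : ∀ σ, HasDerivAt (fun t => (2 * Real.arctan (Real.exp t), g t, p t))
      (reducedField (k - 2) (d * (d + k - 2)) a (2 * Real.arctan (Real.exp σ), g σ, p σ)) σ)
    (hsymm : ∀ σ, g (-σ) = Real.pi - g σ) {P : ℝ → ℝ} (hP : ContDiff ℝ ∞ P) {σ₀ : ℝ}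
    (hpole : ∀ σ ≤ σ₀, g σ = 2 * Real.arctan (Real.exp σ ^ d * P (Real.exp σ ^ 2))) :
    ∃ f, IsSmoothProfile k d a (P 0) f := by
  set q : ℝ := k - 2 with hq
  set lam : ℝ := d * (d + k - 2) with hlam
  set f : ℝ → ℝ := fun ψ => if ψ ≤ 0 then 0 else if Real.pi ≤ ψ then Real.pi else
    g (Real.log (Real.tan (ψ / 2))) with hf
  have hfin : ∀ ψ ∈ Ioo 0 Real.pi, f ψ = g (Real.log (Real.tan (ψ / 2))) := fun ψ hψ => by
    simp only [hf]; rw [if_neg hψ.1.not_ge, if_neg hψ.2.not_ge]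
  have hf0 : f 0 = 0 := by simp [hf]
  have hfπ : f Real.pi = Real.pi := by simp only [hf]; rw [if_neg Real.pi_pos.not_ge, if_pos le_rfl]
  have hγ := contDiff_of_trajectory (contDiff_reducedField q lam ha) hgp
  have hgs : ContDiff ℝ ∞ g := hγ.snd.fst
  have hlog : ContDiffOn ℝ ∞ (fun ψ => Real.log (Real.tan (ψ / 2))) (Ioo 0 Real.pi) := fun ψ hψ => by
    have hc : 0 < Real.cos (ψ / 2) :=
      Real.cos_pos_of_mem_Ioo ⟨by linarith [hψ.1, Real.pi_pos], by linarith [hψ.2]⟩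
    refine ContDiffAt.contDiffWithinAt (ContDiffAt.log ?_ (tan_half_pos hψ).ne')
    exact (Real.contDiffAt_tan.2 hc.ne').comp (f := fun ψ => ψ / 2) ψ (by fun_prop)
  have hsmooth : ContDiffOn ℝ ∞ f (Ioo 0 Real.pi) :=
    (hgs.comp_contDiffOn hlog).congr hfin
  have hrefl : ∀ ψ ∈ Icc 0 Real.pi, f (Real.pi - ψ) = Real.pi - f ψ := fun ψ hψ => by
    rcases hψ.1.eq_or_lt with rfl | h1
    · rw [sub_zero, hf0, hfπ, sub_zero]
    rcases hψ.2.eq_or_lt with rfl | h2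
    · rw [sub_self, hf0, hfπ, sub_self]
    rw [hfin _ ⟨h1, h2⟩, hfin _ ⟨by linarith, by linarith⟩, ← hsymm, ← Real.log_inv,
      ← Real.tan_pi_div_two_sub]
    congr 3; ring
  have hpole' : ∀ᶠ ψ in 𝓝[≥] 0,
      f ψ = 2 * Real.arctan (Real.tan (ψ / 2) ^ d * P (Real.tan (ψ / 2) ^ 2)) := by
    have hpos : 0 < 2 * Real.arctan (Real.exp σ₀) := by
      have := Real.arctan_pos.2 (Real.exp_pos σ₀); linarith
    filter_upwards [Ico_mem_nhdsGE hpos] with ψ hψ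
    rcases hψ.1.eq_or_lt with rfl | h1
    · rw [hf0]
      simp [zero_pow (by omega : d ≠ 0)]
    have hψπ : ψ ∈ Ioo 0 Real.pi :=
      ⟨h1, hψ.2.trans (by linarith [Real.arctan_lt_pi_div_two (Real.exp σ₀)])⟩
    have ht := tan_half_pos hψπ
    have hle : Real.log (Real.tan (ψ / 2)) ≤ σ₀ := by
      rw [Real.log_le_iff_le_exp ht, ← Real.arctan_le_arctan_iff]
      linarith [two_mul_arctan_tan_half hψπ, hψ.2]
    rw [hfin ψ hψπ, hpole _ hle, Real.exp_log ht]
  have hcont0 : ContinuousWithinAt f (Ici 0) 0 := by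
    have hc : ContinuousAt (fun ψ => 2 * Real.arctan (Real.tan (ψ / 2) ^ d *
        P (Real.tan (ψ / 2) ^ 2))) 0 := by
      have h1 : ContinuousAt (fun ψ : ℝ => Real.tan (ψ / 2)) 0 :=
        ContinuousAt.comp (g := Real.tan) (f := fun ψ : ℝ => ψ / 2)
          (Real.continuousAt_tan.2 (by simp)) (by fun_prop)
      have h2 : ContinuousAt (fun ψ : ℝ => P (Real.tan (ψ / 2) ^ 2)) 0 :=
        ContinuousAt.comp (g := P) hP.continuous.continuousAt (h1.pow 2)
      exact ((Real.continuous_arctan.continuousAt).comp ((h1.pow d).mul h2)).const_mul 2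
        |>.congr (Eventually.of_forall fun _ => rfl)
    exact hc.continuousWithinAt.congr_of_eventuallyEq hpole' (hpole'.self_of_nhdsWithin self_mem_Ici)
  have hF1 : ∀ ψ ∈ Ioo 0 Real.pi, HasDerivAt f (lengthFactor a ψ *
      p (Real.log (Real.tan (ψ / 2))) / lengthFactor a (f ψ) * (1 / Real.sin ψ)) ψ := by
    intro ψ hψ
    have h1 : HasDerivAt g _ _ := (hgp (Real.log (Real.tan (ψ / 2)))).snd.fst
    have h2 := h1.comp ψ (hasDerivAt_log_tan_half hψ)
    have h3 := h2.congr_of_eventuallyEq (f₁ := f)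
      (by filter_upwards [isOpen_Ioo.mem_nhds hψ] with x hx using hfin x hx)
    refine h3.congr_deriv ?_
    simp only [reducedField]
    rw [Real.exp_log (tan_half_pos hψ), two_mul_arctan_tan_half hψ, hfin ψ hψ]
  refine ⟨f, ⟨hsmooth.of_le (WithTop.coe_le_coe.2 le_top), ?_, ?_, hf0, 1, by simpa using hfπ⟩, hsmooth,
    hrefl, P, hP, rfl, hpole'⟩
  · intro ψ hψ
    have hd1 : deriv f =ᶠ[𝓝 ψ] fun ψ => lengthFactor a ψ *
      p (Real.log (Real.tan (ψ / 2))) / lengthFactor a (f ψ) * (1 / Real.sin ψ) := by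
      filter_upwards [isOpen_Ioo.mem_nhds hψ] with x hx using (hF1 x hx).deriv
    have hsin : 0 < Real.sin ψ := Real.sin_pos_of_mem_Ioo hψ
    have hp : HasDerivAt p _ _ := (hgp (Real.log (Real.tan (ψ / 2)))).snd.snd
    have hp' := hp.comp ψ (hasDerivAt_log_tan_half hψ)
    have hMf := (hasDerivAt_lengthFactor ha (f ψ)).comp ψ (hF1 ψ hψ)
    have hM1 := lengthFactor_pos ha ψ
    have hM2 := lengthFactor_pos ha (f ψ)
    have h2 := ((((hasDerivAt_lengthFactor ha ψ).mul hp').div hMf hM2.ne').mul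
      ((Real.hasDerivAt_sin ψ).inv hsin.ne'))
    have h3 : HasDerivAt (fun ψ => lengthFactor a ψ *
      p (Real.log (Real.tan (ψ / 2))) / lengthFactor a (f ψ) * (1 / Real.sin ψ)) _ ψ :=
      h2.congr_of_eventuallyEq (Eventually.of_forall fun x => by
        simp [div_eq_mul_inv])
    rw [hd1.deriv_eq, h3.deriv, (hF1 ψ hψ).deriv, Real.cot_eq_cos_div_sin, ← sq_lengthFactor ha ψ,
      ← sq_lengthFactor ha (f ψ)]
    simp only [reducedField, Function.comp_apply, Pi.mul_apply, Pi.div_apply, Pi.inv_apply]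
    rw [Real.exp_log (tan_half_pos hψ), two_mul_arctan_tan_half hψ, ← hfin ψ hψ]
    generalize lengthFactor a ψ = M₁ at *
    generalize lengthFactor a (f ψ) = M₂ at *
    generalize p (Real.log (Real.tan (ψ / 2))) = p₀ at *
    generalize Real.sin (2 * f ψ) = S₁
    generalize Real.sin (2 * ψ) = S₂
    generalize Real.sin ψ = s at *
    generalize Real.cos ψ = c at *
    field_simp
    ring
  · intro ψ hψ
    rcases hψ.1.eq_or_lt with rfl | h1
    · exact hcont0.mono Icc_subset_Ici_self
    rcases hψ.2.eq_or_lt with rfl | h2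
    · have h3 : ContinuousWithinAt (fun ψ => Real.pi - f (Real.pi - ψ)) (Icc 0 Real.pi) Real.pi := by
        refine continuousWithinAt_const.sub (ContinuousWithinAt.comp (g := f) (s := Icc 0 Real.pi)
          (t := Ici 0) (f := fun ψ => Real.pi - ψ) ?_ (by fun_prop) fun x hx => sub_nonneg.2 hx.2)
        rw [sub_self]; exact hcont0
      refine h3.congr (fun x hx => ?_) ?_
      · rw [hrefl x hx]; ring
      · rw [hrefl _ hψ]; ring
    · exact (hF1 ψ ⟨h1, h2⟩).continuousAt.continuousWithinAt

/-- There are infinitely many profiles, distinguished by their leading coefficients at the pole. -/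
theorem infinite_isSmoothProfile {k d : ℕ} (hk : 3 ≤ k) {a : ℝ} (ha : a ≠ 0)
    (hsmall : a ^ 2 < 4 * (d : ℝ) * ((d : ℝ) + (k : ℝ) - 2) / ((k : ℝ) - 2) ^ 2) :
    {v : ℝ | ∃ f, IsSmoothProfile k d a v f}.Infinite := by
  have hkR : (3 : ℝ) ≤ k := by exact_mod_cast hk
  have hd : 1 ≤ d := by
    by_contra! h
    obtain rfl : d = 0 := by omega
    have : 0 < a ^ 2 := by positivity
    simp at hsmall
    linarith
  have hdR : (1 : ℝ) ≤ d := by exact_mod_cast hd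
  have hq : (0 : ℝ) < k - 2 := by linarith
  have hlam : (0 : ℝ) < d * (d + k - 2) := by nlinarith
  rw [lt_div_iff₀ (by positivity)] at hsmall
  obtain ⟨B, hB, r, hr, κ₀, hκ₀, f, p, hfc, hpc, hfam⟩ := exists_trajectory_family hk hd ha
  have hinf := infinite_symmetric_trajectories ha hB.le hq hlam (by linarith) hκ₀ hfc hpc
    (fun κ hκ => (hfam κ hκ).1) (fun κ hκ => ⟨((hfam κ hκ).2.1 0 le_rfl).1,
      ((hfam κ hκ).2.1 0 le_rfl).2.1⟩) (fun κ hκ => (hfam κ hκ).2.2.1)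
  have hinj : InjOn (fun κ => (r / κ) ^ d)
      {κ ∈ Ioc 0 κ₀ | f κ (-Real.log κ) = Real.pi / 2} := by
    intro x hx y hy hxy
    have hx0 := hx.1.1
    have hy0 := hy.1.1
    have h1 := (pow_left_inj₀ (by positivity) (by positivity) (by omega : d ≠ 0)).1 hxy
    rw [div_eq_div_iff hx0.ne' hy0.ne'] at h1
    exact (mul_left_cancel₀ hr.ne' h1).symm
  refine (hinf.image hinj).mono ?_
  rintro _ ⟨κ, ⟨hκ, hmid⟩, rfl⟩
  have hκ0 : 0 < κ := hκ.1
  obtain ⟨htraj, -, hbound, hP⟩ := hfam κ ⟨hκ0.le, hκ.2⟩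
  obtain ⟨P, hPs, hP0, hPf⟩ := hP hκ0
  set T := -Real.log κ with hT
  have hκT : κ * Real.exp T = 1 := by
    rw [hT, Real.exp_neg, Real.exp_log hκ0, mul_inv_cancel₀ hκ0.ne']
  have hshift : ∀ σ, κ * Real.exp (σ + T) = Real.exp σ := fun σ => by
    rw [Real.exp_add, mul_left_comm, hκT, mul_one]
  obtain ⟨C, K, hC, hK⟩ := exists_bound_clippedField (k - 2) (d * (d + k - 2)) ha hB.le
  -- The trajectory, in the time that vanishes at the equator.
  set γ : ℝ → ℝ × ℝ × ℝ := fun σ => (2 * Real.arctan (Real.exp σ), f κ (σ + T), p κ (σ + T)) with hγ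
  have hγd : ∀ σ, HasDerivAt γ (clippedField (k - 2) (d * (d + k - 2)) a B (γ σ)) σ := fun σ => by
    have h1 := (htraj (σ + T)).comp_add_const σ T
    simp only [hshift] at h1
    exact h1
  have hγ' : ∀ σ, HasDerivAt (fun σ => (Real.pi - (γ (-σ)).1, Real.pi - (γ (-σ)).2.1, (γ (-σ)).2.2))
      (clippedField (k - 2) (d * (d + k - 2)) a B
        (Real.pi - (γ (-σ)).1, Real.pi - (γ (-σ)).2.1, (γ (-σ)).2.2)) σ := fun σ => by
    have h0 : HasDerivAt (fun σ => γ (-σ)) _ σ :=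
      (hγd (-σ)).scomp σ (hasDerivAt_neg σ)
    have h1 : HasDerivAt (fun σ => (γ (-σ)).1) _ σ := h0.fst
    have h2 : HasDerivAt (fun σ => (γ (-σ)).2.1) _ σ := h0.snd.fst
    have h3 : HasDerivAt (fun σ => (γ (-σ)).2.2) _ σ := h0.snd.snd
    refine HasDerivAt.congr_deriv
      ((h1.const_sub Real.pi).prodMk ((h2.const_sub Real.pi).prodMk h3)) ?_
    simp only [clippedField, reducedField, lengthFactor_pi_sub, Real.sin_pi_sub, Real.cos_pi_sub,
      mul_sub, Real.sin_two_pi_sub, neg_smul, one_smul, Prod.fst_neg,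
      Prod.snd_neg, neg_neg]
    refine Prod.ext rfl (Prod.ext rfl ?_)
    simp only
    ring
  have hsymm : ∀ σ, γ σ = (Real.pi - (γ (-σ)).1, Real.pi - (γ (-σ)).2.1, (γ (-σ)).2.2) :=
    congrFun (eq_of_trajectories hK hγd hγ' (t₀ := 0) (by
      simp only [hγ, neg_zero, zero_add, Real.exp_zero, Real.arctan_one, hmid]
      refine Prod.ext ?_ (Prod.ext ?_ rfl) <;> simp only <;> ring))
  have hpB : ∀ σ, |p κ (σ + T)| < B := fun σ => by
    rcases le_total σ 0 with h | h
    · exact (hbound _ (by rw [hshift]; exact Real.exp_le_one_iff.2 h)).1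
    · have h1 : p κ (σ + T) = p κ (-σ + T) := congrArg (fun s : ℝ × ℝ × ℝ => s.2.2) (hsymm σ)
      rw [h1]
      exact (hbound _ (by rw [hshift]; exact Real.exp_le_one_iff.2 (by linarith))).1
  rw [mem_ofPred_eq]
  beta_reduce
  rw [← hP0]
  refine exists_isSmoothProfile hd ha (g := fun σ => f κ (σ + T)) (p := fun σ => p κ (σ + T))
    (fun σ => ?_) (fun σ => ?_) hPs (σ₀ := -T) fun σ hσ => ?_
  · have h1 := hγd σ
    rw [show γ σ = (2 * Real.arctan (Real.exp σ), f κ (σ + T), p κ (σ + T)) from rfl,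
      clippedField_eq (clip_eq_self (hpB σ).le)] at h1
    exact h1
  · have h1 : f κ (σ + T) = Real.pi - f κ (-σ + T) := congrArg (fun s : ℝ × ℝ × ℝ => s.2.1) (hsymm σ)
    linarith
  · have h1 := hPf (σ + T) (by linarith)
    rw [hshift] at h1
    exact h1

end Profiles

/-! ### The tension field as a trace of ambient Hessians -/

section TensionField

open Set Filter Topology
open scoped InnerProductSpace

theorem sum_apply_orthonormalBasis {E F ι : Type*} [NormedAddCommGroup E]
    [InnerProductSpace ℝ E] [FiniteDimensional ℝ E] [NormedAddCommGroup F] [NormedSpace ℝ F]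
    [Fintype ι] (B : E →L[ℝ] E →L[ℝ] F) (b : OrthonormalBasis ι ℝ E) :
    ∑ i, B (b i) (b i) = TensorProduct.lift (LinearMap.mk₂ ℝ (fun v w => B v w) (by simp) (by simp)
      (by simp) (by simp)) (InnerProductSpace.canonicalCovariantTensor E) := by
  rw [InnerProductSpace.canonicalCovariantTensor_eq_sum E b, map_sum]
  rfl

theorem sum_apply_orthonormalBasis_eq {E F ι κ : Type*} [NormedAddCommGroup E]
    [InnerProductSpace ℝ E] [NormedAddCommGroup F] [NormedSpace ℝ F] [Fintype ι] [Fintype κ]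
    (B : E →L[ℝ] E →L[ℝ] F) (b : OrthonormalBasis ι ℝ E) (b' : OrthonormalBasis κ ℝ E) :
    ∑ i, B (b i) (b i) = ∑ j, B (b' j) (b' j) := by
  have : FiniteDimensional ℝ E := b.toBasis.finiteDimensional_of_finite
  rw [sum_apply_orthonormalBasis, sum_apply_orthonormalBasis]

/-- The trace of a bilinear map is the sum of its trace on a hyperplane and its value at the unit
normal. -/
theorem sum_apply_orthogonal_span {E F ι κ : Type*} [NormedAddCommGroup E]
    [InnerProductSpace ℝ E] [NormedAddCommGroup F] [NormedSpace ℝ F] [Fintype ι] [Fintype κ]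
    (B : E →L[ℝ] E →L[ℝ] F) {n : E} (hn : n ≠ 0)
    (b : OrthonormalBasis ι ℝ (Submodule.span ℝ {n})ᗮ) (b' : OrthonormalBasis κ ℝ E) :
    ∑ i, B (b i : E) (b i : E) + (‖n‖ ^ 2)⁻¹ • B n n = ∑ j, B (b' j) (b' j) := by
  have : FiniteDimensional ℝ E := b'.toBasis.finiteDimensional_of_finite
  have hn0 : ‖n‖ ≠ 0 := norm_ne_zero_iff.2 hn
  let v : Option ι → E := fun o => o.elim (‖n‖⁻¹ • n) fun i => (b i : E)
  have hbn : ∀ i, ⟪n, (b i : E)⟫_ℝ = 0 := fun i =>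
    (Submodule.mem_orthogonal_singleton_iff_inner_right).1 (b i).2
  have hbb : ∀ i j, ⟪(b i : E), (b j : E)⟫_ℝ = ⟪b i, b j⟫_ℝ := fun i j => rfl
  have hv : Orthonormal ℝ v := by
    classical
    rw [orthonormal_iff_ite]
    rintro (_ | i) (_ | j)
    · simp only [v, Option.elim, inner_smul_left, inner_smul_right, real_inner_self_eq_norm_sq,
        if_true]
      simp only [conj_trivial]
      field_simp
    · simp [v, inner_smul_left, hbn]
    · simp [v, inner_smul_right, real_inner_comm, hbn]
    · simp only [v, Option.elim, hbb, orthonormal_iff_ite.1 b.orthonormal, Option.some.injEq]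
  have hsp : (Submodule.span ℝ (range v))ᗮ = ⊥ := by
    rw [eq_bot_iff]
    intro x hx
    have hx' : ∀ o, ⟪v o, x⟫_ℝ = 0 := fun o =>
      Submodule.inner_right_of_mem_orthogonal (Submodule.subset_span (mem_range_self o)) hx
    have h1 : ⟪n, x⟫_ℝ = 0 := by
      have := hx' none
      simp only [v, Option.elim, inner_smul_left] at this
      simpa [hn0] using this
    let y : (Submodule.span ℝ {n})ᗮ := ⟨x, Submodule.mem_orthogonal_singleton_iff_inner_right.2 h1⟩
    have h2 : y = 0 := by
      rw [← b.sum_repr' y]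
      exact Finset.sum_eq_zero fun i _ => by
        rw [show ⟪b i, y⟫_ℝ = 0 from hx' (some i), zero_smul]
    exact congrArg Subtype.val h2
  have h := sum_apply_orthonormalBasis_eq B (OrthonormalBasis.mkOfOrthogonalEqBot hv hsp) b'
  rw [← h, Fintype.sum_option, OrthonormalBasis.coe_of_orthogonal_eq_bot_mk]
  simp only [v, Option.elim, map_smul, smul_apply, smul_smul]
  rw [add_comm]
  congr 2
  rw [pow_two, mul_inv]

variable {n : ℕ}

/-- The linear map `x ↦ normalVec c x`. -/
noncomputable def normalCLM (c : Fin n → ℝ) : EuclideanSpace ℝ (Fin n) →L[ℝ] EuclideanSpace ℝ (Fin n) :=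
  LinearMap.toContinuousLinearMap
    { toFun := normalVec c
      map_add' := fun x y => by ext i; simp [normalVec, mul_add]
      map_smul' := fun r x => by ext i; simp [normalVec, mul_left_comm] }

@[simp] theorem normalCLM_apply (c : Fin n → ℝ) (x : EuclideanSpace ℝ (Fin n)) :
    normalCLM c x = normalVec c x := rfl

theorem inner_normalVec_self {c : Fin n → ℝ} {x : EuclideanSpace ℝ (Fin n)} (hx : x ∈ ellipsoid c) :
    ⟪normalVec c x, x⟫_ℝ = 1 := by
  rw [← (show ∑ i, c i * x i ^ 2 = 1 from hx), PiLp.inner_apply]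
  refine Finset.sum_congr rfl fun i _ => ?_
  simp [normalVec]; ring

theorem inner_normalVec_comm (c : Fin n → ℝ) (x y : EuclideanSpace ℝ (Fin n)) :
    ⟪normalVec c x, y⟫_ℝ = ⟪normalVec c y, x⟫_ℝ := by
  rw [PiLp.inner_apply, PiLp.inner_apply]
  refine Finset.sum_congr rfl fun i _ => ?_
  simp [normalVec]; ring

theorem normalVec_ne_zero {c : Fin n → ℝ} {x : EuclideanSpace ℝ (Fin n)} (hx : x ∈ ellipsoid c) :
    normalVec c x ≠ 0 := fun h => by
  have := inner_normalVec_self hx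
  rw [h, inner_zero_left] at this
  exact zero_ne_one this

theorem tangentProj_eq (c : Fin n → ℝ) (x v : EuclideanSpace ℝ (Fin n)) :
    tangentProj c x v =
      v - (⟪normalVec c x, v⟫_ℝ / ‖normalVec c x‖ ^ 2) • normalVec c x := by
  change ((Submodule.span ℝ {normalVec c x})ᗮ).starProjection v = _
  rw [Submodule.starProjection_orthogonal', sub_apply, Submodule.starProjection_singleton]
  rfl

theorem tangentProj_smul_normalVec {c : Fin n → ℝ} (x : EuclideanSpace ℝ (Fin n)) (r : ℝ) :
    tangentProj c x (r • normalVec c x) = 0 := by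
  rw [tangentProj_eq, inner_smul_right, real_inner_self_eq_norm_sq]
  rcases eq_or_ne (normalVec c x) 0 with h | h
  · simp [h]
  · have : ‖normalVec c x‖ ≠ 0 := norm_ne_zero_iff.2 h
    rw [mul_div_assoc, div_self (by positivity), mul_one, sub_self]

theorem inner_normalVec_of_mem {c : Fin n → ℝ} {x v : EuclideanSpace ℝ (Fin n)}
    (hv : v ∈ tangentPlane c x) : ⟪normalVec c x, v⟫_ℝ = 0 :=
  Submodule.mem_orthogonal_singleton_iff_inner_right.1 hv

theorem sum_apply_tangentPlane {F : Type*} [NormedAddCommGroup F] [NormedSpace ℝ F]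
    {c : Fin n → ℝ} {x : EuclideanSpace ℝ (Fin n)} (hx : normalVec c x ≠ 0)
    (B : EuclideanSpace ℝ (Fin n) →L[ℝ] EuclideanSpace ℝ (Fin n) →L[ℝ] F) :
    ∑ i, B (stdOrthonormalBasis ℝ (tangentPlane c x) i : EuclideanSpace ℝ (Fin n))
        (stdOrthonormalBasis ℝ (tangentPlane c x) i : EuclideanSpace ℝ (Fin n)) +
      (‖normalVec c x‖ ^ 2)⁻¹ • B (normalVec c x) (normalVec c x) =
    ∑ j, B (EuclideanSpace.basisFun (Fin n) ℝ j) (EuclideanSpace.basisFun (Fin n) ℝ j) :=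
  sum_apply_orthogonal_span B hx (stdOrthonormalBasis ℝ (tangentPlane c x)) _

/-- The bilinear map `D²U(v, w) - |N|⁻² ⟨Cv, w⟩ DU(N)`, where `N` is the normal field and `C` its
derivative. On tangent vectors it is the Hessian, for the induced metric, of the restriction of `U`
as a vector-valued function: the correction to `D²U` is the second fundamental form. -/
noncomputable def ambientHessian (c : Fin n → ℝ) (U : EuclideanSpace ℝ (Fin n) → EuclideanSpace ℝ (Fin n))
    (x : EuclideanSpace ℝ (Fin n)) :
    EuclideanSpace ℝ (Fin n) →L[ℝ] EuclideanSpace ℝ (Fin n) →L[ℝ] EuclideanSpace ℝ (Fin n) :=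
  fderiv ℝ (fderiv ℝ U) x - (‖normalVec c x‖ ^ 2)⁻¹ •
    ((ContinuousLinearMap.smulRightL ℝ _ _).flip (fderiv ℝ U x (normalVec c x))).comp
      ((isBoundedBilinearMap_inner (𝕜 := ℝ)).toContinuousLinearMap.comp (normalCLM c))

theorem ambientHessian_apply (c : Fin n → ℝ)
    (U : EuclideanSpace ℝ (Fin n) → EuclideanSpace ℝ (Fin n)) (x v w : EuclideanSpace ℝ (Fin n)) :
    ambientHessian c U x v w = fderiv ℝ (fderiv ℝ U) x v w -
      (⟪normalVec c v, w⟫_ℝ / ‖normalVec c x‖ ^ 2) • fderiv ℝ U x (normalVec c x) := by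
  simp only [ambientHessian, sub_apply, smul_apply,
    ContinuousLinearMap.comp_apply, ContinuousLinearMap.flip_apply,
    ContinuousLinearMap.smulRightL_apply_apply, normalCLM_apply, ContinuousLinearMap.smulRight_apply]
  rw [div_eq_inv_mul, IsBoundedBilinearMap.toContinuousLinearMap_apply, smul_smul]

/-- The covariant Hessian is the tangential part of the Hessian of `u` as a vector-valued function. -/
theorem covHessian_eq {c : Fin n → ℝ} {U : EuclideanSpace ℝ (Fin n) → EuclideanSpace ℝ (Fin n)}
    {x v w : EuclideanSpace ℝ (Fin n)} (hU : ContDiffAt ℝ 2 U x) (hx : x ∈ ellipsoid c)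
    (hw : w ∈ tangentPlane c x) :
    covHessian c U x v w = tangentProj c (U x) (ambientHessian c U x v w) := by
  have hN := normalVec_ne_zero hx
  have hN0 : ‖normalVec c x‖ ^ 2 ≠ 0 := pow_ne_zero 2 (norm_ne_zero_iff.2 hN)
  have hNw := inner_normalVec_of_mem hw
  have hNd : HasFDerivAt (normalVec c) (normalCLM c) x := (normalCLM c).hasFDerivAt
  -- The derivative of the tangential projection of the constant field `w`.
  have hW : ∃ W' : EuclideanSpace ℝ (Fin n) →L[ℝ] EuclideanSpace ℝ (Fin n),
      HasFDerivAt (fun y => tangentProj c y w) W' x ∧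
        W' v = -((⟪normalVec c v, w⟫_ℝ / ‖normalVec c x‖ ^ 2) • normalVec c x) := by
    have h1 : HasFDerivAt (fun y => ⟪normalVec c y, w⟫_ℝ) _ x := hNd.inner ℝ (hasFDerivAt_const w x)
    have h2 : DifferentiableAt ℝ (fun y => (‖normalVec c y‖ ^ 2)⁻¹ • normalVec c y) x :=
      (hNd.differentiableAt.norm_sq ℝ |>.inv hN0).smul hNd.differentiableAt
    have h3 := HasFDerivAt.const_sub (HasFDerivAt.smul h1 h2.hasFDerivAt) w
    refine ⟨_, h3.congr_of_eventuallyEq (Eventually.of_forall fun y => ?_), ?_⟩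
    · change tangentProj c y w = w - ⟪normalVec c y, w⟫_ℝ • (‖normalVec c y‖ ^ 2)⁻¹ • normalVec c y
      rw [tangentProj_eq, smul_smul, div_eq_mul_inv]
    · simp [hNw, fderivInnerCLM_apply, smul_smul, div_eq_mul_inv]
  obtain ⟨W', hW', hW'v⟩ := hW
  have hU1 : DifferentiableAt ℝ (fderiv ℝ U) x :=
    (hU.fderiv_right (m := 1) (by norm_num)).differentiableAt (by norm_num)
  have hx0 : tangentProj c x w = w := by rw [tangentProj_eq, hNw]; simp
  have h4 := hU1.hasFDerivAt.clm_apply hW'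
  rw [covHessian, h4.fderiv, hW'.fderiv, hW'v]
  rw [show -((⟪normalVec c v, w⟫_ℝ / ‖normalVec c x‖ ^ 2) • normalVec c x) =
    (-(⟪normalVec c v, w⟫_ℝ / ‖normalVec c x‖ ^ 2)) • normalVec c x by rw [neg_smul],
    tangentProj_smul_normalVec, map_zero, sub_zero, ambientHessian_apply]
  congr 1
  simp only [add_apply, ContinuousLinearMap.comp_apply,
    ContinuousLinearMap.flip_apply, hx0, hW'v]
  simp only [map_neg, map_smul]
  abel

theorem tensionField_eq {c : Fin n → ℝ} {U : EuclideanSpace ℝ (Fin n) → EuclideanSpace ℝ (Fin n)}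
    {x : EuclideanSpace ℝ (Fin n)} (hU : ContDiffAt ℝ 2 U x) (hx : x ∈ ellipsoid c) :
    tensionField c U x = tangentProj c (U x)
      (∑ i, ambientHessian c U x (stdOrthonormalBasis ℝ (tangentPlane c x) i)
        (stdOrthonormalBasis ℝ (tangentPlane c x) i)) := by
  simp only [tangentProj, map_sum, tensionField]
  exact Finset.sum_congr rfl fun i _ => covHessian_eq hU hx (Subtype.mem _)

theorem continuousOn_tensionField {c : Fin n → ℝ} {u : ellipsoid c → ellipsoid c}
    {U : EuclideanSpace ℝ (Fin n) → EuclideanSpace ℝ (Fin n)} (hU : IsSmoothExtension c u U) :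
    ContinuousOn (tensionField c U) (ellipsoid c) := by
  obtain ⟨⟨O, hO, hsub, hUO⟩, hu⟩ := hU
  have hUx : ∀ x ∈ ellipsoid c, U x ∈ ellipsoid c := fun x hx => by
    rw [hu ⟨x, hx⟩]; exact Subtype.mem _
  have hNc : Continuous (normalVec c) := (normalCLM c).continuous
  have hN : ContinuousOn (normalVec c) (ellipsoid c) := hNc.continuousOn
  have hU0 : ContinuousOn U (ellipsoid c) := hUO.continuousOn.mono hsub
  have hD : ContDiffOn ℝ ∞ (fderiv ℝ U) O := hUO.fderiv_of_isOpen hO (by simp)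
  have hU1 : ContinuousOn (fderiv ℝ U) (ellipsoid c) := hD.continuousOn.mono hsub
  have hU2 : ContinuousOn (fderiv ℝ (fderiv ℝ U)) (ellipsoid c) :=
    (hD.continuousOn_fderiv_of_isOpen hO (by simp)).mono hsub
  have hN2 : ContinuousOn (fun x => ‖normalVec c x‖ ^ 2) (ellipsoid c) := hN.norm.pow 2
  have hN0 : ∀ x ∈ ellipsoid c, ‖normalVec c x‖ ^ 2 ≠ 0 := fun x hx =>
    pow_ne_zero 2 (norm_ne_zero_iff.2 (normalVec_ne_zero hx))
  have hB : ∀ {v : EuclideanSpace ℝ (Fin n) → EuclideanSpace ℝ (Fin n)},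
      ContinuousOn v (ellipsoid c) →
      ContinuousOn (fun x => ambientHessian c U x (v x) (v x)) (ellipsoid c) := fun {v} hv => by
    simp only [ambientHessian_apply]
    exact ((hU2.clm_apply hv).clm_apply hv).sub
      ((((hNc.comp_continuousOn hv).inner hv).div hN2 hN0).smul (hU1.clm_apply hN))
  set b := EuclideanSpace.basisFun (Fin n) ℝ
  have hS : ContinuousOn (fun x => ∑ j, ambientHessian c U x (b j) (b j) -
      (‖normalVec c x‖ ^ 2)⁻¹ • ambientHessian c U x (normalVec c x) (normalVec c x))
      (ellipsoid c) := by
    refine ContinuousOn.sub (continuousOn_finsetSum _ fun j _ => ?_) ?_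
    · exact hB continuousOn_const
    · exact (hN2.inv₀ hN0).smul (hB hN)
  have hNU : ContinuousOn (fun x => normalVec c (U x)) (ellipsoid c) := hNc.comp_continuousOn hU0
  refine ContinuousOn.congr (hS.sub ((((hNU.inner hS).div (hNU.norm.pow 2) fun x hx => ?_)).smul
    hNU)) fun x hx => ?_
  · exact pow_ne_zero 2 (norm_ne_zero_iff.2 (normalVec_ne_zero (hUx x hx)))
  · have hUat : ContDiffAt ℝ 2 U x :=
      (hUO.contDiffAt (hO.mem_nhds (hsub hx))).of_le (WithTop.coe_le_coe.2 le_top)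
    have h := sum_apply_tangentPlane (normalVec_ne_zero hx) (ambientHessian c U x)
    rw [tensionField_eq hUat hx, eq_sub_iff_add_eq.2 h, tangentProj_eq]
    rfl

/-- The chain rule of second order along a curve. -/
theorem fderiv_fderiv_apply_curve {E F : Type*} [NormedAddCommGroup E] [NormedSpace ℝ E]
    [NormedAddCommGroup F] [NormedSpace ℝ F] {U : E → F} {γ γ' : ℝ → E} {Γ Γ' : ℝ → F} {γ'' : E}
    {Γ'' : F} {t : ℝ} (hU : ContDiffAt ℝ 2 U (γ t)) (hγ : ∀ᶠ s in 𝓝 t, HasDerivAt γ (γ' s) s)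
    (hγ' : HasDerivAt γ' γ'' t) (hΓ : ∀ᶠ s in 𝓝 t, HasDerivAt Γ (Γ' s) s)
    (hΓ' : HasDerivAt Γ' Γ'' t) (h : ∀ᶠ s in 𝓝 t, U (γ s) = Γ s) :
    fderiv ℝ U (γ t) (γ' t) = Γ' t ∧
      fderiv ℝ (fderiv ℝ U) (γ t) (γ' t) (γ' t) + fderiv ℝ U (γ t) γ'' = Γ'' := by
  have hc : ContinuousAt γ t := hγ.self_of_nhds.continuousAt
  have hUev : ∀ᶠ s in 𝓝 t, DifferentiableAt ℝ U (γ s) :=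
    hc.eventually ((hU.eventually (by simp)).mono fun y hy => hy.differentiableAt (by norm_num))
  have h1 : ∀ᶠ s in 𝓝 t, fderiv ℝ U (γ s) (γ' s) = Γ' s := by
    filter_upwards [hγ, hΓ, h.eventually_nhds, hUev] with s h1 h2 h3 h4
    have h5 := (h4.hasFDerivAt.comp_hasDerivAt s h1)
    exact (h5.congr_of_eventuallyEq (h3.mono fun y hy => hy.symm)).unique h2
  have hU1 : DifferentiableAt ℝ (fderiv ℝ U) (γ t) :=
    (hU.fderiv_right (m := 1) (by norm_num)).differentiableAt (by norm_num)
  have h2 := (hU1.hasFDerivAt.comp_hasDerivAt t hγ.self_of_nhds).clm_apply hγ'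
  exact ⟨h1.self_of_nhds,
    (h2.congr_of_eventuallyEq (h1.mono fun y hy => hy.symm)).unique hΓ'⟩

end TensionField

/-! ### Great circles and eigenmaps -/

section Sphere

open Set Filter Topology
open scoped InnerProductSpace

variable {k : ℕ}

@[simp] theorem normalVec_sphereWeights (x : EuclideanSpace ℝ (Fin k)) :
    normalVec (sphereWeights k) x = x := by
  ext i; simp [normalVec, sphereWeights]

theorem mem_sphere_iff {x : EuclideanSpace ℝ (Fin k)} :
    x ∈ ellipsoid (sphereWeights k) ↔ ‖x‖ = 1 := by
  rw [ellipsoid_sphereWeights, mem_sphere_zero_iff_norm]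

/-- The great circle through `θ` in the direction `η`. -/
noncomputable def greatCircle (θ η : EuclideanSpace ℝ (Fin k)) (t : ℝ) : EuclideanSpace ℝ (Fin k) :=
  Real.cos t • θ + Real.sin t • η

@[simp] theorem greatCircle_zero (θ η : EuclideanSpace ℝ (Fin k)) : greatCircle θ η 0 = θ := by
  simp [greatCircle]

theorem hasDerivAt_greatCircle (θ η : EuclideanSpace ℝ (Fin k)) (t : ℝ) :
    HasDerivAt (greatCircle θ η) (greatCircle η (-θ) t) t := by
  have h := ((Real.hasDerivAt_cos t).smul_const θ).add ((Real.hasDerivAt_sin t).smul_const η)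
  refine h.congr_deriv ?_
  simp only [greatCircle]
  rw [neg_smul, smul_neg, add_comm]

theorem norm_greatCircle {θ η : EuclideanSpace ℝ (Fin k)} (hθ : ‖θ‖ = 1) (hη : ‖η‖ = 1)
    (h : ⟪θ, η⟫_ℝ = 0) (t : ℝ) : ‖greatCircle θ η t‖ = 1 := by
  have h1 : ‖greatCircle θ η t‖ ^ 2 = 1 := by
    rw [greatCircle, norm_add_sq_real, norm_smul, norm_smul, hθ, hη, inner_smul_left,
      inner_smul_right, h]
    simp [Real.cos_sq_add_sin_sq]
  exact (pow_eq_one_iff_of_nonneg (norm_nonneg _) two_ne_zero).1 h1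

/-- The members of the standard orthonormal basis of a tangent space of the sphere. -/
theorem norm_stdOrthonormalBasis_tangentPlane {θ : EuclideanSpace ℝ (Fin k)} (i) :
    ‖(stdOrthonormalBasis ℝ (tangentPlane (sphereWeights k) θ) i : EuclideanSpace ℝ (Fin k))‖ = 1 ∧
      ⟪θ, (stdOrthonormalBasis ℝ (tangentPlane (sphereWeights k) θ) i :
        EuclideanSpace ℝ (Fin k))⟫_ℝ = 0 := by
  refine ⟨(stdOrthonormalBasis ℝ (tangentPlane (sphereWeights k) θ)).orthonormal.1 i, ?_⟩
  have := inner_normalVec_of_mem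
    (stdOrthonormalBasis ℝ (tangentPlane (sphereWeights k) θ) i).2
  rwa [normalVec_sphereWeights] at this

theorem finrank_tangentPlane_sphere {θ : EuclideanSpace ℝ (Fin k)} (hθ : ‖θ‖ = 1) :
    (Module.finrank ℝ (tangentPlane (sphereWeights k) θ) : ℝ) = k - 1 := by
  have h := Submodule.finrank_add_finrank_orthogonal (K := Submodule.span ℝ {θ})
  have hθ0 : θ ≠ 0 := by rintro rfl; simp at hθ
  rw [finrank_span_singleton hθ0, finrank_euclideanSpace, Fintype.card_fin] at h
  have h' : Module.finrank ℝ (tangentPlane (sphereWeights k) θ) =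
      Module.finrank ℝ (Submodule.span ℝ {θ})ᗮ := by
    rw [tangentPlane, normalVec_sphereWeights]
  rw [h']
  have : (1 + Module.finrank ℝ (Submodule.span ℝ {θ})ᗮ : ℝ) = k := by exact_mod_cast h
  linarith

variable {χ : ellipsoid (sphereWeights k) → ellipsoid (sphereWeights k)}
  {U : EuclideanSpace ℝ (Fin k) → EuclideanSpace ℝ (Fin k)}

theorem IsSmoothExtension.contDiffAt {n : ℕ} {c : Fin n → ℝ} {u : ellipsoid c → ellipsoid c}
    {U : EuclideanSpace ℝ (Fin n) → EuclideanSpace ℝ (Fin n)} (hU : IsSmoothExtension c u U)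
    {x : EuclideanSpace ℝ (Fin n)} (hx : x ∈ ellipsoid c) : ContDiffAt ℝ ∞ U x := by
  obtain ⟨⟨O, hO, hsub, hUO⟩, -⟩ := hU
  exact hUO.contDiffAt (hO.mem_nhds (hsub hx))

/-- The second derivative of a map of the sphere along a great circle. -/
theorem hasDerivAt_comp_greatCircle (hU : IsSmoothExtension (sphereWeights k) χ U)
    {θ η : EuclideanSpace ℝ (Fin k)} (hθ : ‖θ‖ = 1) (hη : ‖η‖ = 1) (h : ⟪θ, η⟫_ℝ = 0) :
    (∀ t, HasDerivAt (fun t => U (greatCircle θ η t))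
      (fderiv ℝ U (greatCircle θ η t) (greatCircle η (-θ) t)) t) ∧
    HasDerivAt (fun t => fderiv ℝ U (greatCircle θ η t) (greatCircle η (-θ) t))
      (ambientHessian (sphereWeights k) U θ η η) 0 := by
  have hUat : ∀ t, ContDiffAt ℝ 2 U (greatCircle θ η t) := fun t =>
    (hU.contDiffAt (mem_sphere_iff.2 (norm_greatCircle hθ hη h t))).of_le
      (WithTop.coe_le_coe.2 le_top)
  refine ⟨fun t => ((hUat t).differentiableAt (by norm_num)).hasFDerivAt.comp_hasDerivAt t
    (hasDerivAt_greatCircle θ η t), ?_⟩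
  have hU1 : DifferentiableAt ℝ (fderiv ℝ U) (greatCircle θ η 0) :=
    ((hUat 0).fderiv_right (m := 1) (by norm_num)).differentiableAt (by norm_num)
  refine ((hU1.hasFDerivAt.comp_hasDerivAt 0 (hasDerivAt_greatCircle θ η 0)).clm_apply
    (hasDerivAt_greatCircle η (-θ) 0)).congr_deriv ?_
  simp only [greatCircle_zero, Function.comp_apply]
  rw [ambientHessian_apply]
  simp [hθ, hη, sub_eq_add_neg]

/-- The Laplacian of an eigenmap of the sphere, written as a map to the ambient space. -/
theorem sum_ambientHessian_eigenmap {ev : ℝ} (hU : IsSmoothExtension (sphereWeights k) χ U)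
    (ht : ∀ x ∈ ellipsoid (sphereWeights k), tensionField (sphereWeights k) U x = 0)
    (he : ∀ x ∈ ellipsoid (sphereWeights k), normSqDiff (sphereWeights k) U x = ev)
    {θ : EuclideanSpace ℝ (Fin k)} (hθ : ‖θ‖ = 1) :
    ∑ i, ambientHessian (sphereWeights k) U θ
        (stdOrthonormalBasis ℝ (tangentPlane (sphereWeights k) θ) i)
        (stdOrthonormalBasis ℝ (tangentPlane (sphereWeights k) θ) i) = -ev • U θ := by
  have hθS := mem_sphere_iff.2 hθ
  have hUn : ∀ x : EuclideanSpace ℝ (Fin k), ‖x‖ = 1 → ‖U x‖ = 1 := fun x hx => by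
    rw [hU.2 ⟨x, mem_sphere_iff.2 hx⟩]
    exact mem_sphere_iff.1 (Subtype.mem _)
  have h1 := ht θ hθS
  rw [tensionField_eq ((hU.contDiffAt hθS).of_le (WithTop.coe_le_coe.2 le_top)) hθS,
    tangentProj_eq, normalVec_sphereWeights, hUn θ hθ, sub_eq_zero] at h1
  rw [h1]
  congr 1
  rw [one_pow, div_one, inner_sum, ← he θ hθS, normSqDiff, ← Finset.sum_neg_distrib]
  refine Finset.sum_congr rfl fun i _ => ?_
  set η : EuclideanSpace ℝ (Fin k) :=
    (stdOrthonormalBasis ℝ (tangentPlane (sphereWeights k) θ) i : EuclideanSpace ℝ (Fin k)) with hη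
  obtain ⟨hη1, hη0⟩ := norm_stdOrthonormalBasis_tangentPlane (θ := θ) i
  rw [← hη] at hη1 hη0
  obtain ⟨hd1, hd2⟩ := hasDerivAt_comp_greatCircle hU hθ hη1 hη0
  set Γ := fun t => U (greatCircle θ η t) with hΓ
  set Γ' := fun t => fderiv ℝ U (greatCircle θ η t) (greatCircle η (-θ) t) with hΓ'
  -- Differentiate `|Γ|² = 1` twice.
  have h2 : ∀ t, ⟪Γ t, Γ' t⟫_ℝ = 0 := fun t => by
    have e1 := (hd1 t).inner ℝ (hd1 t)
    have e2 : (fun t => ⟪Γ t, Γ t⟫_ℝ) = fun _ => 1 := funext fun t => by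
      rw [real_inner_self_eq_norm_sq, hΓ]
      simp [hUn _ (norm_greatCircle hθ hη1 hη0 t)]
    rw [e2] at e1
    have e3 := e1.unique (hasDerivAt_const t (1 : ℝ))
    rw [real_inner_comm (Γ t)] at e3
    linarith
  have e1 := (hd1 0).inner ℝ hd2
  rw [show (fun t => ⟪Γ t, Γ' t⟫_ℝ) = fun _ => 0 from funext h2] at e1
  have e3 := e1.unique (hasDerivAt_const 0 (0 : ℝ))
  rw [show Γ 0 = U θ by simp [hΓ], show Γ' 0 = fderiv ℝ U θ η by simp [hΓ']] at e3
  simp only [greatCircle_zero] at e3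
  rw [real_inner_self_eq_norm_sq] at e3
  linarith

end Sphere

/-! ### Homogeneous harmonic functions -/

section Removability

open Set Filter Topology MeasureTheory
open scoped InnerProductSpace

variable {k : ℕ}

theorem fderiv_apply_self_of_homogeneous {E F : Type*} [NormedAddCommGroup E] [NormedSpace ℝ E]
    [NormedAddCommGroup F] [NormedSpace ℝ F] {g : E → F} {d : ℕ} {x : E}
    (hg : DifferentiableAt ℝ g x) (hhom : ∀ r : ℝ, 0 < r → g (r • x) = r ^ d • g x) :
    fderiv ℝ g x x = (d : ℝ) • g x := by
  have h1 : HasDerivAt (fun r : ℝ => r • x) x 1 := by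
    simpa using (hasDerivAt_id (1 : ℝ)).smul_const x
  have hg' : HasFDerivAt g (fderiv ℝ g x) ((1 : ℝ) • x) := by rw [one_smul]; exact hg.hasFDerivAt
  have h2 := hg'.comp_hasDerivAt 1 h1
  have h3 : HasDerivAt (fun r : ℝ => r ^ d • g x) ((d : ℝ) • g x) 1 := by
    simpa using (hasDerivAt_pow d (1 : ℝ)).smul_const (g x)
  refine (h2.congr_of_eventuallyEq ?_).unique h3
  filter_upwards [lt_mem_nhds (zero_lt_one : (0 : ℝ) < 1)] with r hr using (hhom r hr).symm

theorem sum_apply_basisFun_mul (L : EuclideanSpace ℝ (Fin k) →L[ℝ] ℝ)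
    (x : EuclideanSpace ℝ (Fin k)) :
    ∑ i, ⟪x, EuclideanSpace.basisFun (Fin k) ℝ i⟫_ℝ * L (EuclideanSpace.basisFun (Fin k) ℝ i) =
      L x := by
  conv_rhs => rw [← (EuclideanSpace.basisFun (Fin k) ℝ).sum_repr' x]
  rw [map_sum]
  refine Finset.sum_congr rfl fun i _ => ?_
  rw [map_smul, smul_eq_mul, real_inner_comm]

/-- A harmonic function that is homogeneous of degree zero has vanishing gradient: multiply
`Δ g = 0` by `η g` with a radial cut-off `η` and integrate by parts; the cross term vanishes since
`∇η` is radial and `∇g` is orthogonal to the radial direction. -/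
theorem fderiv_eq_zero_of_homogeneous_zero {g : EuclideanSpace ℝ (Fin k) → ℝ}
    (hg : ContDiffOn ℝ ∞ g {0}ᶜ) (hhom : ∀ r : ℝ, 0 < r → ∀ x, x ≠ 0 → g (r • x) = g x)
    (hharm : ∀ x, x ≠ 0 → ∑ i, fderiv ℝ (fderiv ℝ g) x (EuclideanSpace.basisFun (Fin k) ℝ i)
      (EuclideanSpace.basisFun (Fin k) ℝ i) = 0) {x₀ : EuclideanSpace ℝ (Fin k)} (hx₀ : x₀ ≠ 0) :
    fderiv ℝ g x₀ = 0 := by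
  set e := EuclideanSpace.basisFun (Fin k) ℝ with he
  have hgat : ∀ x, x ≠ 0 → ContDiffAt ℝ ∞ g x := fun x hx =>
    hg.contDiffAt (isOpen_compl_singleton.mem_nhds hx)
  set ρ := ‖x₀‖ ^ 2 with hρ
  have hρ0 : 0 < ρ := by have := norm_pos_iff.2 hx₀; positivity
  let β : ContDiffBump ρ := ⟨ρ / 2, 3 * ρ / 4, by linarith, by linarith⟩
  let b : ContDiffBump ρ := ⟨ρ / 8, ρ / 4, by linarith, by linarith⟩
  set G : EuclideanSpace ℝ (Fin k) → ℝ := fun x => β (‖x‖ ^ 2) * g x with hG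
  set η : EuclideanSpace ℝ (Fin k) → ℝ := fun x => b (‖x‖ ^ 2) with hη
  have hns : ContDiff ℝ ∞ fun x : EuclideanSpace ℝ (Fin k) => ‖x‖ ^ 2 := contDiff_norm_sq ℝ
  have hGs : ContDiff ℝ ∞ G := by
    rw [contDiff_iff_contDiffAt]
    intro x
    rcases eq_or_ne x 0 with rfl | hx
    · have h1 : ∀ᶠ y : EuclideanSpace ℝ (Fin k) in 𝓝 0, ‖y‖ ^ 2 < ρ / 4 :=
        hns.continuous.continuousAt.eventually_lt_const (by simpa using hρ0)
      refine (contDiffAt_const (c := (0 : ℝ))).congr_of_eventuallyEq ?_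
      filter_upwards [h1] with y hy
      have : β (‖y‖ ^ 2) = 0 := β.zero_of_le_dist (by
        rw [Real.dist_eq, abs_sub_comm]
        exact le_trans (by change 3 * ρ / 4 ≤ _; linarith) (le_abs_self _))
      simp only [hG, this, zero_mul]
    · exact (β.contDiff.comp hns).contDiffAt.mul (hgat x hx)
  have hηs : ContDiff ℝ ∞ η := b.contDiff.comp hns
  have hηc : HasCompactSupport η := by
    refine HasCompactSupport.intro (isCompact_closedBall 0 (‖x₀‖ * 2)) fun x hx => ?_
    rw [mem_closedBall_zero_iff, not_le] at hx
    refine b.zero_of_le_dist ?_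
    have h1 : (‖x₀‖ * 2) ^ 2 < ‖x‖ ^ 2 := by gcongr
    rw [Real.dist_eq]
    refine le_trans ?_ (le_abs_self _)
    change ρ / 4 ≤ _
    rw [mul_pow, ← hρ] at h1
    linarith
  -- Near each point either `G = g` or `η = 0`.
  have hcase : ∀ x, (x ≠ 0 ∧ G =ᶠ[𝓝 x] g) ∨ η =ᶠ[𝓝 x] fun _ => 0 := fun x => by
    rcases lt_or_ge (dist (‖x‖ ^ 2) ρ) (ρ / 2) with h | h
    · left
      refine ⟨?_, ?_⟩
      · rintro rfl
        rw [norm_zero, Real.dist_eq, abs_sub_comm] at h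
        have := le_abs_self (ρ - 0 ^ 2)
        norm_num at this h
        linarith
      · have h1 : ∀ᶠ y : EuclideanSpace ℝ (Fin k) in 𝓝 x, dist (‖y‖ ^ 2) ρ < ρ / 2 :=
          ((hns.continuous.dist continuous_const).continuousAt).eventually_lt_const h
        filter_upwards [h1] with y hy
        have : β (‖y‖ ^ 2) = 1 := β.one_of_mem_closedBall (Metric.mem_closedBall.2 hy.le)
        simp only [hG, this, one_mul]
    · right
      have h1 : ∀ᶠ y : EuclideanSpace ℝ (Fin k) in 𝓝 x, ρ / 4 < dist (‖y‖ ^ 2) ρ :=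
        ((hns.continuous.dist continuous_const).continuousAt).eventually_const_lt (by linarith)
      filter_upwards [h1] with y hy using b.zero_of_le_dist hy.le
  have hG1 : ∀ i, ContDiff ℝ ∞ fun x => fderiv ℝ G x (e i) := fun i =>
    (hGs.fderiv_right (m := ∞) (by simp)).clm_apply contDiff_const
  have hG2 : ∀ i x, fderiv ℝ (fun x => fderiv ℝ G x (e i)) x (e i) =
      fderiv ℝ (fderiv ℝ G) x (e i) (e i) := fun i x => by
    have h1 : DifferentiableAt ℝ (fderiv ℝ G) x :=
      ((hGs.fderiv_right (m := ∞) (by simp)).differentiable (by simp)) x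
    rw [fderiv_clm_apply h1 (differentiableAt_const _)]
    simp
  have hw : ContDiff ℝ ∞ fun x => η x * G x := hηs.mul hGs
  have hwc : HasCompactSupport fun x => η x * G x := hηc.mul_right
  have hwi : ∀ i, Continuous fun x => fderiv ℝ (fun x => η x * G x) x (e i) := fun i =>
    ((hw.fderiv_right (m := ∞) (by simp)).clm_apply contDiff_const).continuous
  have hw1 : ∀ i, HasCompactSupport fun x => fderiv ℝ (fun x => η x * G x) x (e i) := fun i =>
    hwc.fderiv_apply ℝ (e i)
  have hint1 : ∀ i, Integrable fun x => fderiv ℝ (fun x => η x * G x) x (e i) *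
      fderiv ℝ G x (e i) := fun i =>
    ((hwi i).mul (hG1 i).continuous).integrable_of_hasCompactSupport (hw1 i).mul_right
  have hint2 : ∀ i, Integrable fun x => (η x * G x) *
      fderiv ℝ (fun x => fderiv ℝ G x (e i)) x (e i) := fun i =>
    (hw.continuous.mul (((hG1 i).fderiv_right (m := ∞) (by simp)).clm_apply
      contDiff_const).continuous).integrable_of_hasCompactSupport hwc.mul_right
  have hparts : ∀ i, ∫ x, (η x * G x) * fderiv ℝ (fun x => fderiv ℝ G x (e i)) x (e i) =
      -∫ x, fderiv ℝ (fun x => η x * G x) x (e i) * fderiv ℝ G x (e i) := fun i =>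
    integral_mul_fderiv_eq_neg_fderiv_mul_of_integrable (hint1 i) (hint2 i)
      ((hw.continuous.mul (hG1 i).continuous).integrable_of_hasCompactSupport hwc.mul_right)
      (fun x _ => (hw.differentiable (by simp)) x) fun x _ => ((hG1 i).differentiable (by simp)) x
  have hsum1 : ∑ i, ∫ x, (η x * G x) * fderiv ℝ (fun x => fderiv ℝ G x (e i)) x (e i) = 0 := by
    rw [← integral_finsetSum _ fun i _ => hint2 i, ← integral_zero (EuclideanSpace ℝ (Fin k)) ℝ]
    congr 1
    ext x
    rw [← Finset.mul_sum]
    rcases hcase x with ⟨hx, h⟩ | h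
    · simp only [hG2, h.fderiv.fderiv_eq]
      rw [hharm x hx, mul_zero]
    · rw [h.self_of_nhds, zero_mul, zero_mul]
  have hpt : ∀ x, ∑ i, fderiv ℝ (fun x => η x * G x) x (e i) * fderiv ℝ G x (e i) =
      η x * ∑ i, fderiv ℝ G x (e i) ^ 2 := fun x => by
    rcases hcase x with ⟨hx, h⟩ | h
    · have h1 : fderiv ℝ (fun x => η x * G x) x = η x • fderiv ℝ G x + G x • fderiv ℝ η x :=
        fderiv_fun_mul ((hηs.differentiable (by simp)) x) ((hGs.differentiable (by simp)) x)
      have h2 : ∀ v, fderiv ℝ η x v = deriv b (‖x‖ ^ 2) * (2 * ⟪x, v⟫_ℝ) := fun v => by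
        have hb : HasDerivAt b (deriv b (‖x‖ ^ 2)) (‖x‖ ^ 2) :=
          ((b.contDiff (n := 1)).differentiable (by simp) _).hasDerivAt
        have h3 : HasFDerivAt (fun x : EuclideanSpace ℝ (Fin k) => ‖x‖ ^ 2) _ x :=
          (hasFDerivAt_id x).norm_sq
        have h3' : HasFDerivAt η _ x :=
          HasDerivAt.comp_hasFDerivAt (h₂ := b) (f := fun x => ‖x‖ ^ 2) x hb h3
        rw [h3'.fderiv]
        simp
      have h4 : fderiv ℝ G x x = 0 := by
        rw [h.fderiv_eq, fderiv_apply_self_of_homogeneous (d := 0)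
          ((hgat x hx).differentiableAt (by simp))
          (fun r hr => by rw [hhom r hr x hx, pow_zero, one_smul])]
        simp
      have h5 := sum_apply_basisFun_mul (fderiv ℝ G x) x
      rw [h4] at h5
      have h6 : ∀ i, fderiv ℝ (fun x => η x * G x) x (e i) * fderiv ℝ G x (e i) =
          η x * fderiv ℝ G x (e i) ^ 2 + (2 * G x * deriv b (‖x‖ ^ 2)) *
            (⟪x, e i⟫_ℝ * fderiv ℝ G x (e i)) := fun i => by
        rw [h1]
        simp only [add_apply, smul_apply, smul_eq_mul, h2]
        ring
      simp only [h6]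
      rw [Finset.sum_add_distrib, ← Finset.mul_sum, ← Finset.mul_sum, h5, mul_zero, add_zero]
    · have h1 : (fun x => η x * G x) =ᶠ[𝓝 x] fun _ => 0 := by
        filter_upwards [h] with y hy
        rw [hy, zero_mul]
      rw [h.self_of_nhds, h1.fderiv_eq]
      simp
  have hzero : ∫ x, η x * ∑ i, fderiv ℝ G x (e i) ^ 2 = 0 := by
    have h1 := hsum1
    simp only [hparts] at h1
    rw [Finset.sum_neg_distrib, neg_eq_zero, ← integral_finsetSum _ fun i _ => hint1 i] at h1
    simpa only [hpt] using h1
  have hcont : Continuous fun x => η x * ∑ i, fderiv ℝ G x (e i) ^ 2 :=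
    hηs.continuous.mul (continuous_finsetSum _ fun i _ => (hG1 i).continuous.pow 2)
  have hnonneg : ∀ x, 0 ≤ η x * ∑ i, fderiv ℝ G x (e i) ^ 2 := fun x =>
    mul_nonneg b.nonneg (Finset.sum_nonneg fun i _ => sq_nonneg _)
  have hae := (integral_eq_zero_iff_of_nonneg hnonneg
    (hcont.integrable_of_hasCompactSupport hηc.mul_right)).1 hzero
  have hall := (Continuous.ae_eq_iff_eq volume hcont continuous_const).1 hae
  have hx := congrFun hall x₀
  have hη1 : η x₀ = 1 := b.one_of_mem_closedBall (by
    rw [← hρ]; exact Metric.mem_closedBall_self (by change 0 ≤ ρ / 8; positivity))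
  have hGg : G =ᶠ[𝓝 x₀] g := (hcase x₀).elim (fun h => h.2) fun h => by
    have := h.self_of_nhds
    rw [hη1] at this
    exact absurd this one_ne_zero
  simp only [hη1, one_mul] at hx
  have hx' := (Finset.sum_eq_zero_iff_of_nonneg fun i _ => sq_nonneg _).1 hx
  ext v
  rw [← hGg.fderiv_eq, ← sum_apply_basisFun_mul]
  refine Finset.sum_eq_zero fun i hi => ?_
  rw [pow_eq_zero_iff two_ne_zero |>.1 (hx' i hi), mul_zero]

/-- A function on the punctured space that is harmonic and homogeneous of degree `d` extends
smoothly to the origin (it is a harmonic polynomial). The partial derivatives are of the same kind,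
of degree `d - 1`, and Euler's identity recovers the function from them. -/
theorem exists_contDiff_of_homogeneous_harmonic (hk : 2 ≤ k) (d : ℕ) :
    ∀ g : EuclideanSpace ℝ (Fin k) → ℝ, ContDiffOn ℝ ∞ g {0}ᶜ →
      (∀ r : ℝ, 0 < r → ∀ x, x ≠ 0 → g (r • x) = r ^ d * g x) →
      (∀ x, x ≠ 0 → ∑ i, fderiv ℝ (fderiv ℝ g) x (EuclideanSpace.basisFun (Fin k) ℝ i)
        (EuclideanSpace.basisFun (Fin k) ℝ i) = 0) →
      ∃ G : EuclideanSpace ℝ (Fin k) → ℝ, ContDiff ℝ ∞ G ∧ ∀ x, x ≠ 0 → G x = g x := by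
  set e := EuclideanSpace.basisFun (Fin k) ℝ with he
  induction d with
  | zero =>
    intro g hg hhom hharm
    have hconn : IsPreconnected ({0}ᶜ : Set (EuclideanSpace ℝ (Fin k))) := by
      refine (isConnected_compl_singleton_of_one_lt_rank ?_ 0).isPreconnected
      rw [← Module.finrank_eq_rank, finrank_euclideanSpace, Fintype.card_fin]
      exact_mod_cast hk
    obtain ⟨a, ha⟩ := isOpen_compl_singleton.exists_is_const_of_fderiv_eq_zero hconn
      (hg.differentiableOn (by simp)) fun x hx =>
        fderiv_eq_zero_of_homogeneous_zero hg (fun r hr x hx => by simpa using hhom r hr x hx)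
          hharm hx
    exact ⟨fun _ => a, contDiff_const, fun x hx => (ha x hx).symm⟩
  | succ d ih =>
    intro g hg hhom hharm
    have hopen : IsOpen ({0}ᶜ : Set (EuclideanSpace ℝ (Fin k))) := isOpen_compl_singleton
    have hD : ContDiffOn ℝ ∞ (fderiv ℝ g) {0}ᶜ := hg.fderiv_of_isOpen hopen (by simp)
    have hD2 : ContDiffOn ℝ ∞ (fderiv ℝ (fderiv ℝ g)) {0}ᶜ := hD.fderiv_of_isOpen hopen (by simp)
    have hat : ∀ {F : Type} [NormedAddCommGroup F] [NormedSpace ℝ F]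
        {h : EuclideanSpace ℝ (Fin k) → F}, ContDiffOn ℝ ∞ h {0}ᶜ → ∀ x, x ≠ 0 →
        ContDiffAt ℝ ∞ h x := fun h x hx => h.contDiffAt (hopen.mem_nhds hx)
    have hsymm1 : ∀ x, x ≠ 0 → ∀ v w, fderiv ℝ (fderiv ℝ g) x v w = fderiv ℝ (fderiv ℝ g) x w v :=
      fun x hx v w => ((hat hg x hx).isSymmSndFDerivAt
        (by rw [minSmoothness_of_isRCLikeNormedField]; exact WithTop.coe_le_coe.2 le_top)).eq v w
    have hsymm2 : ∀ x, x ≠ 0 → ∀ v w, fderiv ℝ (fderiv ℝ (fderiv ℝ g)) x v w =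
        fderiv ℝ (fderiv ℝ (fderiv ℝ g)) x w v :=
      fun x hx v w => ((hat hD x hx).isSymmSndFDerivAt
        (by rw [minSmoothness_of_isRCLikeNormedField]; exact WithTop.coe_le_coe.2 le_top)).eq v w
    have hex : ∀ i, ∃ G : EuclideanSpace ℝ (Fin k) → ℝ, ContDiff ℝ ∞ G ∧
        ∀ x, x ≠ 0 → G x = fderiv ℝ g x (e i) := by
      intro i
      refine ih (fun x => fderiv ℝ g x (e i)) (hD.clm_apply contDiffOn_const) ?_ ?_
      · intro r hr x hx
        have hrx : r • x ≠ 0 := smul_ne_zero hr.ne' hx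
        have h1 : HasFDerivAt (fun y => g (r • y)) _ x :=
          ((hat hg _ hrx).differentiableAt (by simp)).hasFDerivAt.comp x
            ((hasFDerivAt_id x).const_smul r)
        have h2 : HasFDerivAt (fun y => r ^ (d + 1) * g y) _ x :=
          ((hat hg x hx).differentiableAt (by simp)).hasFDerivAt.const_mul (r ^ (d + 1))
        have h3 : (fun y => g (r • y)) =ᶠ[𝓝 x] fun y => r ^ (d + 1) * g y := by
          filter_upwards [hopen.mem_nhds hx] with y hy using hhom r hr y hy
        have h4 := DFunLike.congr_fun ((h1.congr_of_eventuallyEq h3.symm).unique h2) (e i)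
        simp only [ContinuousLinearMap.comp_apply, smul_apply, ContinuousLinearMap.id_apply,
          map_smul, smul_eq_mul, pow_succ] at h4
        have h5 : r * fderiv ℝ g (r • x) (e i) = r * (r ^ d * fderiv ℝ g x (e i)) := by
          rw [h4]; ring
        exact mul_left_cancel₀ hr.ne' h5
      · intro x hx
        have hev : fderiv ℝ (fun y => fderiv ℝ g y (e i)) =ᶠ[𝓝 x]
            fun y => fderiv ℝ (fderiv ℝ g) y (e i) := by
          filter_upwards [hopen.mem_nhds hx] with y hy
          ext v
          rw [fderiv_clm_apply ((hat hD y hy).differentiableAt (by simp))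
            (differentiableAt_const _)]
          simpa using hsymm1 y hy v (e i)
        have hD2x : DifferentiableAt ℝ (fderiv ℝ (fderiv ℝ g)) x :=
          (hat hD2 x hx).differentiableAt (by simp)
        have h1 : ∀ j, fderiv ℝ (fderiv ℝ (fun y => fderiv ℝ g y (e i))) x (e j) (e j) =
            fderiv ℝ (fderiv ℝ (fderiv ℝ g)) x (e i) (e j) (e j) := fun j => by
          rw [hev.fderiv_eq, fderiv_clm_apply hD2x (differentiableAt_const _), hsymm2 x hx (e i)]
          simp
        simp only [h1]
        have h2 : HasFDerivAt (fun y => ∑ j, fderiv ℝ (fderiv ℝ g) y (e j) (e j)) _ x :=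
          HasFDerivAt.fun_sum fun j _ =>
            (hD2x.hasFDerivAt.clm_apply (hasFDerivAt_const (e j) x)).clm_apply
              (hasFDerivAt_const (e j) x)
        have h3 : (fun y => ∑ j, fderiv ℝ (fderiv ℝ g) y (e j) (e j)) =ᶠ[𝓝 x] fun _ => 0 := by
          filter_upwards [hopen.mem_nhds hx] with y hy using hharm y hy
        have h4 := DFunLike.congr_fun
          ((h2.congr_of_eventuallyEq h3.symm).unique (hasFDerivAt_const 0 x)) (e i)
        simpa using h4
    choose G hGs hGe using hex
    refine ⟨fun x => ((d : ℝ) + 1)⁻¹ * ∑ i, ⟪x, e i⟫_ℝ * G i x, ?_, fun x hx => ?_⟩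
    · exact contDiff_const.mul (ContDiff.sum fun i _ =>
        (contDiff_id.inner ℝ contDiff_const).mul (hGs i))
    · simp only [hGe _ x hx]
      rw [sum_apply_basisFun_mul, fderiv_apply_self_of_homogeneous (d := d + 1)
        ((hat hg x hx).differentiableAt (by simp)) fun r hr => hhom r hr x hx]
      push_cast
      rw [smul_eq_mul, inv_mul_cancel_left₀ (by positivity)]

end Removability

/-! ### The homogeneous extension of an eigenmap -/

section SolidExtension

open Set Filter Topology
open scoped InnerProductSpace

variable {k : ℕ} {χ : ellipsoid (sphereWeights k) → ellipsoid (sphereWeights k)}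
  {U : EuclideanSpace ℝ (Fin k) → EuclideanSpace ℝ (Fin k)}

theorem contDiffAt_comp_normalize (hU : IsSmoothExtension (sphereWeights k) χ U)
    {x : EuclideanSpace ℝ (Fin k)} (hx : x ≠ 0) :
    ContDiffAt ℝ ∞ (fun y : EuclideanSpace ℝ (Fin k) => U (‖y‖⁻¹ • y)) x := by
  have hmem : ‖x‖⁻¹ • x ∈ ellipsoid (sphereWeights k) :=
    mem_sphere_iff.2 (norm_smul_inv_norm (𝕜 := ℝ) hx)
  have h1 : ContDiffAt ℝ ∞ (fun y : EuclideanSpace ℝ (Fin k) => ‖y‖⁻¹ • y) x :=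
    ((contDiffAt_norm ℝ hx).inv (norm_ne_zero_iff.2 hx)).smul contDiffAt_id
  exact ContDiffAt.comp (g := U) x (hU.contDiffAt hmem) h1

/-- The components of the extension of an eigenmap that is homogeneous of degree `d` are
harmonic. -/
theorem harmonic_homogeneous_extension {d : ℕ} (hU : IsSmoothExtension (sphereWeights k) χ U)
    (ht : ∀ x ∈ ellipsoid (sphereWeights k), tensionField (sphereWeights k) U x = 0)
    (he : ∀ x ∈ ellipsoid (sphereWeights k), normSqDiff (sphereWeights k) U x =
      (d : ℝ) * ((d : ℝ) + (k : ℝ) - 2))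
    (i : Fin k) {x : EuclideanSpace ℝ (Fin k)} (hx : x ≠ 0) :
    ∑ j, fderiv ℝ (fderiv ℝ fun y : EuclideanSpace ℝ (Fin k) => ‖y‖ ^ d * U (‖y‖⁻¹ • y) i) x
      (EuclideanSpace.basisFun (Fin k) ℝ j) (EuclideanSpace.basisFun (Fin k) ℝ j) = 0 := by
  set g : EuclideanSpace ℝ (Fin k) → ℝ := fun y => ‖y‖ ^ d * U (‖y‖⁻¹ • y) i with hg
  set R := ‖x‖ with hR
  have hR0 : 0 < R := norm_pos_iff.2 hx
  set θ := R⁻¹ • x with hθdef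
  have hθ : ‖θ‖ = 1 := norm_smul_inv_norm (𝕜 := ℝ) hx
  have hθ0 : θ ≠ 0 := by rw [← norm_ne_zero_iff, hθ]; exact one_ne_zero
  have hxθ : R • θ = x := by rw [hθdef, smul_inv_smul₀ hR0.ne']
  have hgr : ∀ r : ℝ, 0 < r → ∀ ζ : EuclideanSpace ℝ (Fin k), ‖ζ‖ = 1 →
      g (r • ζ) = r ^ d * U ζ i := fun r hr ζ hζ => by
    simp only [hg]
    rw [norm_smul, hζ, mul_one, Real.norm_of_nonneg hr.le, inv_smul_smul₀ hr.ne']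
  have hgx : g x = R ^ d * U θ i := by rw [← hxθ, hgr R hR0 θ hθ]
  have hgat : ContDiffAt ℝ ∞ g x := by
    refine ((contDiffAt_norm ℝ hx).pow d).mul ?_
    exact contDiffAt_euclidean.1 (contDiffAt_comp_normalize hU hx) i
  have hg2 : ContDiffAt ℝ 2 g x := hgat.of_le (WithTop.coe_le_coe.2 le_top)
  have hhom : ∀ r : ℝ, 0 < r → g (r • x) = r ^ d * g x := fun r hr => by
    rw [hgx, ← hxθ, smul_smul, hgr _ (by positivity) θ hθ, mul_pow, mul_assoc]
  have hDx : fderiv ℝ g x x = d * g x := by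
    rw [fderiv_apply_self_of_homogeneous (d := d) (hgat.differentiableAt (by simp)) hhom,
      smul_eq_mul]
  -- Second derivative in the radial direction.
  have hrad : fderiv ℝ (fderiv ℝ g) x x x = d * (d - 1) * g x := by
    have hγ : ∀ t : ℝ, HasDerivAt (fun t : ℝ => (1 + t) • x) x t := fun t => by
      simpa using ((hasDerivAt_id t).const_add 1).smul_const x
    have hΓ : ∀ t : ℝ, HasDerivAt (fun t : ℝ => (1 + t) ^ d * g x)
        ((d * (1 + t) ^ (d - 1)) * g x) t := fun t => by
      simpa using (((hasDerivAt_id t).const_add 1).pow d).mul_const (g x)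
    have hΓ' : HasDerivAt (fun t : ℝ => (d * (1 + t) ^ (d - 1)) * g x)
        (d * (d - 1) * g x) 0 := by
      have h := ((((hasDerivAt_id (0 : ℝ)).const_add 1).pow (d - 1)).const_mul (d : ℝ)).mul_const
        (g x)
      refine h.congr_deriv ?_
      rcases d with _ | d <;> simp
    have h := fderiv_fderiv_apply_curve (U := g) (γ := fun t : ℝ => (1 + t) • x)
      (γ' := fun _ => x) (t := 0) (by simpa using hg2) (Eventually.of_forall hγ)
      (hasDerivAt_const _ _) (Eventually.of_forall hΓ) hΓ' (by
        filter_upwards [lt_mem_nhds (show (-1 : ℝ) < 0 by norm_num)] with t ht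
        exact hhom _ (by linarith))
    simpa using h.2
  set b := stdOrthonormalBasis ℝ (tangentPlane (sphereWeights k) θ) with hb
  -- Second derivatives in the tangential directions, along great circles.
  have htan : ∀ j, R ^ 2 * fderiv ℝ (fderiv ℝ g) x (b j) (b j) =
      R ^ d * ambientHessian (sphereWeights k) U θ (b j) (b j) i + d * g x := fun j => by
    obtain ⟨hη1, hη0⟩ := norm_stdOrthonormalBasis_tangentPlane (θ := θ) j
    obtain ⟨hd1, hd2⟩ := hasDerivAt_comp_greatCircle hU hθ hη1 hη0
    have hpr : ∀ {c : ℝ → EuclideanSpace ℝ (Fin k)} {c' : EuclideanSpace ℝ (Fin k)} {t : ℝ},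
        HasDerivAt c c' t → HasDerivAt (fun t => R ^ d * c t i) (R ^ d * c' i) t :=
      fun {c c' t} h => ((EuclideanSpace.proj i : EuclideanSpace ℝ (Fin k) →L[ℝ]
        ℝ).hasFDerivAt.comp_hasDerivAt t h).const_mul _
    have h := fderiv_fderiv_apply_curve (U := g)
      (γ := fun t : ℝ => R • greatCircle θ (b j) t)
      (γ' := fun t => R • greatCircle (b j : EuclideanSpace ℝ (Fin k)) (-θ) t) (t := 0)
      (by simpa [hxθ] using hg2)
      (Eventually.of_forall fun t => (hasDerivAt_greatCircle θ (b j) t).const_smul R)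
      ((hasDerivAt_greatCircle (b j : EuclideanSpace ℝ (Fin k)) (-θ) 0).const_smul R)
      (Eventually.of_forall fun t => hpr (hd1 t)) (hpr hd2)
      (Eventually.of_forall fun t => hgr R hR0 _ (norm_greatCircle hθ hη1 hη0 t))
    have h2 := h.2
    simp only [greatCircle_zero, hxθ, map_smul, smul_apply, smul_eq_mul, map_neg] at h2
    rw [← hxθ, map_smul, smul_eq_mul, hxθ] at hDx
    linarith
  have htr := sum_apply_tangentPlane (c := sphereWeights k) (x := θ)
    (by rwa [normalVec_sphereWeights]) (fderiv ℝ (fderiv ℝ g) x)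
  rw [normalVec_sphereWeights, hθ, one_pow, inv_one, one_smul, ← hb] at htr
  rw [← htr]
  have hsum := congrArg (fun v : EuclideanSpace ℝ (Fin k) => v i)
    (sum_ambientHessian_eigenmap hU ht he hθ)
  simp only [WithLp.ofLp_sum, Finset.sum_apply, PiLp.smul_apply, smul_eq_mul] at hsum
  rw [← hb] at hsum
  have hrad' : R ^ 2 * fderiv ℝ (fderiv ℝ g) x θ θ = d * (d - 1) * g x := by
    rw [← hrad, ← hxθ]
    simp only [map_smul, smul_apply, smul_eq_mul]
    ring
  have hall : R ^ 2 * (∑ j, fderiv ℝ (fderiv ℝ g) x (b j) (b j) + fderiv ℝ (fderiv ℝ g) x θ θ) =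
      0 := by
    rw [mul_add, Finset.mul_sum, hrad', Finset.sum_congr rfl fun j _ => htan j,
      Finset.sum_add_distrib, ← Finset.mul_sum, hsum, Finset.sum_const, Finset.card_univ,
      Fintype.card_fin, nsmul_eq_mul, finrank_tangentPlane_sphere hθ, hgx]
    ring
  exact (mul_eq_zero.1 hall).resolve_left (by positivity)

/-- The extension of an eigenmap that is homogeneous of degree `d` is smooth, also at the
origin. -/
theorem exists_contDiff_homogeneous_extension {d : ℕ} (hk : 2 ≤ k) (hd : 1 ≤ d)
    (hU : IsSmoothExtension (sphereWeights k) χ U)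
    (ht : ∀ x ∈ ellipsoid (sphereWeights k), tensionField (sphereWeights k) U x = 0)
    (he : ∀ x ∈ ellipsoid (sphereWeights k), normSqDiff (sphereWeights k) U x =
      (d : ℝ) * ((d : ℝ) + (k : ℝ) - 2)) :
    ∃ H : EuclideanSpace ℝ (Fin k) → EuclideanSpace ℝ (Fin k), ContDiff ℝ ∞ H ∧ H 0 = 0 ∧
      ∀ r : ℝ, 0 < r → ∀ θ : EuclideanSpace ℝ (Fin k), ‖θ‖ = 1 → H (r • θ) = r ^ d • U θ := by
  have hpol : ∀ r : ℝ, 0 < r → ∀ θ : EuclideanSpace ℝ (Fin k), ‖θ‖ = 1 →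
      ‖r • θ‖ = r ∧ ‖r • θ‖⁻¹ • r • θ = θ := fun r hr θ hθ => by
    have h1 : ‖r • θ‖ = r := by rw [norm_smul, hθ, mul_one, Real.norm_of_nonneg hr.le]
    exact ⟨h1, by rw [h1, inv_smul_smul₀ hr.ne']⟩
  have hex : ∀ i, ∃ G : EuclideanSpace ℝ (Fin k) → ℝ, ContDiff ℝ ∞ G ∧
      ∀ x, x ≠ 0 → G x = ‖x‖ ^ d * U (‖x‖⁻¹ • x) i := fun i => by
    refine exists_contDiff_of_homogeneous_harmonic hk d _ (fun x hx => ?_) (fun r hr x hx => ?_)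
      fun x hx => harmonic_homogeneous_extension hU ht he i hx
    · refine ContDiffAt.contDiffWithinAt (((contDiffAt_norm ℝ hx).pow d).mul ?_)
      exact contDiffAt_euclidean.1 (contDiffAt_comp_normalize hU hx) i
    · rw [norm_smul, Real.norm_of_nonneg hr.le, mul_pow, mul_assoc, smul_smul, mul_inv,
        mul_right_comm, inv_mul_cancel₀ hr.ne', one_mul]
  choose G hGs hG using hex
  have hval : ∀ r : ℝ, 0 < r → ∀ θ : EuclideanSpace ℝ (Fin k), ‖θ‖ = 1 →
      WithLp.toLp 2 (fun i => G i (r • θ)) = r ^ d • U θ := fun r hr θ hθ => by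
    obtain ⟨h1, h2⟩ := hpol r hr θ hθ
    have h0 : r • θ ≠ 0 := by rw [← norm_ne_zero_iff, h1]; exact hr.ne'
    ext i
    simp only [PiLp.smul_apply, smul_eq_mul, hG i _ h0, h2]
    rw [h1]
  have hH : ContDiff ℝ ∞ fun x => WithLp.toLp 2 fun i => G i x :=
    contDiff_euclidean.2 fun i => hGs i
  refine ⟨_, hH, ?_, hval⟩
  -- At the origin, by continuity along a ray.
  set θ : EuclideanSpace ℝ (Fin k) := EuclideanSpace.single ⟨0, by omega⟩ 1 with hθ
  have hθ1 : ‖θ‖ = 1 := by simp [hθ]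
  have h1 : Tendsto (fun r : ℝ => WithLp.toLp 2 fun i => G i (r • θ)) (𝓝[>] 0)
      (𝓝 (WithLp.toLp 2 fun i => G i 0)) := by
    have hc : Continuous fun r : ℝ => WithLp.toLp 2 fun i => G i (r • θ) :=
      hH.continuous.comp (by fun_prop : Continuous fun r : ℝ => r • θ)
    have h := hc.tendsto 0
    rw [zero_smul] at h
    exact h.mono_left nhdsWithin_le_nhds
  have h2 : Tendsto (fun r : ℝ => r ^ d • U θ) (𝓝[>] 0) (𝓝 0) := by
    have hc : Continuous fun r : ℝ => r ^ d • U θ := by fun_prop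
    have h := hc.tendsto 0
    rw [zero_pow (by omega : d ≠ 0), zero_smul] at h
    exact h.mono_left nhdsWithin_le_nhds
  refine tendsto_nhds_unique h1 (h2.congr' ?_)
  filter_upwards [self_mem_nhdsWithin] with r hr using (hval r hr θ hθ1).symm

end SolidExtension

/-! ### The tension field in rotational coordinates -/

section RotationalCoordinates

open Set Filter Topology
open scoped InnerProductSpace

/-- The unit vector of the axis of rotation. -/
noncomputable def axisVec (k : ℕ) : EuclideanSpace ℝ (Fin (k + 1)) :=
  WithLp.toLp 2 (Fin.cons 1 0)

/-- The inclusion `y ↦ (0, y)` of the hyperplane orthogonal to the axis of rotation. -/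
noncomputable def tailIncl (k : ℕ) :
    EuclideanSpace ℝ (Fin k) →L[ℝ] EuclideanSpace ℝ (Fin (k + 1)) :=
  LinearMap.toContinuousLinearMap
    { toFun := fun y => WithLp.toLp 2 (Fin.cons 0 y)
      map_add' := fun x y => by ext i; refine Fin.cases ?_ (fun j => ?_) i <;> simp
      map_smul' := fun r x => by ext i; refine Fin.cases ?_ (fun j => ?_) i <;> simp }

/-- The projection `(s, y) ↦ y` along the axis of rotation. -/
noncomputable def tailProj (k : ℕ) :
    EuclideanSpace ℝ (Fin (k + 1)) →L[ℝ] EuclideanSpace ℝ (Fin k) :=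
  LinearMap.toContinuousLinearMap
    { toFun := fun x => WithLp.toLp 2 fun i => x i.succ
      map_add' := fun x y => by ext i; simp
      map_smul' := fun r x => by ext i; simp }

variable {k : ℕ} {a : ℝ}

@[simp] theorem axisVec_zero : axisVec k 0 = 1 := rfl

@[simp] theorem axisVec_succ (i : Fin k) : axisVec k i.succ = 0 := rfl

@[simp] theorem tailIncl_zero (y : EuclideanSpace ℝ (Fin k)) : tailIncl k y 0 = 0 := rfl

@[simp] theorem tailIncl_succ (y : EuclideanSpace ℝ (Fin k)) (i : Fin k) :
    tailIncl k y i.succ = y i := rfl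

@[simp] theorem tailProj_apply (x : EuclideanSpace ℝ (Fin (k + 1))) (i : Fin k) :
    tailProj k x i = x i.succ := rfl

theorem smul_axisVec_add_tailIncl (x : EuclideanSpace ℝ (Fin (k + 1))) :
    x 0 • axisVec k + tailIncl k (tailProj k x) = x := by
  ext i; refine Fin.cases ?_ (fun j => ?_) i <;> simp

theorem inner_axis_tail (s t : ℝ) (y z : EuclideanSpace ℝ (Fin k)) :
    ⟪s • axisVec k + tailIncl k y, t • axisVec k + tailIncl k z⟫_ℝ = s * t + ⟪y, z⟫_ℝ := by
  rw [PiLp.inner_apply, PiLp.inner_apply, Fin.sum_univ_succ]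
  simp [mul_comm]

theorem normalVec_axis_tail (s : ℝ) (y : EuclideanSpace ℝ (Fin k)) :
    normalVec (weightsE k a) (s • axisVec k + tailIncl k y) =
      (s / a ^ 2) • axisVec k + tailIncl k y := by
  ext i
  refine Fin.cases ?_ (fun j => ?_) i <;> simp [normalVec, weightsE]
  rw [div_eq_inv_mul]

theorem polarVec_eq (ψ : ℝ) (θ : EuclideanSpace ℝ (Fin k)) :
    polarVec a ψ θ = (a * Real.cos ψ) • axisVec k + Real.sin ψ • tailIncl k θ := by
  ext i; refine Fin.cases ?_ (fun j => ?_) i <;> simp [polarVec]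

theorem normalVec_polarVec (ha : a ≠ 0) (ψ : ℝ) (θ : EuclideanSpace ℝ (Fin k)) :
    normalVec (weightsE k a) (polarVec a ψ θ) =
      (Real.cos ψ / a) • axisVec k + Real.sin ψ • tailIncl k θ := by
  rw [polarVec_eq, ← map_smul, normalVec_axis_tail]
  congr 2
  field_simp

theorem norm_normalVec_polarVec (ha : a ≠ 0) (ψ : ℝ) {θ : EuclideanSpace ℝ (Fin k)}
    (hθ : ‖θ‖ = 1) :
    ‖normalVec (weightsE k a) (polarVec a ψ θ)‖ ^ 2 = metricFactor a ψ / a ^ 2 := by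
  rw [← real_inner_self_eq_norm_sq, normalVec_polarVec ha, ← map_smul, inner_axis_tail,
    inner_smul_left, inner_smul_right, real_inner_self_eq_norm_sq, hθ, metricFactor]
  simp only [conj_trivial]
  field_simp
  ring

/-- The velocity `∂/∂ψ` of the meridians. -/
noncomputable def meridianVec (a ψ : ℝ) (θ : EuclideanSpace ℝ (Fin k)) :
    EuclideanSpace ℝ (Fin (k + 1)) :=
  (-(a * Real.sin ψ)) • axisVec k + Real.cos ψ • tailIncl k θ

/-- The trace of a bilinear map over the tangent space of the ellipsoid splits into the directions
of the meridian and of the parallels. -/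
theorem sum_apply_tangentPlane_polarVec {F : Type*} [NormedAddCommGroup F] [NormedSpace ℝ F]
    (ha : a ≠ 0) (ψ : ℝ) {θ : EuclideanSpace ℝ (Fin k)} (hθ : ‖θ‖ = 1)
    (B : EuclideanSpace ℝ (Fin (k + 1)) →L[ℝ] EuclideanSpace ℝ (Fin (k + 1)) →L[ℝ] F) :
    ∑ i, B (stdOrthonormalBasis ℝ (tangentPlane (weightsE k a) (polarVec a ψ θ)) i :
          EuclideanSpace ℝ (Fin (k + 1)))
        (stdOrthonormalBasis ℝ (tangentPlane (weightsE k a) (polarVec a ψ θ)) i :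
          EuclideanSpace ℝ (Fin (k + 1))) =
      (metricFactor a ψ)⁻¹ • B (meridianVec a ψ θ) (meridianVec a ψ θ) +
      ∑ j, B (tailIncl k (stdOrthonormalBasis ℝ (tangentPlane (sphereWeights k) θ) j))
        (tailIncl k (stdOrthonormalBasis ℝ (tangentPlane (sphereWeights k) θ) j)) := by
  have hm := metricFactor_pos ha ψ
  have hmem := polarVec_mem ha ψ (mem_sphere_iff.2 hθ)
  have h1 := sum_apply_tangentPlane (normalVec_ne_zero hmem) B
  have hθ0 : θ ≠ 0 := by rw [← norm_ne_zero_iff, hθ]; exact one_ne_zero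
  have h2 := sum_apply_tangentPlane (c := sphereWeights k) (x := θ)
    (by rwa [normalVec_sphereWeights]) (B.bilinearComp (tailIncl k) (tailIncl k))
  simp only [ContinuousLinearMap.bilinearComp_apply, normalVec_sphereWeights, hθ, one_pow, inv_one,
    one_smul] at h2
  rw [eq_sub_iff_add_eq.2 h1, eq_sub_iff_add_eq.2 h2, Fin.sum_univ_succ]
  have hb0 : EuclideanSpace.basisFun (Fin (k + 1)) ℝ 0 = axisVec k := by
    ext i; refine Fin.cases ?_ (fun j => ?_) i <;> simp
  have hbs : ∀ j : Fin k, EuclideanSpace.basisFun (Fin (k + 1)) ℝ j.succ =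
      tailIncl k (EuclideanSpace.basisFun (Fin k) ℝ j) := fun j => by
    ext i; refine Fin.cases ?_ (fun j => ?_) i <;> simp
  simp only [hb0, hbs]
  rw [norm_normalVec_polarVec ha ψ hθ, normalVec_polarVec ha, meridianVec]
  simp only [map_add, map_smul, add_apply, smul_apply]
  rw [show metricFactor a ψ = a ^ 2 * Real.sin ψ ^ 2 + Real.cos ψ ^ 2 from rfl] at hm ⊢
  match_scalars <;> field_simp <;> ring

/-- A vector in the plane of the meridian through a point that is orthogonal to the meridian is
normal to the ellipsoid. -/
theorem tangentProj_eq_zero_of_orthogonal_meridian (ha : a ≠ 0) {f X Y : ℝ}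
    {w : EuclideanSpace ℝ (Fin k)} (h : Real.cos f * Y = a * Real.sin f * X) :
    tangentProj (weightsE k a) (polarVec a f w) (X • axisVec k + Y • tailIncl k w) = 0 := by
  have hm := metricFactor_pos ha f
  have : X • axisVec k + Y • tailIncl k w =
      (a * (X * Real.cos f + a * Real.sin f * Y) / metricFactor a f) •
        normalVec (weightsE k a) (polarVec a f w) := by
    rw [normalVec_polarVec ha, smul_add, smul_smul, smul_smul]
    rw [show metricFactor a f = a ^ 2 * Real.sin f ^ 2 + Real.cos f ^ 2 from rfl] at hm ⊢
    congr 2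
    · field_simp
      linear_combination (-a * Real.sin f) * h
    · field_simp
      linear_combination Real.cos f * h
  rw [this, tangentProj_smul_normalVec]

variable {d : ℕ} {χ : ellipsoid (sphereWeights k) → ellipsoid (sphereWeights k)}
  {V : EuclideanSpace ℝ (Fin k) → EuclideanSpace ℝ (Fin k)}
  {u : ellipsoid (weightsE k a) → ellipsoid (weightsE k a)}
  {U : EuclideanSpace ℝ (Fin (k + 1)) → EuclideanSpace ℝ (Fin (k + 1))} {f : ℝ → ℝ}

/-- The Hessian in the direction of the meridian. The correction to the second derivative is the
tangential acceleration of the meridian. -/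
theorem ambientHessian_meridian (ha : a ≠ 0) {ψ : ℝ} {θ : EuclideanSpace ℝ (Fin k)} (hθ : ‖θ‖ = 1)
    {D : EuclideanSpace ℝ (Fin (k + 1)) →L[ℝ] EuclideanSpace ℝ (Fin (k + 1))}
    (hD : fderiv ℝ U (polarVec a ψ θ) = D) {Γ₂ : EuclideanSpace ℝ (Fin (k + 1))}
    (hΓ : fderiv ℝ (fderiv ℝ U) (polarVec a ψ θ) (meridianVec a ψ θ) (meridianVec a ψ θ) +
      D (-(a * Real.cos ψ) • axisVec k - Real.sin ψ • tailIncl k θ) = Γ₂) :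
    ambientHessian (weightsE k a) U (polarVec a ψ θ) (meridianVec a ψ θ) (meridianVec a ψ θ) =
      Γ₂ - ((a ^ 2 - 1) * Real.sin ψ * Real.cos ψ / metricFactor a ψ) • D (meridianVec a ψ θ) := by
  have hm := metricFactor_pos ha ψ
  have h1 : ⟪normalVec (weightsE k a) (meridianVec a ψ θ), meridianVec a ψ θ⟫_ℝ = 1 := by
    rw [meridianVec, ← map_smul, normalVec_axis_tail, inner_axis_tail, inner_smul_left,
      inner_smul_right, real_inner_self_eq_norm_sq, hθ]
    have := Real.sin_sq_add_cos_sq ψ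
    simp only [conj_trivial]
    field_simp
    linarith
  rw [ambientHessian_apply, h1, norm_normalVec_polarVec ha ψ hθ, hD, ← hΓ, add_sub_assoc,
    sub_eq_add_neg, ← map_smul D, ← map_smul D, ← map_sub D, ← map_neg D]
  congr 2
  rw [normalVec_polarVec ha, meridianVec]
  have hsc := Real.sin_sq_add_cos_sq ψ
  have hmeq : metricFactor a ψ = a ^ 2 * Real.sin ψ ^ 2 + Real.cos ψ ^ 2 := rfl
  match_scalars
  · field_simp
    rw [hmeq]
    linear_combination Real.cos ψ * hsc
  · field_simp
    rw [hmeq]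
    linear_combination (a ^ 2 * Real.sin ψ) * hsc

/-- The Hessian in the direction of a parallel. -/
theorem ambientHessian_parallel (ha : a ≠ 0) {ψ : ℝ} (hψ : Real.sin ψ ≠ 0)
    {θ η : EuclideanSpace ℝ (Fin k)} (hθ : ‖θ‖ = 1) (hη : ‖η‖ = 1)
    {D : EuclideanSpace ℝ (Fin (k + 1)) →L[ℝ] EuclideanSpace ℝ (Fin (k + 1))}
    (hD : fderiv ℝ U (polarVec a ψ θ) = D) {Γ₂ : EuclideanSpace ℝ (Fin (k + 1))}
    (hΓ : fderiv ℝ (fderiv ℝ U) (polarVec a ψ θ) (Real.sin ψ • tailIncl k η)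
      (Real.sin ψ • tailIncl k η) + D (Real.sin ψ • tailIncl k (-θ)) = Γ₂) :
    ambientHessian (weightsE k a) U (polarVec a ψ θ) (tailIncl k η) (tailIncl k η) =
      (Real.sin ψ ^ 2)⁻¹ • Γ₂ +
        (Real.cos ψ / (metricFactor a ψ * Real.sin ψ)) • D (meridianVec a ψ θ) := by
  have hm := metricFactor_pos ha ψ
  have h1 : ⟪normalVec (weightsE k a) (tailIncl k η), tailIncl k η⟫_ℝ = 1 := by
    have h := normalVec_axis_tail (a := a) 0 η
    have h2 := inner_axis_tail 0 0 η η
    simp only [zero_smul, zero_add, zero_div, mul_zero] at h h2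
    rw [h, h2, real_inner_self_eq_norm_sq, hη, one_pow]
  rw [ambientHessian_apply, h1, norm_normalVec_polarVec ha ψ hθ, hD, ← hΓ]
  simp only [map_smul, smul_apply, map_neg, smul_neg, smul_add, smul_smul]
  rw [show (Real.sin ψ ^ 2)⁻¹ * (Real.sin ψ * Real.sin ψ) = 1 by field_simp, one_smul,
    sub_eq_add_neg, add_assoc]
  congr 1
  simp only [← map_smul, ← map_neg, ← map_add]
  congr 1
  rw [normalVec_polarVec ha, meridianVec]
  have hmeq : metricFactor a ψ = a ^ 2 * Real.sin ψ ^ 2 + Real.cos ψ ^ 2 := rfl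
  simp only [map_smul, map_neg]
  match_scalars
  · field_simp
  · field_simp
    rw [hmeq]
    ring

/-- Away from the poles the tension field of `(ψ, θ) ↦ (f(ψ), χ(θ))` vanishes, by the reduced
equation. -/
theorem tensionField_polarVec_eq_zero (ha : a ≠ 0)
    (hV : IsSmoothExtension (sphereWeights k) χ V)
    (ht : ∀ x ∈ ellipsoid (sphereWeights k), tensionField (sphereWeights k) V x = 0)
    (he : ∀ x ∈ ellipsoid (sphereWeights k), normSqDiff (sphereWeights k) V x =
      (d : ℝ) * ((d : ℝ) + (k : ℝ) - 2))
    (hf : IsReducedSolution k d a f) (hU : IsSmoothExtension (weightsE k a) u U)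
    (hform : HasForm ha u f χ) {ψ : ℝ} (hψ : ψ ∈ Ioo 0 Real.pi) {θ : EuclideanSpace ℝ (Fin k)}
    (hθ : ‖θ‖ = 1) : tensionField (weightsE k a) U (polarVec a ψ θ) = 0 := by
  have hm := metricFactor_pos ha ψ
  have hmf := metricFactor_pos ha (f ψ)
  have hs : 0 < Real.sin ψ := Real.sin_pos_of_mem_Ioo hψ
  have hmem := polarVec_mem ha ψ (mem_sphere_iff.2 hθ)
  have hUval : ∀ s ∈ Icc 0 Real.pi, ∀ ζ : EuclideanSpace ℝ (Fin k), ‖ζ‖ = 1 →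
      U (polarVec a s ζ) = polarVec a (f s) (V ζ) := fun s hs ζ hζ => by
    have h1 := hU.2 (polarE ha s ⟨ζ, mem_sphere_iff.2 hζ⟩)
    rw [hform s hs] at h1
    have h2 := hV.2 ⟨ζ, mem_sphere_iff.2 hζ⟩
    simp only [polarE] at h1
    rw [h1, ← h2]
  have hψI : ψ ∈ Icc 0 Real.pi := Ioo_subset_Icc_self hψ
  have hU2 : ContDiffAt ℝ 2 U (polarVec a ψ θ) :=
    (hU.contDiffAt hmem).of_le (WithTop.coe_le_coe.2 le_top)
  set D := fderiv ℝ U (polarVec a ψ θ) with hD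
  -- The meridian.
  have hfd : ∀ s ∈ Ioo 0 Real.pi, HasDerivAt f (deriv f s) s := fun s hs =>
    ((hf.contDiffOn.contDiffAt (isOpen_Ioo.mem_nhds hs)).differentiableAt
      (by norm_num)).hasDerivAt
  have hfd2 : HasDerivAt (deriv f) (deriv (deriv f) ψ) ψ := by
    have h1 : ContDiffOn ℝ 1 (deriv f) (Ioo 0 Real.pi) :=
      hf.contDiffOn.deriv_of_isOpen isOpen_Ioo (by norm_num)
    exact ((h1.contDiffAt (isOpen_Ioo.mem_nhds hψ)).differentiableAt (by norm_num)).hasDerivAt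
  have hmer : ∀ (w : EuclideanSpace ℝ (Fin k)) s,
      HasDerivAt (fun s => polarVec a s w) (meridianVec a s w) s := fun w s => by
    simp only [polarVec_eq]
    refine ((((Real.hasDerivAt_cos s).const_mul a).smul_const (axisVec k)).add
      ((Real.hasDerivAt_sin s).smul_const (tailIncl k w))).congr_deriv ?_
    rw [meridianVec]; simp
  have hmer2 : ∀ (w : EuclideanSpace ℝ (Fin k)) s, HasDerivAt (fun s => meridianVec a s w)
      (-(a * Real.cos s) • axisVec k - Real.sin s • tailIncl k w) s := fun w s => by
    refine (((((Real.hasDerivAt_sin s).const_mul a).neg).smul_const (axisVec k)).add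
      ((Real.hasDerivAt_cos s).smul_const (tailIncl k w))).congr_deriv ?_
    rw [neg_smul, neg_smul, ← sub_eq_add_neg]
  have hev : ∀ᶠ s in 𝓝 ψ, s ∈ Ioo 0 Real.pi := isOpen_Ioo.mem_nhds hψ
  obtain ⟨hc1, hc2⟩ := fderiv_fderiv_apply_curve (U := U) (γ := fun s => polarVec a s θ)
    (γ' := fun s => meridianVec a s θ) (Γ := fun s => polarVec a (f s) (V θ))
    (Γ' := fun s => deriv f s • meridianVec a (f s) (V θ)) hU2
    (Eventually.of_forall (hmer θ)) (hmer2 θ ψ)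
    (hev.mono fun s hs => (hmer (V θ) (f s)).scomp s (hfd s hs))
    (hfd2.smul ((hmer2 (V θ) (f ψ)).scomp ψ (hfd ψ hψ)))
    (hev.mono fun s hs => hUval s (Ioo_subset_Icc_self hs) θ hθ)
  have hB1 := ambientHessian_meridian ha hθ hD.symm hc2
  rw [← hD] at hc1
  rw [hc1] at hB1
  -- The parallels.
  set b := stdOrthonormalBasis ℝ (tangentPlane (sphereWeights k) θ) with hb
  have hB2 : ∀ j, ambientHessian (weightsE k a) U (polarVec a ψ θ) (tailIncl k (b j))
      (tailIncl k (b j)) = (Real.sin ψ ^ 2)⁻¹ • Real.sin (f ψ) •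
        tailIncl k (ambientHessian (sphereWeights k) V θ (b j) (b j)) +
      (Real.cos ψ / (metricFactor a ψ * Real.sin ψ)) • deriv f ψ • meridianVec a (f ψ) (V θ) :=
      fun j => by
    obtain ⟨hη1, hη0⟩ := norm_stdOrthonormalBasis_tangentPlane (θ := θ) j
    obtain ⟨hd1, hd2⟩ := hasDerivAt_comp_greatCircle hV hθ hη1 hη0
    have hlift : ∀ (r : ℝ) {c : ℝ → EuclideanSpace ℝ (Fin k)} {c' : EuclideanSpace ℝ (Fin k)}
        {t : ℝ}, HasDerivAt c c' t →
        HasDerivAt (fun t => polarVec a r (c t)) (Real.sin r • tailIncl k c') t :=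
      fun r c c' t h => by
        simp only [polarVec_eq]
        exact (((tailIncl k).hasFDerivAt.comp_hasDerivAt t h).const_smul (Real.sin r)).const_add _
    have hlift' : ∀ (r : ℝ) {c : ℝ → EuclideanSpace ℝ (Fin k)} {c' : EuclideanSpace ℝ (Fin k)}
        {t : ℝ}, HasDerivAt c c' t →
        HasDerivAt (fun t => r • tailIncl k (c t)) (r • tailIncl k c') t :=
      fun r c c' t h => ((tailIncl k).hasFDerivAt.comp_hasDerivAt t h).const_smul r
    obtain ⟨-, h2⟩ := fderiv_fderiv_apply_curve (U := U)
      (γ := fun t => polarVec a ψ (greatCircle θ (b j) t))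
      (γ' := fun t => Real.sin ψ • tailIncl k (greatCircle (b j : EuclideanSpace ℝ (Fin k)) (-θ) t))
      (t := 0) (by simpa using hU2)
      (Eventually.of_forall fun t => hlift ψ (hasDerivAt_greatCircle θ (b j) t))
      (hlift' (Real.sin ψ) (hasDerivAt_greatCircle (b j : EuclideanSpace ℝ (Fin k)) (-θ) 0))
      (Eventually.of_forall fun t => hlift (f ψ) (hd1 t))
      (hlift' (Real.sin (f ψ)) hd2)
      (Eventually.of_forall fun t => hUval ψ hψI _ (norm_greatCircle hθ hη1 hη0 t))
    simp only [greatCircle_zero] at h2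
    have h4 := ambientHessian_parallel ha hs.ne' hθ hη1 hD.symm h2
    rw [h4, hc1]
  have htr := sum_apply_tangentPlane_polarVec ha ψ hθ
    (ambientHessian (weightsE k a) U (polarVec a ψ θ))
  rw [tensionField_eq hU2 hmem, htr, hB1, ← hb, Finset.sum_congr rfl fun j _ => hB2 j,
    Finset.sum_add_distrib, ← Finset.smul_sum, ← Finset.smul_sum, ← map_sum,
    sum_ambientHessian_eigenmap hV ht he hθ, Finset.sum_const, Finset.card_univ, Fintype.card_fin,
    ← Nat.cast_smul_eq_nsmul ℝ, finrank_tangentPlane_sphere hθ, hUval ψ hψI θ hθ]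
  have hode := hf.ode ψ hψ
  rw [Real.cot_eq_cos_div_sin, Real.sin_two_mul, Real.sin_two_mul] at hode
  generalize deriv (deriv f) ψ = f₂ at *
  generalize deriv f ψ = f₁ at *
  set m := metricFactor a ψ with hmdef
  have hmfeq : metricFactor a (f ψ) = a ^ 2 * Real.sin (f ψ) ^ 2 + Real.cos (f ψ) ^ 2 := rfl
  rw [meridianVec]
  set X : ℝ := m⁻¹ * (f₂ * -(a * Real.sin (f ψ)) + f₁ ^ 2 * -(a * Real.cos (f ψ)) -
    (a ^ 2 - 1) * Real.sin ψ * Real.cos ψ / m * (f₁ * -(a * Real.sin (f ψ)))) +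
    (k - 1) * (Real.cos ψ / (m * Real.sin ψ) * (f₁ * -(a * Real.sin (f ψ)))) with hX
  set Y : ℝ := m⁻¹ * (f₂ * Real.cos (f ψ) - f₁ ^ 2 * Real.sin (f ψ) -
    (a ^ 2 - 1) * Real.sin ψ * Real.cos ψ / m * (f₁ * Real.cos (f ψ))) -
    (Real.sin ψ ^ 2)⁻¹ * Real.sin (f ψ) * (d * (d + k - 2)) +
    (k - 1) * (Real.cos ψ / (m * Real.sin ψ) * (f₁ * Real.cos (f ψ))) with hY
  have horth : Real.cos (f ψ) * Y = a * Real.sin (f ψ) * X := by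
    rw [hode] at hX hY
    rw [hX, hY]
    have hmf' := hmf.ne'
    rw [hmfeq] at hmf' ⊢
    field_simp
    ring
  have hfin := tangentProj_eq_zero_of_orthogonal_meridian ha (w := V θ) horth
  rw [← hfin]
  congr 1
  rw [hX, hY]
  simp only [map_smul, map_neg, neg_smul]
  module

end RotationalCoordinates

/-! ### Smoothness of the rotational maps -/

section Extension

open Set Filter Topology
open scoped InnerProductSpace

theorem mem_ellipsoid_iff {n : ℕ} {c : Fin n → ℝ} {x : EuclideanSpace ℝ (Fin n)} :
    x ∈ ellipsoid c ↔ ⟪normalVec c x, x⟫_ℝ = 1 := by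
  refine ⟨inner_normalVec_self, fun h => ?_⟩
  rw [PiLp.inner_apply] at h
  rw [ellipsoid, mem_ofPred_eq, ← h]
  refine Finset.sum_congr rfl fun i _ => ?_
  simp [normalVec]; ring

theorem isClosed_ellipsoid {n : ℕ} (c : Fin n → ℝ) : IsClosed (ellipsoid c) :=
  isClosed_eq (by fun_prop) continuous_const

/-- A map that extends smoothly near each point of the ellipsoid has a global smooth extension, by
a partition of unity. -/
theorem exists_isSmoothExtension {n : ℕ} {c : Fin n → ℝ} (u : ellipsoid c → ellipsoid c)
    (h : ∀ x : ellipsoid c, ∃ W ∈ 𝓝 (x : EuclideanSpace ℝ (Fin n)),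
      ∃ g : EuclideanSpace ℝ (Fin n) → EuclideanSpace ℝ (Fin n), ContDiffOn ℝ ∞ g W ∧
        ∀ y : ellipsoid c, (y : EuclideanSpace ℝ (Fin n)) ∈ W → g y = u y) :
    ∃ U, IsSmoothExtension c u U := by
  let t : EuclideanSpace ℝ (Fin n) → Set (EuclideanSpace ℝ (Fin n)) := fun x =>
    {z | ∀ hx : x ∈ ellipsoid c, z = u ⟨x, hx⟩}
  have ht : ∀ x, Convex ℝ (t x) := fun x z hz w hw α β hα hβ hαβ hx => by
    rw [hz hx, hw hx, ← add_smul, hαβ, one_smul]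
  obtain ⟨U, hU⟩ := exists_contMDiffMap_forall_mem_convex_of_local (n := ⊤)
    (modelWithCornersSelf ℝ (EuclideanSpace ℝ (Fin n))) (t := t) ht fun x => by
      by_cases hx : x ∈ ellipsoid c
      · obtain ⟨W, hW, g, hg, hgu⟩ := h ⟨x, hx⟩
        exact ⟨W, hW, g, hg.contMDiffOn, fun y hy hyc => hgu ⟨y, hyc⟩ hy⟩
      · exact ⟨_, (isClosed_ellipsoid c).isOpen_compl.mem_nhds hx, fun _ => 0, contMDiffOn_const,
          fun y hy hyc => absurd hyc hy⟩
  exact ⟨U, ⟨univ, isOpen_univ, subset_univ _, U.contMDiff.contDiff.contDiffOn⟩,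
    fun x => hU x x.2⟩

variable {k : ℕ} {a : ℝ}

@[simp] theorem polarVec_apply_zero (ψ : ℝ) (θ : EuclideanSpace ℝ (Fin k)) :
    polarVec a ψ θ 0 = a * Real.cos ψ := rfl

@[simp] theorem tailProj_polarVec (ψ : ℝ) (θ : EuclideanSpace ℝ (Fin k)) :
    tailProj k (polarVec a ψ θ) = Real.sin ψ • θ := by
  ext i; simp [polarVec]

theorem contDiff_polarVec : ContDiff ℝ ∞ fun z : ℝ × EuclideanSpace ℝ (Fin k) =>
    polarVec a z.1 z.2 := by
  simp only [polarVec_eq]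
  fun_prop

/-- Every point of the ellipsoid has polar coordinates. -/
theorem exists_polarVec_eq (hk : 1 ≤ k) (ha : a ≠ 0) {x : EuclideanSpace ℝ (Fin (k + 1))}
    (hx : x ∈ ellipsoid (weightsE k a)) :
    ∃ ψ ∈ Icc 0 Real.pi, ∃ θ : EuclideanSpace ℝ (Fin k), ‖θ‖ = 1 ∧ polarVec a ψ θ = x := by
  set y := tailProj k x with hy
  have h1 : (x 0 / a) ^ 2 + ‖y‖ ^ 2 = 1 := by
    have h := mem_ellipsoid_iff.1 hx
    rw [← smul_axisVec_add_tailIncl x, normalVec_axis_tail, inner_axis_tail,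
      real_inner_self_eq_norm_sq, ← hy] at h
    rw [← h]
    ring
  have h2 : |x 0 / a| ≤ 1 := by
    rw [← sq_le_one_iff_abs_le_one]; linarith [sq_nonneg ‖y‖]
  set ψ := Real.arccos (x 0 / a) with hψ
  have hcos : Real.cos ψ = x 0 / a := Real.cos_arccos (abs_le.1 h2).1 (abs_le.1 h2).2
  have hsin : Real.sin ψ = ‖y‖ := by
    rw [hψ, Real.sin_arccos, ← Real.sqrt_sq (norm_nonneg y)]
    congr 1; linarith
  obtain ⟨θ, hθ, hyθ⟩ : ∃ θ : EuclideanSpace ℝ (Fin k), ‖θ‖ = 1 ∧ ‖y‖ • θ = y := by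
    rcases eq_or_ne y 0 with h0 | h0
    · exact ⟨EuclideanSpace.single ⟨0, by omega⟩ 1, by simp, by rw [h0]; simp⟩
    · exact ⟨‖y‖⁻¹ • y, norm_smul_inv_norm (𝕜 := ℝ) h0,
        smul_inv_smul₀ (norm_ne_zero_iff.2 h0) y⟩
  refine ⟨ψ, ⟨Real.arccos_nonneg _, Real.arccos_le_pi _⟩, θ, hθ, ?_⟩
  rw [polarVec_eq, hcos, mul_div_cancel₀ _ ha, hsin, ← map_smul, hyθ]
  exact smul_axisVec_add_tailIncl x

theorem polarVec_eq_polarVec_iff (ha : a ≠ 0) {ψ ψ' : ℝ} {θ θ' : EuclideanSpace ℝ (Fin k)} :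
    polarVec a ψ θ = polarVec a ψ' θ' ↔
      Real.cos ψ = Real.cos ψ' ∧ Real.sin ψ • θ = Real.sin ψ' • θ' := by
  constructor
  · intro h
    have h0 := congrArg (fun x : EuclideanSpace ℝ (Fin (k + 1)) => x 0) h
    have h1 := congrArg (tailProj k) h
    simp only [polarVec_apply_zero, tailProj_polarVec] at h0 h1
    exact ⟨mul_left_cancel₀ ha h0, h1⟩
  · rintro ⟨h0, h1⟩
    rw [polarVec_eq, polarVec_eq, h0, ← map_smul, h1, map_smul]

/-- The map `(ψ, θ) ↦ (f(ψ), χ(θ))` is well defined if `f` maps the poles to poles. -/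
theorem exists_hasForm (hk : 1 ≤ k) (ha : a ≠ 0) {f : ℝ → ℝ} (h0 : Real.sin (f 0) = 0)
    (hπ : Real.sin (f Real.pi) = 0)
    (χ : ellipsoid (sphereWeights k) → ellipsoid (sphereWeights k)) :
    ∃ u : ellipsoid (weightsE k a) → ellipsoid (weightsE k a), HasForm ha u f χ := by
  have hex : ∀ x : ellipsoid (weightsE k a), ∃ ψ ∈ Icc 0 Real.pi,
      ∃ θ : ellipsoid (sphereWeights k), polarE ha ψ θ = x := fun x => by
    obtain ⟨ψ, hψ, θ, hθ, h⟩ := exists_polarVec_eq hk ha x.2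
    exact ⟨ψ, hψ, ⟨θ, mem_sphere_iff.2 hθ⟩, Subtype.ext h⟩
  choose Ψ hΨ Θ hΘ using hex
  refine ⟨fun x => polarE ha (f (Ψ x)) (χ (Θ x)), fun ψ hψ θ => ?_⟩
  change polarE ha (f (Ψ (polarE ha ψ θ))) (χ (Θ (polarE ha ψ θ))) = _
  set x := polarE ha ψ θ
  have h := congrArg Subtype.val (hΘ x)
  change polarVec a (Ψ x) (Θ x : EuclideanSpace ℝ (Fin k)) =
    polarVec a ψ (θ : EuclideanSpace ℝ (Fin k)) at h
  obtain ⟨hc, hs⟩ := (polarVec_eq_polarVec_iff ha).1 h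
  have hψeq : Ψ x = ψ := Real.injOn_cos (hΨ x) hψ hc
  rw [hψeq] at hs ⊢
  rcases hψ.1.eq_or_lt with rfl | h1
  · exact Subtype.ext ((polarVec_eq_polarVec_iff ha).2 ⟨rfl, by rw [h0, zero_smul, zero_smul]⟩)
  rcases hψ.2.eq_or_lt with rfl | h2
  · exact Subtype.ext ((polarVec_eq_polarVec_iff ha).2 ⟨rfl, by rw [hπ, zero_smul, zero_smul]⟩)
  have hsin := Real.sin_pos_of_pos_of_lt_pi h1 h2
  rw [Subtype.ext (smul_right_injective _ hsin.ne' hs)]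

variable {d : ℕ} {v : ℝ} {f : ℝ → ℝ}
  {χ : ellipsoid (sphereWeights k) → ellipsoid (sphereWeights k)}
  {V : EuclideanSpace ℝ (Fin k) → EuclideanSpace ℝ (Fin k)}

theorem tan_half_eq_sin_div (ψ : ℝ) : Real.tan (ψ / 2) = Real.sin ψ / (1 + Real.cos ψ) := by
  have h1 : Real.sin ψ = 2 * Real.sin (ψ / 2) * Real.cos (ψ / 2) := by
    rw [← Real.sin_two_mul]; ring_nf
  have h2 : 1 + Real.cos ψ = 2 * Real.cos (ψ / 2) ^ 2 := by
    have := Real.cos_sq (ψ / 2)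
    rw [show 2 * (ψ / 2) = ψ by ring] at this
    rw [this]; ring
  rw [h1, h2, Real.tan_eq_sin_div_cos]
  rcases eq_or_ne (Real.cos (ψ / 2)) 0 with h | h
  · simp [h]
  · field_simp

/-- Near the pole `ψ = 0` the map `(ψ, θ) ↦ (f(ψ), χ(θ))` is a smooth function of the ambient
coordinates: `tan(f/2) χ` is the product of a smooth function of `tan²(ψ/2)` and the homogeneous
extension of `χ`. -/
theorem exists_local_extension_pole (ha : a ≠ 0) (hd : 1 ≤ d) (hf : IsSmoothProfile k d a v f)
    {H : EuclideanSpace ℝ (Fin k) → EuclideanSpace ℝ (Fin k)} (hH : ContDiff ℝ ∞ H) (hH0 : H 0 = 0)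
    (hHV : ∀ r : ℝ, 0 < r → ∀ θ : EuclideanSpace ℝ (Fin k), ‖θ‖ = 1 → H (r • θ) = r ^ d • V θ) :
    ∃ C < 1, ∃ g : EuclideanSpace ℝ (Fin (k + 1)) → EuclideanSpace ℝ (Fin (k + 1)),
      ContDiffOn ℝ ∞ g {x | C < x 0 / a} ∧
      ∀ s ∈ Icc 0 Real.pi, C < Real.cos s → ∀ ζ : EuclideanSpace ℝ (Fin k), ‖ζ‖ = 1 →
        g (polarVec a s ζ) = polarVec a (f s) (V ζ) := by
  obtain ⟨P, hP, -, hpole⟩ := hf.pole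
  obtain ⟨ε₀, hε₀, hε⟩ : ∃ ε > 0, ∀ s, 0 ≤ s → s < ε →
      f s = 2 * Real.arctan (Real.tan (s / 2) ^ d * P (Real.tan (s / 2) ^ 2)) := by
    obtain ⟨ε, hε, h⟩ := mem_nhdsGE_iff_exists_Ico_subset.1 hpole
    exact ⟨ε, hε, fun s h0 h1 => h ⟨h0, h1⟩⟩
  set ε := min ε₀ (Real.pi / 2) with hεdef
  have hε0 : 0 < ε := lt_min hε₀ (by positivity)
  have hcosε : 0 ≤ Real.cos ε := Real.cos_nonneg_of_mem_Icc
    ⟨by linarith [Real.pi_pos], min_le_right _ _⟩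
  set c : EuclideanSpace ℝ (Fin (k + 1)) → ℝ := fun x => 1 + x 0 / a with hc
  set T : EuclideanSpace ℝ (Fin (k + 1)) → ℝ := fun x => ‖tailProj k x‖ ^ 2 / c x ^ 2 with hT
  set Q : EuclideanSpace ℝ (Fin (k + 1)) → ℝ := fun x => T x ^ d * P (T x) ^ 2 with hQ
  have hcs : ContDiff ℝ ∞ c := by simp only [hc]; fun_prop
  have hC : Real.cos ε < 1 := by
    rw [← Real.cos_zero]
    exact Real.cos_lt_cos_of_nonneg_of_le_pi le_rfl (by
      linarith [min_le_right ε₀ (Real.pi / 2), Real.pi_pos]) hε0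
  refine ⟨Real.cos ε, hC, fun x => (a * ((1 - Q x) / (1 + Q x))) • axisVec k +
    (2 * P (T x) / ((1 + Q x) * c x ^ d)) • tailIncl k (H (tailProj k x)), fun x hx => ?_, ?_⟩
  · have hx' : Real.cos ε < x 0 / a := hx
    have hcx : 0 < c x := by simp only [hc]; linarith
    have hTx : ContDiffAt ℝ ∞ T x :=
      (((tailProj k).contDiff.norm_sq ℝ).contDiffAt).div (hcs.contDiffAt.pow 2) (by positivity)
    have hPT : ContDiffAt ℝ ∞ (fun x => P (T x)) x := hP.contDiffAt.comp x hTx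
    have hQx : ContDiffAt ℝ ∞ Q x := (hTx.pow d).mul (hPT.pow 2)
    have hT0 : 0 ≤ T x := by simp only [hT]; positivity
    have hQ0 : 0 ≤ Q x := by simp only [hQ]; positivity
    have h1Q : ContDiffAt ℝ ∞ (fun x => 1 + Q x) x := contDiffAt_const.add hQx
    have hHx : ContDiffAt ℝ ∞ (fun x => tailIncl k (H (tailProj k x))) x :=
      ((tailIncl k).contDiff.comp (hH.comp (tailProj k).contDiff)).contDiffAt
    refine ContDiffAt.contDiffWithinAt (ContDiffAt.add ?_ ?_)
    · exact (contDiffAt_const.mul ((contDiffAt_const.sub hQx).div h1Q (by positivity))).smul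
        contDiffAt_const
    · exact ((contDiffAt_const.mul hPT).div (h1Q.mul (hcs.contDiffAt.pow d))
        (by positivity)).smul hHx
  · intro s hs hsε' ζ hζ
    have hsε : s < ε := by
      by_contra! hle
      exact hsε'.not_ge (Real.cos_le_cos_of_nonneg_of_le_pi hε0.le hs.2 hle)
    have hcoss : 0 < Real.cos s := Real.cos_pos_of_mem_Ioo
      ⟨by linarith [hs.1, Real.pi_pos], hsε.trans_le (min_le_right _ _)⟩
    have hsins : 0 ≤ Real.sin s := Real.sin_nonneg_of_mem_Icc hs
    set t := Real.tan (s / 2) with ht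
    set h := t ^ d * P (t ^ 2) with hh
    have hfs : f s = 2 * Real.arctan h := hε s hs.1 (hsε.trans_le (min_le_left _ _))
    have hcv : c (polarVec a s ζ) = 1 + Real.cos s := by
      simp only [hc, polarVec_apply_zero]; rw [mul_div_cancel_left₀ _ ha]
    have htv : t = Real.sin s / (1 + Real.cos s) := tan_half_eq_sin_div s
    have hTv : T (polarVec a s ζ) = t ^ 2 := by
      simp only [hT]
      rw [hcv, tailProj_polarVec, norm_smul, hζ, mul_one, Real.norm_of_nonneg hsins, htv, div_pow]
    have hQv : Q (polarVec a s ζ) = h ^ 2 := by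
      simp only [hQ]; rw [hTv, hh]; ring
    have hHv : H (Real.sin s • ζ) = Real.sin s ^ d • V ζ := by
      rcases hsins.eq_or_lt with h0 | h0
      · rw [← h0, zero_smul, hH0, zero_pow (by omega), zero_smul]
      · exact hHV _ h0 ζ hζ
    beta_reduce
    rw [hQv, hTv, hcv, tailProj_polarVec, hHv, polarVec_eq, hfs, cos_two_mul_arctan,
      sin_two_mul_arctan, map_smul, smul_smul]
    congr 2
    rw [hh, htv]
    have : 0 < 1 + Real.cos s := by linarith
    rw [div_pow (Real.sin s) _ d]
    field_simp

/-- The map `(ψ, θ) ↦ (f(ψ), χ(θ))` is smooth if `χ` is an eigenmap and `f` a profile. -/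
theorem exists_isSmoothExtension_of_hasForm (hk : 2 ≤ k) (ha : a ≠ 0) (hd : 1 ≤ d)
    (hf : IsSmoothProfile k d a v f) (hV : IsSmoothExtension (sphereWeights k) χ V)
    (ht : ∀ x ∈ ellipsoid (sphereWeights k), tensionField (sphereWeights k) V x = 0)
    (he : ∀ x ∈ ellipsoid (sphereWeights k), normSqDiff (sphereWeights k) V x =
      (d : ℝ) * ((d : ℝ) + (k : ℝ) - 2))
    {u : ellipsoid (weightsE k a) → ellipsoid (weightsE k a)} (hu : HasForm ha u f χ) :
    ∃ U, IsSmoothExtension (weightsE k a) u U := by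
  obtain ⟨H, hH, hH0, hHV⟩ := exists_contDiff_homogeneous_extension hk hd hV ht he
  obtain ⟨C, hC, g, hg, hgf⟩ := exists_local_extension_pole ha hd hf hH hH0 hHV
  have hval : ∀ s ∈ Icc 0 Real.pi, ∀ ζ : ellipsoid (sphereWeights k),
      (u (polarE ha s ζ) : EuclideanSpace ℝ (Fin (k + 1))) = polarVec a (f s) (V ζ) :=
    fun s hs ζ => by rw [hu s hs, hV.2]; rfl
  refine exists_isSmoothExtension u fun x => ?_
  have hpolar : ∀ y : ellipsoid (weightsE k a), ∃ s ∈ Icc 0 Real.pi,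
      ∃ ζ : ellipsoid (sphereWeights k), polarE ha s ζ = y := fun y => by
    obtain ⟨s, hs, ζ, hζ, h⟩ := exists_polarVec_eq (by omega) ha y.2
    exact ⟨s, hs, ⟨ζ, mem_sphere_iff.2 hζ⟩, Subtype.ext h⟩
  obtain ⟨ψ, hψ, θ, rfl⟩ := hpolar x
  have hcosa : ∀ s : ℝ, a * Real.cos s / a = Real.cos s := fun s => mul_div_cancel_left₀ _ ha
  have hcont0 : Continuous fun x : EuclideanSpace ℝ (Fin (k + 1)) => x 0 / a := by fun_prop
  have hmemI : ∀ {s : ℝ}, s ∈ Icc 0 Real.pi → Real.pi - s ∈ Icc 0 Real.pi := fun hs =>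
    ⟨by linarith [hs.2], by linarith [hs.1]⟩
  rcases lt_or_ge C (Real.cos ψ) with hψ0 | hψ0
  · refine ⟨{x | C < x 0 / a}, (isOpen_lt continuous_const hcont0).mem_nhds ?_, g, hg,
      fun y hy => ?_⟩
    · change C < a * Real.cos ψ / a
      rwa [hcosa]
    · obtain ⟨s, hs, ζ, rfl⟩ := hpolar y
      rw [hval s hs]
      refine hgf s hs ?_ ζ (mem_sphere_iff.1 ζ.2)
      have h1 : C < a * Real.cos s / a := hy
      rwa [hcosa] at h1
  rcases lt_or_ge C (-Real.cos ψ) with hψ1 | hψ1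
  -- The other pole, by reflection.
  · let σ : EuclideanSpace ℝ (Fin (k + 1)) → EuclideanSpace ℝ (Fin (k + 1)) := fun x =>
      (-x 0) • axisVec k + tailIncl k (tailProj k x)
    have hσ : ContDiff ℝ ∞ σ := by simp only [σ]; fun_prop
    have hσp : ∀ s (ζ : EuclideanSpace ℝ (Fin k)), σ (polarVec a s ζ) = polarVec a (Real.pi - s) ζ :=
      fun s ζ => by
        simp only [σ]
        rw [polarVec_apply_zero, tailProj_polarVec, polarVec_eq, Real.cos_pi_sub, Real.sin_pi_sub,
          map_smul, mul_neg]
    refine ⟨{x | C < -(x 0 / a)}, (isOpen_lt continuous_const hcont0.neg).mem_nhds ?_,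
      fun x => σ (g (σ x)), ?_, fun y hy => ?_⟩
    · change C < -(a * Real.cos ψ / a)
      rwa [hcosa]
    · refine hσ.comp_contDiffOn (hg.comp hσ.contDiffOn fun x hx => ?_)
      have hx' : C < -(x 0 / a) := hx
      rw [mem_ofPred_eq]
      simpa [σ, neg_div] using hx'
    · obtain ⟨s, hs, ζ, rfl⟩ := hpolar y
      have h1 : C < -(a * Real.cos s / a) := hy
      rw [hcosa] at h1
      have h2 := hgf (Real.pi - s) (hmemI hs) (by rwa [Real.cos_pi_sub]) ζ (mem_sphere_iff.1 ζ.2)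
      beta_reduce
      rw [hval s hs, show ((polarE ha s ζ : ellipsoid (weightsE k a)) :
        EuclideanSpace ℝ (Fin (k + 1))) = polarVec a s ζ from rfl, hσp, h2, hσp,
        hf.map_pi_sub s hs, sub_sub_cancel]
  -- Away from the poles.
  · have hsinψ : 0 < Real.sin ψ := by
      refine Real.sin_pos_of_pos_of_lt_pi (hψ.1.lt_of_ne ?_) (hψ.2.lt_of_ne ?_)
      · rintro rfl; rw [Real.cos_zero] at hψ0; linarith
      · rintro rfl; rw [Real.cos_pi] at hψ1; linarith
    set W : Set (EuclideanSpace ℝ (Fin (k + 1))) := {x | |x 0 / a| < 1 ∧ tailProj k x ≠ 0} with hW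
    have hWo : IsOpen W :=
      (isOpen_lt hcont0.abs continuous_const).inter
        (isOpen_ne_fun (tailProj k).continuous continuous_const)
    have hWmem : ∀ s (ζ : ellipsoid (sphereWeights k)), polarVec a s ζ ∈ W ↔ Real.sin s ≠ 0 :=
      fun s ζ => by
        have hζ0 : (ζ : EuclideanSpace ℝ (Fin k)) ≠ 0 := by
          rw [← norm_ne_zero_iff, mem_sphere_iff.1 ζ.2]; exact one_ne_zero
        rw [hW, mem_ofPred_eq, polarVec_apply_zero, hcosa, tailProj_polarVec,
          smul_ne_zero_iff, and_iff_left hζ0, and_iff_right_iff_imp]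
        intro h
        rw [← sq_lt_one_iff_abs_lt_one, ← Real.sin_sq_add_cos_sq s]
        have : 0 < Real.sin s ^ 2 := by positivity
        linarith
    refine ⟨W, hWo.mem_nhds ((hWmem ψ θ).2 hsinψ.ne'), fun x => polarVec a
      (f (Real.arccos (x 0 / a))) (V (‖tailProj k x‖⁻¹ • tailProj k x)), fun x hx => ?_,
      fun y hy => ?_⟩
    · have hx1 := abs_lt.1 hx.1
      have hx0 : ContDiffAt ℝ ∞ (fun x : EuclideanSpace ℝ (Fin (k + 1)) => x 0 / a) x := by fun_prop
      have harc : ContDiffAt ℝ ∞ (fun x : EuclideanSpace ℝ (Fin (k + 1)) =>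
          Real.arccos (x 0 / a)) x :=
        ContDiffAt.comp (g := Real.arccos) x (Real.contDiffAt_arccos hx1.1.ne' hx1.2.ne) hx0
      have hmem : Real.arccos (x 0 / a) ∈ Ioo 0 Real.pi :=
        ⟨Real.arccos_pos.2 hx1.2, Real.arccos_lt_pi.2 hx1.1⟩
      have hfx : ContDiffAt ℝ ∞ (fun x : EuclideanSpace ℝ (Fin (k + 1)) =>
          f (Real.arccos (x 0 / a))) x :=
        ContDiffAt.comp (g := f) x (hf.contDiffOn.contDiffAt (isOpen_Ioo.mem_nhds hmem)) harc
      have hVx : ContDiffAt ℝ ∞ (fun x : EuclideanSpace ℝ (Fin (k + 1)) =>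
          V (‖tailProj k x‖⁻¹ • tailProj k x)) x :=
        ContDiffAt.comp (g := fun y : EuclideanSpace ℝ (Fin k) => V (‖y‖⁻¹ • y)) x
          (contDiffAt_comp_normalize hV hx.2) (tailProj k).contDiff.contDiffAt
      exact (contDiff_polarVec.contDiffAt.comp x (hfx.prodMk hVx)).contDiffWithinAt
    · obtain ⟨s, hs, ζ, rfl⟩ := hpolar y
      have hsin : Real.sin s ≠ 0 := (hWmem s ζ).1 hy
      have hsin0 : 0 < Real.sin s := (Real.sin_nonneg_of_mem_Icc hs).lt_of_ne hsin.symm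
      rw [hval s hs]
      change polarVec a (f (Real.arccos (a * Real.cos s / a)))
        (V (‖tailProj k (polarVec a s ζ)‖⁻¹ • tailProj k (polarVec a s ζ))) = _
      rw [hcosa, Real.arccos_cos hs.1 hs.2, tailProj_polarVec, norm_smul, mem_sphere_iff.1 ζ.2,
        mul_one, Real.norm_of_nonneg hsin0.le, inv_smul_smul₀ hsin]

end Extension

/-! ### Infinitely many harmonic self-maps -/

section HarmonicMaps

open Set Filter Topology
open scoped InnerProductSpace

variable {k d : ℕ} {a v w : ℝ} {f g : ℝ → ℝ}
  {χ : ellipsoid (sphereWeights k) → ellipsoid (sphereWeights k)}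

/-- The map defined by a profile and an eigenmap is harmonic. The tension field is continuous, so
that it vanishes at the poles as well. -/
theorem exists_harmonic_of_profile (hk : 2 ≤ k) (ha : a ≠ 0) (hd : 1 ≤ d)
    (hχ : IsEigenmap χ ((d : ℝ) * ((d : ℝ) + (k : ℝ) - 2))) (hf : IsSmoothProfile k d a v f) :
    ∃ u, IsHarmonicSelfMap (weightsE k a) u ∧ HasForm ha u f χ := by
  obtain ⟨V, hV, ht, he⟩ := hχ
  obtain ⟨l, hl⟩ := hf.isReducedSolution.right
  obtain ⟨u, hu⟩ := exists_hasForm (f := f) (by omega) ha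
    (by rw [hf.isReducedSolution.left, Real.sin_zero]) (by rw [hl, Real.sin_int_mul_pi]) χ
  obtain ⟨U, hU⟩ := exists_isSmoothExtension_of_hasForm hk ha hd hf hV ht he hu
  refine ⟨u, ⟨U, hU, fun x hx => ?_⟩, hu⟩
  obtain ⟨ψ, hψ, θ, hθ, rfl⟩ := exists_polarVec_eq (by omega) ha hx
  have hcont : Continuous fun s => tensionField (weightsE k a) U (polarVec a s θ) := by
    refine (continuousOn_tensionField hU).comp_continuous ?_ fun s =>
      polarVec_mem ha s (mem_sphere_iff.2 hθ)
    exact contDiff_polarVec.continuous.comp (by fun_prop : Continuous fun s : ℝ => (s, θ))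
  have heq : EqOn (fun s => tensionField (weightsE k a) U (polarVec a s θ)) (fun _ => 0)
      (Ioo 0 Real.pi) := fun s hs =>
    tensionField_polarVec_eq_zero ha hV ht he hf.isReducedSolution hU hu hs hθ
  have hcl := heq.closure hcont continuous_const
  rw [closure_Ioo Real.pi_pos.ne] at hcl
  exact hcl hψ

/-- The coefficient `v` of a profile is determined by the values of the profile, even modulo `2π`,
since `tan(f/2) = sin f / (1 + cos f)`. -/
theorem IsSmoothProfile.coeff_eq (hf : IsSmoothProfile k d a v f) (hg : IsSmoothProfile k d a w g)
    (hcos : ∀ ψ ∈ Icc 0 Real.pi, Real.cos (f ψ) = Real.cos (g ψ))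
    (hsin : ∀ ψ ∈ Icc 0 Real.pi, Real.sin (f ψ) = Real.sin (g ψ)) : v = w := by
  obtain ⟨P, hP, rfl, hPf⟩ := hf.pole
  obtain ⟨Q, hQ, rfl, hQg⟩ := hg.pole
  have harc : ∀ h : ℝ, h = Real.sin (2 * Real.arctan h) / (1 + Real.cos (2 * Real.arctan h)) :=
    fun h => by
      rw [← tan_half_eq_sin_div, mul_div_cancel_left₀ _ two_ne_zero, Real.tan_arctan]
  have hev : ∀ᶠ ψ in 𝓝[>] (0 : ℝ), P (Real.tan (ψ / 2) ^ 2) = Q (Real.tan (ψ / 2) ^ 2) := by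
    filter_upwards [nhdsWithin_mono 0 Ioi_subset_Ici_self hPf,
      nhdsWithin_mono 0 Ioi_subset_Ici_self hQg, Ioo_mem_nhdsGT Real.pi_pos] with ψ h1 h2 hψ
    have hI := Ioo_subset_Icc_self hψ
    have h3 := harc (Real.tan (ψ / 2) ^ d * P (Real.tan (ψ / 2) ^ 2))
    rw [← h1, hcos ψ hI, hsin ψ hI, h2, ← harc] at h3
    exact mul_left_cancel₀ (pow_ne_zero d (tan_half_pos hψ).ne') h3
  have ht : Tendsto (fun ψ : ℝ => Real.tan (ψ / 2) ^ 2) (𝓝[>] 0) (𝓝 0) := by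
    have hc : ContinuousAt (fun ψ : ℝ => Real.tan (ψ / 2)) 0 :=
      ContinuousAt.comp (g := Real.tan) (f := fun ψ : ℝ => ψ / 2)
        (Real.continuousAt_tan.2 (by simp)) (by fun_prop)
    have h : Tendsto (fun ψ : ℝ => Real.tan (ψ / 2) ^ 2) (𝓝 0) (𝓝 (Real.tan (0 / 2) ^ 2)) :=
      (hc.pow 2).tendsto
    rw [zero_div, Real.tan_zero, zero_pow two_ne_zero] at h
    exact h.mono_left nhdsWithin_le_nhds
  exact tendsto_nhds_unique ((hP.continuous.tendsto 0).comp ht)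
    (((hQ.continuous.tendsto 0).comp ht).congr' (hev.mono fun ψ h => h.symm))

theorem HasForm.sin_cos_eq (ha : a ≠ 0) {u : ellipsoid (weightsE k a) → ellipsoid (weightsE k a)}
    (hk : 1 ≤ k) (hf : HasForm ha u f χ) (hg : HasForm ha u g χ) {ψ : ℝ}
    (hψ : ψ ∈ Icc 0 Real.pi) :
    Real.cos (f ψ) = Real.cos (g ψ) ∧ Real.sin (f ψ) = Real.sin (g ψ) := by
  let θ : ellipsoid (sphereWeights k) :=
    ⟨EuclideanSpace.single ⟨0, by omega⟩ 1, mem_sphere_iff.2 (by simp)⟩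
  have h := congrArg Subtype.val ((hf ψ hψ θ).symm.trans (hg ψ hψ θ))
  obtain ⟨h1, h2⟩ := (polarVec_eq_polarVec_iff ha).1 h
  refine ⟨h1, smul_left_injective ℝ ?_ h2⟩
  rw [← norm_ne_zero_iff, mem_sphere_iff.1 (χ θ).2]
  exact one_ne_zero

theorem infinite_reducedSolutions
    (hinf : {v : ℝ | ∃ f, IsSmoothProfile k d a v f}.Infinite) :
    ((Icc 0 Real.pi).domRestrict '' {f : ℝ → ℝ | IsReducedSolution k d a f}).Infinite := by
  choose! F hF using fun (v : ℝ) (hv : v ∈ {v : ℝ | ∃ f, IsSmoothProfile k d a v f}) => hv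
  refine infinite_of_injOn_mapsTo (f := fun v => (Icc 0 Real.pi).domRestrict (F v))
    (fun v hv w hw h => ?_) (fun v hv => mem_image_of_mem _ (hF v hv).isReducedSolution) hinf
  have hval : ∀ ψ ∈ Icc 0 Real.pi, F v ψ = F w ψ := fun ψ hψ => congrFun h ⟨ψ, hψ⟩
  exact (hF v hv).coeff_eq (hF w hw) (fun ψ hψ => by rw [hval ψ hψ]) fun ψ hψ => by rw [hval ψ hψ]

theorem infinite_harmonic_hasForm (hk : 2 ≤ k) (ha : a ≠ 0) (hd : 1 ≤ d)
    (hinf : {v : ℝ | ∃ f, IsSmoothProfile k d a v f}.Infinite)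
    (hχ : IsEigenmap χ ((d : ℝ) * ((d : ℝ) + (k : ℝ) - 2))) :
    {u : ellipsoid (weightsE k a) → ellipsoid (weightsE k a) |
      IsHarmonicSelfMap (weightsE k a) u ∧
        ∃ f : ℝ → ℝ, IsReducedSolution k d a f ∧ HasForm ha u f χ}.Infinite := by
  choose! F hF using fun (v : ℝ) (hv : v ∈ {v : ℝ | ∃ f, IsSmoothProfile k d a v f}) => hv
  have : Nonempty (ellipsoid (weightsE k a) → ellipsoid (weightsE k a)) := ⟨id⟩
  choose! u hu huF using fun (v : ℝ) (hv : v ∈ {v : ℝ | ∃ f, IsSmoothProfile k d a v f}) =>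
    exists_harmonic_of_profile hk ha hd hχ (hF v hv)
  refine infinite_of_injOn_mapsTo (f := u) (fun v hv w hw h => ?_)
    (fun v hv => ⟨hu v hv, F v, (hF v hv).isReducedSolution, huF v hv⟩) hinf
  have h1 := huF v hv
  rw [h] at h1
  exact (hF v hv).coeff_eq (hF w hw)
    (fun ψ hψ => (h1.sin_cos_eq ha (by omega) (huF w hw) hψ).1)
    fun ψ hψ => (h1.sin_cos_eq ha (by omega) (huF w hw) hψ).2

/-- A self-map that is the restriction of a linear map commuting with the weights is totally
geodesic. -/
theorem isHarmonicSelfMap_of_linear {n : ℕ} {c : Fin n → ℝ} {u : ellipsoid c → ellipsoid c}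
    (L : EuclideanSpace ℝ (Fin n) →L[ℝ] EuclideanSpace ℝ (Fin n))
    (hL : ∀ x, normalVec c (L x) = L (normalVec c x)) (hu : ∀ x, (u x : EuclideanSpace ℝ (Fin n)) = L x) :
    IsHarmonicSelfMap c u := by
  refine ⟨L, ⟨⟨univ, isOpen_univ, subset_univ _, L.contDiff.contDiffOn⟩, fun x => (hu x).symm⟩,
    fun x hx => Finset.sum_eq_zero fun i _ => ?_⟩
  have h1 : fderiv ℝ (L : EuclideanSpace ℝ (Fin n) → EuclideanSpace ℝ (Fin n)) = fun _ => L :=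
    funext fun y => L.fderiv
  rw [covHessian_eq L.contDiff.contDiffAt hx (Subtype.mem _), ambientHessian_apply, h1,
    fderiv_const_apply, zero_apply, zero_apply, zero_sub, ← neg_smul, ← hL,
    tangentProj_smul_normalVec]

/-- The reflections in the hyperplanes that contain the axis of rotation are isometries of the
ellipsoid. -/
theorem infinite_harmonic_reflections (hk : 2 ≤ k) :
    {u : ellipsoid (weightsE k a) → ellipsoid (weightsE k a) |
      IsHarmonicSelfMap (weightsE k a) u}.Infinite := by
  set e₁ : EuclideanSpace ℝ (Fin k) := EuclideanSpace.single ⟨0, by omega⟩ 1 with he₁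
  set e₂ : EuclideanSpace ℝ (Fin k) := EuclideanSpace.single ⟨1, by omega⟩ 1 with he₂
  have h1 : ‖e₁‖ = 1 := by simp [he₁]
  have h2 : ‖e₂‖ = 1 := by simp [he₂]
  have h12 : ⟪e₁, e₂⟫_ℝ = 0 := by simp [he₁, he₂, EuclideanSpace.inner_single_left]
  set n : ℝ → EuclideanSpace ℝ (Fin k) := greatCircle e₁ e₂ with hn
  have hn1 : ∀ t, ‖n t‖ = 1 := norm_greatCircle h1 h2 h12
  let L : ℝ → EuclideanSpace ℝ (Fin (k + 1)) →L[ℝ] EuclideanSpace ℝ (Fin (k + 1)) := fun t =>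
    ContinuousLinearMap.id ℝ _ -
      (2 : ℝ) • (innerSL ℝ (tailIncl k (n t))).smulRight (tailIncl k (n t))
  have hLx : ∀ t x, L t x = x - (2 * ⟪tailIncl k (n t), x⟫_ℝ) • tailIncl k (n t) := fun t x => by
    simp [L, smul_smul]
  have hinner : ∀ y z : EuclideanSpace ℝ (Fin k), ⟪tailIncl k y, tailIncl k z⟫_ℝ = ⟪y, z⟫_ℝ :=
    fun y z => by simpa using inner_axis_tail 0 0 y z
  have hNt : ∀ y : EuclideanSpace ℝ (Fin k), normalVec (weightsE k a) (tailIncl k y) =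
      tailIncl k y := fun y => by simpa using normalVec_axis_tail (a := a) 0 y
  have hNi : ∀ y x, ⟪tailIncl k y, normalVec (weightsE k a) x⟫_ℝ = ⟪tailIncl k y, x⟫_ℝ :=
    fun y x => by rw [real_inner_comm, inner_normalVec_comm, hNt, real_inner_comm]
  have hLN : ∀ t x, normalVec (weightsE k a) (L t x) = L t (normalVec (weightsE k a) x) :=
    fun t x => by
      rw [hLx, hLx, ← normalCLM_apply, ← normalCLM_apply, map_sub, map_smul, normalCLM_apply,
        normalCLM_apply, hNt, hNi]
  have hLL : ∀ t x y, ⟪L t x, L t y⟫_ℝ = ⟪x, y⟫_ℝ := fun t x y => by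
    rw [hLx, hLx, inner_sub_left, inner_sub_right, inner_sub_right, inner_smul_left,
      inner_smul_right, inner_smul_right, inner_smul_left, hinner, real_inner_self_eq_norm_sq, hn1,
      real_inner_comm x]
    simp only [conj_trivial]
    ring
  have hmem : ∀ t, ∀ x ∈ ellipsoid (weightsE k a), L t x ∈ ellipsoid (weightsE k a) :=
    fun t x hx => by
      rw [mem_ellipsoid_iff, hLN, hLL]; exact inner_normalVec_self hx
  have hinf : (Icc 0 (Real.pi / 2)).Infinite := Icc_infinite (by positivity)
  refine infinite_of_injOn_mapsTo (f := fun t x => ⟨L t x, hmem t x x.2⟩) (fun s hs t ht h => ?_)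
    (fun t _ => isHarmonicSelfMap_of_linear (L t) (hLN t) fun x => rfl) hinf
  -- The image of the first coordinate vector determines the hyperplane.
  have hp : tailIncl k e₁ ∈ ellipsoid (weightsE k a) := by
    rw [mem_ellipsoid_iff, hNt, hinner, real_inner_self_eq_norm_sq, h1, one_pow]
  have h3 := congrArg (fun x : ellipsoid (weightsE k a) => ⟪tailIncl k e₁, x⟫_ℝ)
    (congrFun h ⟨_, hp⟩)
  have h4 : ∀ t, ⟪n t, e₁⟫_ℝ = Real.cos t := fun t => by
    rw [hn, greatCircle, inner_add_left, inner_smul_left, inner_smul_left,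
      real_inner_self_eq_norm_sq, h1, real_inner_comm, h12]
    simp
  simp only [hLx, inner_sub_right, inner_smul_right, hinner, h4, real_inner_comm (n _) e₁] at h3
  have h5 : Real.cos s ^ 2 = Real.cos t ^ 2 := by linarith
  have hpi : ∀ {r}, r ∈ Icc 0 (Real.pi / 2) → r ∈ Icc 0 Real.pi ∧ 0 ≤ Real.cos r := fun hr =>
    ⟨⟨hr.1, by linarith [hr.2, Real.pi_pos]⟩,
      Real.cos_nonneg_of_mem_Icc ⟨by linarith [hr.1, Real.pi_pos], hr.2⟩⟩
  refine Real.injOn_cos (hpi hs).1 (hpi ht).1 ?_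
  exact (pow_left_inj₀ (hpi hs).2 (hpi ht).2 two_ne_zero).1 h5

end HarmonicMaps

theorem theorem1 (k d : ℕ) (hk : 3 ≤ k) (a : ℝ) (ha : a ≠ 0)
    (hsmall : a ^ 2 < 4 * (d : ℝ) * ((d : ℝ) + (k : ℝ) - 2) / ((k : ℝ) - 2) ^ 2) :
    -- the ellipsoid admits infinitely many harmonic self-maps
    {u : ellipsoid (weightsE k a) → ellipsoid (weightsE k a) |
        IsHarmonicSelfMap (weightsE k a) u}.Infinite ∧
    -- the reduced boundary value problem has infinitely many solutions on `[0, π]`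
    ((Set.Icc 0 Real.pi).domRestrict '' {f : ℝ → ℝ | IsReducedSolution k d a f}).Infinite ∧
    -- for each eigenmap of degree `d`, infinitely many harmonic self-maps have the stated form
    ∀ χ : ellipsoid (sphereWeights k) → ellipsoid (sphereWeights k),
      IsEigenmap χ ((d : ℝ) * ((d : ℝ) + (k : ℝ) - 2)) →
        {u : ellipsoid (weightsE k a) → ellipsoid (weightsE k a) |
          IsHarmonicSelfMap (weightsE k a) u ∧
            ∃ f : ℝ → ℝ, IsReducedSolution k d a f ∧ HasForm ha u f χ}.Infinite := by
  have hd : 1 ≤ d := by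
    by_contra! h
    obtain rfl : d = 0 := by omega
    have : 0 < a ^ 2 := by positivity
    simp at hsmall
    linarith
  have hinf := infinite_isSmoothProfile hk ha hsmall
  have hthird := fun χ (hχ : IsEigenmap χ ((d : ℝ) * ((d : ℝ) + (k : ℝ) - 2))) =>
    infinite_harmonic_hasForm (by omega) ha hd hinf hχ
  refine ⟨?_, infinite_reducedSolutions hinf, hthird⟩
  -- Without an eigenmap of degree `d` the isometries remain.
  by_cases h : ∃ χ : ellipsoid (sphereWeights k) → ellipsoid (sphereWeights k),
      IsEigenmap χ ((d : ℝ) * ((d : ℝ) + (k : ℝ) - 2))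
  · obtain ⟨χ, hχ⟩ := h
    exact (hthird χ hχ).mono fun u hu => hu.1
  · exact infinite_harmonic_reflections (by omega)
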